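/- Let $\Omega\subset\mathbb R^2$ be a compact strictly convex billiard table with the origin in its interior, $h_\Omega(\psi)=\max_{(x,y)\in\Omega}(x\cos\psi+y\sin\psi)$ its support function, $\gamma_\Omega(\psi)$ the boundary point with outer unit normal $(\cos\psi,\sin\psi)$, and $k_\Omega=1/(h_\Omega+h_\Omega'')$ its curvature. A closed convex curve in the interior of $\Omega$ is a 4-rationally integrable caustic (a 4-caustic) if every billiard orbit with one segment tangent to it has all its segments tangent to it, and all these orbits, up to reversal, are $(1,4)$-periodic, i.e. close up after 4 bounces and one turn around the boundary. A 4-loop is an orbit segment which starts at a boundary point, goes counterclockwise around the table exactly once and is back at its starting point after 4 bounces (at any angle). If exactly one 4-loop starts at each point $\gamma_\Omega(\psi)$, its initial angle $d_\Omega(\psi)\in(0,\pi)$ with the positive tangent is called the 4-loop angle function of $\Omega$. Let $\kappa_0>0$, $\kappa_1$ and $M$ be real numbers. There are $\varepsilon_1>0$ and $C>0$, depending only on $\kappa_0,\kappa_1,M$, such that the following holds for every $m\ge 40$. Let $\Omega_0$ be a table that is centrally symmetric about the origin, with $h_0=h_{\Omega_0}\in C^m$, $\|h_0\|_{C^m}<M$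 and $\kappa_0<k_{\Omega_0}<\kappa_1$. Then there is $R_0>0$ (depending only on $\Omega_0$ and $m$) such that, for every table $\Omega_\varepsilon$ with $h_\varepsilon=h_{\Omega_\varepsilon}\in C^m$, $\|h_\varepsilon\|_{C^m}<2M$ and $\varepsilon:=\|h_\varepsilon-h_0\|_{C^5}<\varepsilon_1$ that admits a 4-caustic, the 4-loop angle function $d_\varepsilon=d_{\Omega_\varepsilon}$ is well defined and, writing $O_n(\varepsilon)$ for a function of $\psi\in\mathbb R$ of class $C^n$ with $C^n$ norm at most $C\varepsilon$: (i) $d_\varepsilon(\psi+\pi)=d_\varepsilon(\psi)+O_3(\varepsilon)$. From each $\gamma_{\Omega_\varepsilon}(\psi)$ there starts exactly one $(1,4)$-periodic orbit, with initial angle $d_\varepsilon(\psi)$, and its four vertices, as functions of $\psi$, are $O_2(\varepsilon)$-close to the vertices of a parallelogram. (ii) The tangent lines to $\partial\Omega_\varepsilon$ at consecutive vertices of this orbit meet in four points which, as functions of $\psi$, are $O_2(\varepsilon)$-close to the vertices of a rectangle. (iii) $d_\varepsilon(\psi+\tfrac{\pi}{2})=\tfrac{\pi}{2}-d_\varepsilon(\psi)+O_2(\varepsilon)$.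 (iv) $h_\varepsilon(\psi)^2+h_\varepsilon(\psi+\tfrac{\pi}{2})^2=R_0^2+O_3(\varepsilon)$, $\ h_\varepsilon(\psi)=R_0\sin d_\varepsilon(\psi)+O_2(\varepsilon)$ and $h_\varepsilon(\psi+\tfrac{\pi}{2})=R_0\cos d_\varepsilon(\psi)+O_2(\varepsilon)$. -/

import Mathlib

open Real Set

noncomputable section

/-- The Euclidean plane. -/
abbrev Plane : Type := EuclideanSpace ℝ (Fin 2)

/-- The closed region of a billiard table: compact, strictly convex, the origin inside. -/
structure IsTable (Ω : Set Plane) : Prop where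
  isCompact : IsCompact Ω
  strictConvex : StrictConvex ℝ Ω
  origin_mem : (0 : Plane) ∈ interior Ω

/-- The support function `h_Ω(ψ) = sup {x cos ψ + y sin ψ : (x, y) ∈ Ω}`. -/
def supportFn (Ω : Set Plane) (ψ : ℝ) : ℝ :=
  sSup ((fun x : Plane => x 0 * cos ψ + x 1 * sin ψ) '' Ω)

/-- The boundary point `γ_Ω(ψ)` whose outer unit normal is `(cos ψ, sin ψ)`. -/
def bdryPoint (Ω : Set Plane) (ψ : ℝ) : Plane :=
  !₂[supportFn Ω ψ * cos ψ - deriv (supportFn Ω) ψ * sin ψ,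
     supportFn Ω ψ * sin ψ + deriv (supportFn Ω) ψ * cos ψ]

/-- The positive (counterclockwise) unit tangent at `γ_Ω(ψ)`. -/
def unitTangent (ψ : ℝ) : Plane := !₂[-sin ψ, cos ψ]

/-- The tangent line to `∂Ω` at `γ_Ω(ψ)`. -/
def tangentLine (Ω : Set Plane) (ψ : ℝ) : Set Plane :=
  {x | ∃ s : ℝ, x = bdryPoint Ω ψ + s • unitTangent ψ}

/-- The curvature `k_Ω = 1 / (h_Ω + h_Ω'')` of `∂Ω`, in the parameter `ψ`. -/
def curvature (Ω : Set Plane) (ψ : ℝ) : ℝ :=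
  (supportFn Ω ψ + iteratedDeriv 2 (supportFn Ω) ψ)⁻¹

/-- The `C^n` norm: the largest supremum of a derivative of order at most `n`
(used for periodic functions of class `C^n` only). -/
def cNorm (n : ℕ) (f : ℝ → ℝ) : ℝ :=
  ⨆ k : Fin (n + 1), ⨆ x : ℝ, |iteratedDeriv (k : ℕ) f x|

/-- `f` is of class `C^n` with `C^n` norm at most `B`. -/
def CBound {F : Type*} [NormedAddCommGroup F] [NormedSpace ℝ F]
    (n : ℕ) (B : ℝ) (f : ℝ → F) : Prop :=
  ContDiff ℝ n f ∧ ∀ k : ℕ, k ≤ n → ∀ x : ℝ, ‖iteratedDeriv k f x‖ ≤ B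

/-- The graph of the billiard map, lifted to the universal cover of the phase space. A state
`(ψ, θ)` is the point `γ_Ω(ψ)` with an inward direction at angle `θ` from the positive tangent.
The chord from `γ_Ω(ψ)` to `γ_Ω(ψ')` leaves at angle `θ` and arrives at angle `θ'`, which is the
angle at which it is reflected. -/
def BilliardStep (Ω : Set Plane) (a b : ℝ × ℝ) : Prop :=
  a.1 < b.1 ∧ b.1 < a.1 + 2 * π ∧
  a.2 = InnerProductGeometry.angle (unitTangent a.1) (bdryPoint Ω b.1 - bdryPoint Ω a.1) ∧
  b.2 = InnerProductGeometry.angle (unitTangent b.1) (bdryPoint Ω b.1 - bdryPoint Ω a.1)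

/-- A (lifted, bi-infinite) billiard orbit. -/
def IsOrbit (Ω : Set Plane) (z : ℤ → ℝ × ℝ) : Prop :=
  ∀ k : ℤ, BilliardStep Ω (z k) (z (k + 1))

/-- A lifted orbit is `(p, q)`-periodic: it closes up after `q` bounces, having gone `p` times
around the boundary. -/
def IsPeriodicOrbit (p q : ℕ) (z : ℤ → ℝ × ℝ) : Prop :=
  ∀ k : ℤ, z (k + q) = ((z k).1 + 2 * π * p, (z k).2)

/-- The segment from `x` to `y` touches the convex curve `∂K`. -/
def SegmentTangent (K : Set Plane) (x y : Plane) : Prop :=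
  (segment ℝ x y ∩ frontier K).Nonempty ∧ Disjoint (segment ℝ x y) (interior K)

/-- The `k`-th segment of the orbit `z` is tangent to `∂K`. -/
def OrbitTangentAt (Ω K : Set Plane) (z : ℤ → ℝ × ℝ) (k : ℤ) : Prop :=
  SegmentTangent K (bdryPoint Ω (z k).1) (bdryPoint Ω (z (k + 1)).1)

/-- The closed convex curve `∂K` inside the table is a caustic: an orbit with one segment
tangent to it has all its segments tangent to it. -/
structure IsCaustic (Ω K : Set Plane) : Prop where
  isCompact : IsCompact K
  convex : Convex ℝ K
  interior_nonempty : (interior K).Nonempty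
  subset_interior : K ⊆ interior Ω
  tangent : ∀ z, IsOrbit Ω z → ∀ j, OrbitTangentAt Ω K z j → ∀ k, OrbitTangentAt Ω K z k

/-- The caustic `∂K` is `q`-rationally integrable: all its tangential orbits are
`(1, q)`-periodic. The lift always advances counterclockwise, so that a `(1, q)`-periodic orbit
run through clockwise reads as a `(q - 1, q)`-periodic one. -/
def IsRationalCaustic (q : ℕ) (Ω K : Set Plane) : Prop :=
  IsCaustic Ω K ∧ ∀ z, IsOrbit Ω z → (∀ k, OrbitTangentAt Ω K z k) →
    IsPeriodicOrbit 1 q z ∨ IsPeriodicOrbit (q - 1) q z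

/-- The orbit starting at `γ_Ω(ψ)` with angle `θ` is a `q`-loop: after `q` bounces it is back at
its starting point (at any angle), having gone around the boundary exactly once. -/
def IsLoop (Ω : Set Plane) (q : ℕ) (ψ θ : ℝ) : Prop :=
  ∃ z : ℕ → ℝ × ℝ, z 0 = (ψ, θ) ∧ (∀ k < q, BilliardStep Ω (z k) (z (k + 1))) ∧
    (z q).1 = ψ + 2 * π

/-- `d` is the `q`-loop angle function: from each `γ_Ω(ψ)` there starts exactly one `q`-loop, and
`d ψ ∈ (0, π)` is its initial angle. -/
def IsLoopAngle (Ω : Set Plane) (q : ℕ) (d : ℝ → ℝ) : Prop :=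
  ∀ ψ, d ψ ∈ Ioo 0 π ∧ ∀ θ, IsLoop Ω q ψ θ ↔ θ = d ψ

/-- `P 0, P 1, P 2, P 3` are the consecutive vertices of a (nondegenerate) parallelogram. -/
def IsParallelogram (P : Fin 4 → Plane) : Prop :=
  P 0 + P 2 = P 1 + P 3 ∧ AffineIndependent ℝ ![P 0, P 1, P 2]

/-- `P 0, P 1, P 2, P 3` are the consecutive vertices of a (nondegenerate) rectangle. -/
def IsRectangle (P : Fin 4 → Plane) : Prop :=
  IsParallelogram P ∧ inner ℝ (P 1 - P 0) (P 3 - P 0) = 0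

end

/-!
A 4-caustic gives a continuous invariant curve of 4-periodic orbits: from each boundary point
follow the leftmost tangent line to it. In terms of the normal angles of the chords, the orbit
equations are the critical point equations of a cyclic action. Their linearization along the curve
is a cyclic Jacobi system with a positive solution, given by the slopes of the curve; it is
therefore uniquely solvable, and the curve is as smooth as the table allows, with uniform bounds.

If the table is nearly centrally symmetric, the orbit reflected in the origin almost solves the same
equations; comparing it with the orbit of the curve that touches it from one side shows that it is
close to the curve, first uniformly and then, by the linearized equations, in `C⁴`. Hence opposite
vertices of an orbit are nearly antipodal, its sides are nearly parallel in pairs, and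
`d(ψ + π/2) ≈ π/2 - d(ψ)`. The tangent quadrilateral is then nearly a rectangle, whose squared
half-diagonal `h(ψ)² + h(ψ + π/2)²` has a derivative of order `ε` and so is nearly constant.
-/

open Filter Topology

namespace CBound

theorem zero_iff {B : ℝ} {f : ℝ → ℝ} : CBound 0 B f ↔ Continuous f ∧ ∀ x, |f x| ≤ B := by
  refine ⟨fun h => ⟨h.1.continuous, fun x => by simpa using h.2 0 le_rfl x⟩, fun h => ?_⟩
  refine ⟨contDiff_zero.2 h.1, fun k hk x => ?_⟩
  obtain rfl : k = 0 := by omega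
  simpa using h.2 x

theorem succ_iff {n : ℕ} {B : ℝ} {f : ℝ → ℝ} :
    CBound (n + 1) B f ↔ (∀ x, |f x| ≤ B) ∧ Differentiable ℝ f ∧ CBound n B (deriv f) := by
  have hsucc : ContDiff ℝ (n + 1 : ℕ) f ↔ Differentiable ℝ f ∧ ContDiff ℝ n (deriv f) := by
    rw [Nat.cast_add, Nat.cast_one, contDiff_succ_iff_deriv]
    simp
  constructor
  · rintro ⟨hf, hB⟩
    obtain ⟨hd, hf'⟩ := hsucc.1 hf
    refine ⟨fun x => by simpa using hB 0 (by omega) x, hd, hf', fun k hk x => ?_⟩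
    rw [← iteratedDeriv_succ']
    exact hB (k + 1) (by omega) x
  · rintro ⟨h0, hd, hf', hB⟩
    refine ⟨hsucc.2 ⟨hd, hf'⟩, fun k hk x => ?_⟩
    rcases k with _ | k
    · simpa using h0 x
    · rw [iteratedDeriv_succ']
      exact hB k (by omega) x

theorem abs_le {n : ℕ} {B : ℝ} {f : ℝ → ℝ} (h : CBound n B f) (x : ℝ) : |f x| ≤ B := by
  simpa using h.2 0 (Nat.zero_le n) x

@[gcongr]
theorem mono {F : Type*} [NormedAddCommGroup F] [NormedSpace ℝ F] {n k : ℕ} {B B' : ℝ}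
    {f : ℝ → F} (h : CBound n B f) (hk : k ≤ n) (hB : B ≤ B') : CBound k B' f :=
  ⟨h.1.of_le (by exact_mod_cast hk), fun j hj x => (h.2 j (hj.trans hk) x).trans hB⟩

theorem add {n : ℕ} {B B' : ℝ} {f g : ℝ → ℝ} (hf : CBound n B f) (hg : CBound n B' g) :
    CBound n (B + B') fun x => f x + g x := by
  refine ⟨hf.1.add hg.1, fun k hk x => ?_⟩
  have hk' : (k : WithTop ℕ∞) ≤ n := by exact_mod_cast hk
  rw [iteratedDeriv_fun_add (hf.1.of_le hk').contDiffAt (hg.1.of_le hk').contDiffAt]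
  exact (norm_add_le _ _).trans (add_le_add (hf.2 k hk x) (hg.2 k hk x))

theorem const_mul {n : ℕ} {B : ℝ} {f : ℝ → ℝ} (a : ℝ) (hf : CBound n B f) :
    CBound n (|a| * B) fun x => a * f x := by
  refine ⟨contDiff_const.mul hf.1, fun k hk x => ?_⟩
  rw [iteratedDeriv_const_mul_field, norm_mul]
  exact mul_le_mul_of_nonneg_left (hf.2 k hk x) (abs_nonneg a)

theorem comp_add_const {n : ℕ} {B : ℝ} {f : ℝ → ℝ} (hf : CBound n B f) (a : ℝ) :
    CBound n B fun x => f (x + a) := by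
  refine ⟨hf.1.comp (contDiff_id.add contDiff_const), fun k hk x => ?_⟩
  rw [congrFun (iteratedDeriv_comp_add_const k f a) x]
  exact hf.2 k hk _

theorem abs_sub_le {n : ℕ} {B : ℝ} {f : ℝ → ℝ} (hf : CBound (n + 1) B f) (x y : ℝ) :
    |f x - f y| ≤ B * |x - y| := by
  obtain ⟨-, hd, hB⟩ := succ_iff.1 hf
  exact Convex.norm_image_sub_le_of_norm_deriv_le (fun z _ => hd z)
    (fun z _ => by simpa using hB.abs_le z) convex_univ (mem_univ y) (mem_univ x)

theorem sin (n : ℕ) : CBound n 1 sin :=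
  ⟨contDiff_sin, fun k _ x => abs_iteratedDeriv_sin_le_one k x⟩

theorem cos (n : ℕ) : CBound n 1 cos :=
  ⟨contDiff_cos, fun k _ x => abs_iteratedDeriv_cos_le_one k x⟩

end CBound

/-- The notation `O_n(e)` for families of functions: along the filter `l` on the parameters `i`,
`F i` is of class `C^n` with `C^n` norm at most a constant times `|e i|`. For `e = 1` it says that
the family is bounded in `C^n`. -/
def UniformO {ι : Type*} (l : Filter ι) (n : ℕ) (e : ι → ℝ) (F : ι → ℝ → ℝ) : Prop :=
  ∃ C, 0 ≤ C ∧ ∀ᶠ i in l, CBound n (C * |e i|) (F i)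

/-- A family of functions that, along the filter `l` on the parameters, is bounded below by one
positive constant. Such families can be inverted within `UniformO l n 1`. -/
def UniformPos {ι : Type*} (l : Filter ι) (F : ι → ℝ → ℝ) : Prop :=
  ∃ c, 0 < c ∧ ∀ᶠ i in l, ∀ x, c ≤ F i x

namespace UniformO

variable {ι : Type*} {l : Filter ι} {n k : ℕ} {e : ι → ℝ} {F G X Y : ι → ℝ → ℝ}

theorem of_le (h : UniformO l n e F) (hk : k ≤ n) : UniformO l k e F := by
  obtain ⟨C, hC, h⟩ := h
  exact ⟨C, hC, h.mono fun i hi => hi.mono hk le_rfl⟩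

theorem congr' (h : UniformO l n e F) (hFG : ∀ᶠ i in l, ∀ x, F i x = G i x) :
    UniformO l n e G := by
  obtain ⟨C, hC, h⟩ := h
  refine ⟨C, hC, ?_⟩
  filter_upwards [h, hFG] with i hi hfg
  rwa [← show F i = G i from funext hfg]

theorem congr (h : UniformO l n e F) (hFG : ∀ i x, F i x = G i x) : UniformO l n e G :=
  h.congr' (Eventually.of_forall hFG)

theorem zero_of_abs_le {C : ℝ} (hF : ∀ᶠ i in l, Continuous (F i)) (hC : 0 ≤ C)
    (hB : ∀ᶠ i in l, ∀ x, |F i x| ≤ C * |e i|) : UniformO l 0 e F := by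
  refine ⟨C, hC, ?_⟩
  filter_upwards [hF, hB] with i hi hB using CBound.zero_iff.2 ⟨hi, hB⟩

protected theorem continuous (h : UniformO l n e F) : ∀ᶠ i in l, Continuous (F i) := by
  obtain ⟨C, -, h⟩ := h
  filter_upwards [h] with i hi using hi.1.continuous

protected theorem differentiable (h : UniformO l (n + 1) e F) :
    ∀ᶠ i in l, Differentiable ℝ (F i) := by
  obtain ⟨C, -, h⟩ := h
  filter_upwards [h] with i hi using (CBound.succ_iff.1 hi).2.1

protected theorem deriv (h : UniformO l (n + 1) e F) : UniformO l n e fun i => deriv (F i) := by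
  obtain ⟨C, hC, h⟩ := h
  refine ⟨C, hC, ?_⟩
  filter_upwards [h] with i hi using (CBound.succ_iff.1 hi).2.2

theorem exists_abs_le (h : UniformO l n e F) :
    ∃ C, 0 ≤ C ∧ ∀ᶠ i in l, ∀ x, |F i x| ≤ C * |e i| := by
  obtain ⟨C, hC, h⟩ := h
  refine ⟨C, hC, ?_⟩
  filter_upwards [h] with i hi x using hi.abs_le x

theorem exists_abs_sub_le (h : UniformO l (n + 1) e F) :
    ∃ C, 0 ≤ C ∧ ∀ᶠ i in l, ∀ x y, |F i x - F i y| ≤ C * |e i| * |x - y| := by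
  obtain ⟨C, hC, h⟩ := h
  refine ⟨C, hC, ?_⟩
  filter_upwards [h] with i hi x y using hi.abs_sub_le x y

theorem succ_of_hasDerivAt (h0 : UniformO l 0 e F)
    (hd : ∀ᶠ i in l, ∀ x, HasDerivAt (F i) (G i x) x) (hG : UniformO l n e G) :
    UniformO l (n + 1) e F := by
  obtain ⟨C, hC, h⟩ := h0
  obtain ⟨C', -, h'⟩ := hG
  refine ⟨max C C', le_max_of_le_left hC, ?_⟩
  filter_upwards [h, h', hd] with i h h' hd
  refine CBound.succ_iff.2 ⟨fun x => (h.abs_le x).trans ?_, fun x => (hd x).differentiableAt, ?_⟩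
  · gcongr
    exact le_max_left _ _
  · rw [show deriv (F i) = G i from funext fun x => (hd x).deriv]
    refine h'.mono le_rfl ?_
    gcongr
    exact le_max_right _ _

theorem add (hF : UniformO l n e F) (hG : UniformO l n e G) :
    UniformO l n e fun i x => F i x + G i x := by
  obtain ⟨C, hC, h⟩ := hF
  obtain ⟨C', hC', h'⟩ := hG
  refine ⟨C + C', by positivity, ?_⟩
  filter_upwards [h, h'] with i h h'
  rw [add_mul]
  exact h.add h'

theorem const_mul (a : ℝ) (hF : UniformO l n e F) : UniformO l n e fun i x => a * F i x := by
  obtain ⟨C, hC, h⟩ := hF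
  refine ⟨|a| * C, by positivity, ?_⟩
  filter_upwards [h] with i h
  rw [mul_assoc]
  exact h.const_mul a

theorem neg (hF : UniformO l n e F) : UniformO l n e fun i x => -F i x :=
  (hF.const_mul (-1)).congr fun i x => by ring

theorem sub (hF : UniformO l n e F) (hG : UniformO l n e G) :
    UniformO l n e fun i x => F i x - G i x :=
  (hF.add hG.neg).congr fun i x => by ring

theorem succ_of_hasDerivAt_of_periodic {C T : ℝ} (hT : 0 < T)
    (hper : ∀ᶠ i in l, Function.Periodic (F i) T) (hC : 0 ≤ C)
    (h0 : ∀ᶠ i in l, |F i 0| ≤ C * |e i|) (hd : ∀ᶠ i in l, ∀ x, HasDerivAt (F i) (G i x) x)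
    (hG : UniformO l n e G) : UniformO l (n + 1) e F := by
  obtain ⟨C', hC', hB⟩ := hG.exists_abs_le
  refine succ_of_hasDerivAt (zero_of_abs_le (C := C + C' * T) ?_ (by positivity) ?_) hd hG
  · filter_upwards [hd] with i hd using continuous_iff_continuousAt.2 fun x => (hd x).continuousAt
  · filter_upwards [hper, h0, hd, hB] with i hper h0 hd hB x
    obtain ⟨y, ⟨hy0, hyT⟩, hxy⟩ := hper.exists_mem_Ico₀ hT x
    have hlip : |F i y - F i 0| ≤ C' * |e i| * |y - 0| :=
      Convex.norm_image_sub_le_of_norm_hasDerivWithin_le (fun z _ => (hd z).hasDerivWithinAt)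
        (fun z _ => hB z) convex_univ (mem_univ 0) (mem_univ y)
    rw [sub_zero, abs_of_nonneg hy0] at hlip
    calc |F i x| ≤ |F i 0| + |F i y - F i 0| := by
          rw [hxy]
          simpa using abs_add_le (F i 0) (F i y - F i 0)
      _ ≤ C * |e i| + C' * |e i| * T :=
        add_le_add h0 (hlip.trans (mul_le_mul_of_nonneg_left hyT.le (by positivity)))
      _ = (C + C' * T) * |e i| := by ring

theorem const {a : ι → ℝ} {C : ℝ} (hC : 0 ≤ C) (h : ∀ᶠ i in l, |a i| ≤ C * |e i|) :
    UniformO l n e fun i _ => a i := by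
  refine ⟨C, hC, ?_⟩
  filter_upwards [h] with i hi
  refine ⟨contDiff_const, fun k _ x => ?_⟩
  rw [iteratedDeriv_const]
  split_ifs
  · exact hi
  · rw [norm_zero]
    positivity

theorem bdd_const (a : ℝ) : UniformO l n 1 fun (_ : ι) _ => a :=
  const (abs_nonneg a) (by simp)

theorem mul {e' : ι → ℝ} (hF : UniformO l n e F) (hG : UniformO l n e' G) :
    UniformO l n (e * e') fun i x => F i x * G i x := by
  induction n generalizing F G with
  | zero =>
    obtain ⟨C, hC, h⟩ := hF
    obtain ⟨C', hC', h'⟩ := hG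
    refine zero_of_abs_le (C := C * C') ?_ (by positivity) ?_
    · filter_upwards [h, h'] with i h h' using h.1.continuous.mul h'.1.continuous
    · filter_upwards [h, h'] with i h h' x
      rw [abs_mul, Pi.mul_apply, abs_mul, mul_mul_mul_comm]
      exact mul_le_mul (h.abs_le x) (h'.abs_le x) (abs_nonneg _) (by positivity)
  | succ n ih =>
    have hF₀ := hF.of_le n.le_succ
    have hG₀ := hG.of_le n.le_succ
    refine succ_of_hasDerivAt ((ih hF₀ hG₀).of_le n.zero_le) ?_
      ((ih hF.deriv hG₀).add (ih hF₀ hG.deriv))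
    filter_upwards [hF.differentiable, hG.differentiable] with i hF hG x
    exact (hF x).hasDerivAt.mul (hG x).hasDerivAt

theorem mul_bdd (hF : UniformO l n e F) (hG : UniformO l n 1 G) :
    UniformO l n e fun i x => F i x * G i x := by
  simpa using mul hF hG

theorem bdd_mul (hF : UniformO l n 1 F) (hG : UniformO l n e G) :
    UniformO l n e fun i x => F i x * G i x := by
  simpa using mul hF hG

theorem mul_sub_mul {F' G' : ι → ℝ → ℝ} (hF : UniformO l n 1 F) (hG' : UniformO l n 1 G')
    (hFF' : UniformO l n e fun i x => F i x - F' i x)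
    (hGG' : UniformO l n e fun i x => G i x - G' i x) :
    UniformO l n e fun i x => F i x * G i x - F' i x * G' i x :=
  ((hF.bdd_mul hGG').add (hFF'.mul_bdd hG')).congr fun i x => by ring

theorem inv (hF : UniformO l n 1 F) (hp : UniformPos l F) :
    UniformO l n 1 fun i x => (F i x)⁻¹ := by
  obtain ⟨c, hc, hp⟩ := hp
  induction n with
  | zero =>
    refine zero_of_abs_le (C := c⁻¹) ?_ (by positivity) ?_
    · filter_upwards [hF.continuous, hp] with i hF hp
      exact hF.inv₀ fun x => (hc.trans_le (hp x)).ne'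
    · filter_upwards [hp] with i hp x
      rw [abs_of_pos (inv_pos.2 (hc.trans_le (hp x))), Pi.one_apply, abs_one, mul_one]
      exact inv_anti₀ hc (hp x)
  | succ n ih =>
    have hinv := ih (hF.of_le n.le_succ)
    refine succ_of_hasDerivAt (hinv.of_le n.zero_le) ?_
      (hF.deriv.neg.mul_bdd (hinv.mul_bdd hinv))
    filter_upwards [hF.differentiable, hp] with i hF hp x
    refine ((hF x).hasDerivAt.inv (hc.trans_le (hp x)).ne').congr_deriv ?_
    rw [← mul_inv, ← sq, div_eq_mul_inv]

theorem div (hF : UniformO l n e F) (hG : UniformO l n 1 G) (hp : UniformPos l G) :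
    UniformO l n e fun i x => F i x / G i x :=
  (hF.mul_bdd (hG.inv hp)).congr fun i x => by rw [div_eq_mul_inv]

theorem of_mul_left (h : UniformO l n e fun i x => G i x * F i x) (hG : UniformO l n 1 G)
    (hp : UniformPos l G) : UniformO l n e F := by
  refine (h.div hG hp).congr' ?_
  obtain ⟨c, hc, hp⟩ := hp
  filter_upwards [hp] with i hi x using mul_div_cancel_left₀ _ (hc.trans_le (hi x)).ne'

section Comp

variable {c : ℝ}

theorem continuous_of_sub_linear (hX : UniformO l n 1 fun i x => X i x - c * x) :
    ∀ᶠ i in l, Continuous (X i) := by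
  filter_upwards [hX.continuous] with i hi
  exact (hi.add (continuous_const_mul c)).congr fun x => sub_add_cancel _ _

theorem differentiable_of_sub_linear (hX : UniformO l (n + 1) 1 fun i x => X i x - c * x) :
    ∀ᶠ i in l, Differentiable ℝ (X i) := by
  filter_upwards [hX.differentiable] with i hi
  simpa using hi.fun_add (differentiable_id.const_mul c)

theorem deriv_of_sub_linear (hX : UniformO l (n + 1) 1 fun i x => X i x - c * x) :
    UniformO l n 1 fun i => deriv (X i) := by
  refine (hX.deriv.add (bdd_const c)).congr' ?_
  filter_upwards [hX.differentiable_of_sub_linear] with i hi x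
  rw [((hi x).hasDerivAt.fun_sub ((hasDerivAt_id' x).const_mul c)).deriv]
  ring

theorem comp_of_sub_linear (hF : UniformO l n e F)
    (hX : UniformO l n 1 fun i x => X i x - c * x) : UniformO l n e fun i x => F i (X i x) := by
  have hcont := hX.continuous_of_sub_linear
  induction n generalizing F with
  | zero =>
    obtain ⟨C, hC, hB⟩ := hF.exists_abs_le
    refine zero_of_abs_le ?_ hC (hB.mono fun i hi x => hi _)
    filter_upwards [hF.continuous, hcont] with i hF hX using hF.comp hX
  | succ n ih =>
    have hX₀ := hX.of_le n.le_succ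
    refine succ_of_hasDerivAt ((ih (hF.of_le n.le_succ) hX₀).of_le n.zero_le) ?_
      ((ih hF.deriv hX₀).mul_bdd hX.deriv_of_sub_linear)
    filter_upwards [hF.differentiable, hX.differentiable_of_sub_linear] with i hF hX x
    exact (hF _).hasDerivAt.comp x (hX x).hasDerivAt

theorem comp_sub_comp_of_sub_linear (hF : UniformO l (n + 1) 1 F)
    (hX : UniformO l n 1 fun i x => X i x - c * x) (hY : UniformO l n 1 fun i x => Y i x - c * x)
    (hXY : UniformO l n e fun i x => X i x - Y i x) :
    UniformO l n e fun i x => F i (X i x) - F i (Y i x) := by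
  have hXc := hX.continuous_of_sub_linear
  have hYc := hY.continuous_of_sub_linear
  induction n generalizing F with
  | zero =>
    obtain ⟨C, hC, hlip⟩ := hF.exists_abs_sub_le
    obtain ⟨C', hC', hB⟩ := hXY.exists_abs_le
    refine zero_of_abs_le (C := C * C') ?_ (by positivity) ?_
    · filter_upwards [hF.continuous, hXc, hYc] with i hF hX hY using (hF.comp hX).sub (hF.comp hY)
    · filter_upwards [hlip, hB] with i hlip hB x
      calc |F i (X i x) - F i (Y i x)| ≤ C * |X i x - Y i x| := by simpa using hlip _ _
        _ ≤ C * C' * |e i| := by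
          rw [mul_assoc]
          exact mul_le_mul_of_nonneg_left (hB x) hC
  | succ n ih =>
    have hX₀ := hX.of_le n.le_succ
    have hY₀ := hY.of_le n.le_succ
    have hXY₀ := hXY.of_le n.le_succ
    have hXd := hX.differentiable_of_sub_linear
    have hYd := hY.differentiable_of_sub_linear
    have hXY' : UniformO l n e fun i x => deriv (X i) x - deriv (Y i) x := by
      refine hXY.deriv.congr' ?_
      filter_upwards [hXd, hYd] with i hX hY x using deriv_fun_sub (hX x) (hY x)
    refine succ_of_hasDerivAt ((ih (hF.of_le (n + 1).le_succ) hX₀ hY₀ hXY₀).of_le n.zero_le) ?_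
      (mul_sub_mul ((hF.deriv.of_le n.le_succ).comp_of_sub_linear hX₀) hY.deriv_of_sub_linear
        (ih hF.deriv hX₀ hY₀ hXY₀) hXY')
    filter_upwards [hF.differentiable, hXd, hYd] with i hF hX hY x
    exact ((hF _).hasDerivAt.comp x (hX x).hasDerivAt).sub
      ((hF _).hasDerivAt.comp x (hY x).hasDerivAt)

theorem comp (hF : UniformO l n e F) (hX : UniformO l n 1 fun i x => X i x - x) :
    UniformO l n e fun i x => F i (X i x) :=
  comp_of_sub_linear (c := 1) hF (by simpa using hX)

theorem comp_sub_comp (hF : UniformO l (n + 1) 1 F) (hX : UniformO l n 1 fun i x => X i x - x)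
    (hY : UniformO l n 1 fun i x => Y i x - x)
    (hXY : UniformO l n e fun i x => X i x - Y i x) :
    UniformO l n e fun i x => F i (X i x) - F i (Y i x) :=
  comp_sub_comp_of_sub_linear (c := 1) hF (by simpa using hX) (by simpa using hY) hXY

theorem comp_bdd (hF : UniformO l n e F) (hX : UniformO l n 1 X) :
    UniformO l n e fun i x => F i (X i x) :=
  comp_of_sub_linear (c := 0) hF (by simpa using hX)

theorem comp_bdd_sub_comp_bdd (hF : UniformO l (n + 1) 1 F) (hX : UniformO l n 1 X)
    (hY : UniformO l n 1 Y) (hXY : UniformO l n e fun i x => X i x - Y i x) :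
    UniformO l n e fun i x => F i (X i x) - F i (Y i x) :=
  comp_sub_comp_of_sub_linear (c := 0) hF (by simpa using hX) (by simpa using hY) hXY

end Comp

theorem bdd_sin : UniformO l n 1 fun _ : ι => sin :=
  ⟨1, zero_le_one, Eventually.of_forall fun _ => by simpa using CBound.sin n⟩

theorem bdd_cos : UniformO l n 1 fun _ : ι => cos :=
  ⟨1, zero_le_one, Eventually.of_forall fun _ => by simpa using CBound.cos n⟩

end UniformO

namespace UniformPos

variable {ι : Type*} {l : Filter ι} {F G H : ι → ℝ → ℝ}

theorem eventually_pos (hF : UniformPos l F) : ∀ᶠ i in l, ∀ x, 0 < F i x := by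
  obtain ⟨c, hc, h⟩ := hF
  filter_upwards [h] with i hi x using hc.trans_le (hi x)

theorem mul (hF : UniformPos l F) (hG : UniformPos l G) :
    UniformPos l fun i x => F i x * G i x := by
  obtain ⟨c, hc, h⟩ := hF
  obtain ⟨c', hc', h'⟩ := hG
  refine ⟨c * c', by positivity, ?_⟩
  filter_upwards [h, h'] with i h h' x
  exact mul_le_mul (h x) (h' x) hc'.le (hc.le.trans (h x))

theorem add (hF : UniformPos l F) (hG : UniformPos l G) :
    UniformPos l fun i x => F i x + G i x := by
  obtain ⟨c, hc, h⟩ := hF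
  obtain ⟨c', hc', h'⟩ := hG
  refine ⟨c + c', by positivity, ?_⟩
  filter_upwards [h, h'] with i h h' x using add_le_add (h x) (h' x)

theorem mono (hF : UniformPos l F) (h : ∀ᶠ i in l, ∀ x, F i x ≤ G i x) : UniformPos l G := by
  obtain ⟨c, hc, h'⟩ := hF
  refine ⟨c, hc, ?_⟩
  filter_upwards [h, h'] with i h h' x using (h' x).trans (h x)

theorem comp (hF : UniformPos l F) (X : ι → ℝ → ℝ) : UniformPos l fun i x => F i (X i x) := by
  obtain ⟨c, hc, h⟩ := hF
  exact ⟨c, hc, h.mono fun i hi x => hi _⟩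

theorem of_sub {n : ℕ} {e : ι → ℝ} (hF : UniformPos l F) (he : Tendsto e l (𝓝 0))
    (hFG : UniformO l n e fun i x => F i x - G i x) : UniformPos l G := by
  obtain ⟨c, hc, h⟩ := hF
  obtain ⟨C, -, h'⟩ := hFG.exists_abs_le
  have hlim : Tendsto (fun i => C * |e i|) l (𝓝 0) := by simpa using he.abs.const_mul C
  refine ⟨c / 2, by positivity, ?_⟩
  filter_upwards [h, h', hlim.eventually_lt_const (half_pos hc)] with i h h' hlt x
  linarith [h x, (abs_le.1 (h' x)).2]

theorem of_mul_ge (hH : UniformPos l H) (hG : UniformO l 0 1 G)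
    (hF : ∀ᶠ i in l, ∀ x, 0 ≤ F i x) (hFG : ∀ᶠ i in l, ∀ x, H i x ≤ F i x * G i x) :
    UniformPos l F := by
  obtain ⟨c, hc, hH⟩ := hH
  obtain ⟨C, hC, hG⟩ := hG.exists_abs_le
  refine ⟨c / (C + 1), by positivity, ?_⟩
  filter_upwards [hH, hG, hF, hFG] with i hH hG hF hFG x
  have hG' : G i x ≤ C + 1 := by
    have := (le_abs_self _).trans (hG x)
    simp only [Pi.one_apply, abs_one, mul_one] at this
    linarith
  rw [div_le_iff₀ (by positivity)]
  exact (hH x).trans ((hFG x).trans (mul_le_mul_of_nonneg_left hG' (hF x)))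

end UniformPos

theorem CBound.of_coords {n : ℕ} {B : ℝ} {f : ℝ → Plane} (h : ∀ j, CBound n B fun x => f x j) :
    CBound n (2 * B) f := by
  have hf : f = fun x => f x 0 • (!₂[1, 0] : Plane) + f x 1 • (!₂[0, 1] : Plane) := by
    funext x
    ext i
    fin_cases i <;> simp
  have hsmul (j : Fin 2) (v : Plane) : ContDiff ℝ n fun x => f x j • v :=
    (h j).1.smul contDiff_const
  have hle (v : Plane) (hv : ‖v‖ = 1) (j : Fin 2) {k : ℕ} (hk : k ≤ n) (x : ℝ) :
      ‖iteratedDeriv k (fun x => f x j • v) x‖ ≤ B := by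
    rw [iteratedDeriv_smul_const ((h j).1.of_le (by exact_mod_cast hk)).contDiffAt, norm_smul, hv,
      mul_one]
    exact (h j).2 k hk x
  refine ⟨by rw [hf]; exact (hsmul 0 _).add (hsmul 1 _), fun k hk x => ?_⟩
  have hk' : (k : WithTop ℕ∞) ≤ n := by exact_mod_cast hk
  rw [hf, iteratedDeriv_fun_add ((hsmul 0 _).of_le hk').contDiffAt
    ((hsmul 1 _).of_le hk').contDiffAt, two_mul]
  exact (norm_add_le _ _).trans (add_le_add (hle _ (by simp [EuclideanSpace.norm_eq]) 0 hk x)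
    (hle _ (by simp [EuclideanSpace.norm_eq]) 1 hk x))

section EventuallyCBound

variable {ι : Type*} {l : Filter ι} {n : ℕ} {e : ι → ℝ}

theorem UniformO.eventually_cBound {F : ι → ℝ → ℝ} (h : UniformO l n e F) :
    ∀ᶠ C in atTop, ∀ᶠ i in l, CBound n (C * |e i|) (F i) := by
  obtain ⟨C₀, -, h⟩ := h
  filter_upwards [eventually_ge_atTop C₀] with C hC
  filter_upwards [h] with i hi
    using hi.mono le_rfl (mul_le_mul_of_nonneg_right hC (abs_nonneg _))

theorem UniformO.eventually_cBound_of_coords {F : ι → ℝ → Plane}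
    (h : ∀ j, UniformO l n e fun i x => F i x j) :
    ∀ᶠ C in atTop, ∀ᶠ i in l, CBound n (C * |e i|) (F i) := by
  filter_upwards [(tendsto_id.atTop_div_const two_pos).eventually
    (eventually_all.2 fun j => (h j).eventually_cBound)] with C hC
  filter_upwards [eventually_all.2 hC] with i hi
  convert CBound.of_coords hi using 1
  simp only [id]
  ring

end EventuallyCBound

/-! ### Support functions, chords and orbits -/

/-- For the convex curve with support function `h`: the value of the linear form
`⟨·, (cos φ, sin φ)⟩` at the point with normal angle `x`. -/
noncomputable def supportAt (h : ℝ → ℝ) (x φ : ℝ) : ℝ := h x * cos (φ - x) + deriv h x * sin (φ - x)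

/-- A `C²` support function with positive radius of curvature `h + h''`, so that the normal angle
is a regular parameter of the boundary. -/
structure IsSmoothSupport (h : ℝ → ℝ) : Prop where
  contDiff : ContDiff ℝ 2 h
  periodic : Function.Periodic h (2 * π)
  pos : ∀ x, 0 < h x + deriv (deriv h) x

/-- The oriented chord from the point with normal angle `a` to the point with normal angle `b`,
where `φ` is the angle of its right-hand normal; the normal angles are lifted to `ℝ`. -/
structure IsChord (h : ℝ → ℝ) (a φ b : ℝ) : Prop where
  left : φ ∈ Ioo a (a + π)
  right : φ ∈ Ioo (b - π) b
  eq : supportAt h a φ = supportAt h b φ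

theorem supportAt_self (h : ℝ → ℝ) (x : ℝ) : supportAt h x x = h x := by simp [supportAt]

theorem supportAt_add_pi (h : ℝ → ℝ) (x φ : ℝ) : supportAt h x (φ + π) = -supportAt h x φ := by
  simp only [supportAt, show φ + π - x = φ - x + π by ring, sin_add_pi, cos_add_pi]
  ring

theorem periodic_deriv {h : ℝ → ℝ} {c : ℝ} (hp : Function.Periodic h c) :
    Function.Periodic (deriv h) c := fun x => by
  rw [← deriv_comp_add_const, show (fun x => h (x + c)) = h from funext hp]

theorem periodic_iteratedDeriv {f : ℝ → ℝ} {c : ℝ} (hf : Function.Periodic f c) (k : ℕ) :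
    Function.Periodic (iteratedDeriv k f) c := by
  induction k with
  | zero => simpa using hf
  | succ k ih =>
    rw [iteratedDeriv_succ]
    exact periodic_deriv ih

theorem CBound.cNorm {f : ℝ → ℝ} {n : ℕ} {T : ℝ} (hf : ContDiff ℝ n f) (hT : T ≠ 0)
    (hp : Function.Periodic f T) : CBound n (cNorm n f) f := by
  have hb (k : Fin (n + 1)) : BddAbove (range fun x => |iteratedDeriv (k : ℕ) f x|) := by
    have hc : Continuous fun x => |iteratedDeriv (k : ℕ) f x| :=
      (hf.continuous_iteratedDeriv k (by exact_mod_cast Nat.lt_succ_iff.1 k.2)).abs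
    have hper : Function.Periodic (fun x => |iteratedDeriv (k : ℕ) f x|) T :=
      (periodic_iteratedDeriv hp k).comp abs
    exact (hper.compact_of_continuous hT hc).bddAbove
  refine ⟨hf, fun k hk x => (le_ciSup (hb ⟨k, Nat.lt_succ_of_le hk⟩) x).trans ?_⟩
  exact le_ciSup (f := fun k : Fin (n + 1) => ⨆ x : ℝ, |iteratedDeriv (k : ℕ) f x|)
    (finite_range _).bddAbove ⟨k, Nat.lt_succ_of_le hk⟩

theorem mem_Ioo_zero_pi_of_sin_pos {x : ℝ} (hl : -π ≤ x) (hr : x ≤ 2 * π) (hx : 0 < sin x) :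
    x ∈ Ioo 0 π := by
  constructor
  · by_contra! h
    exact hx.not_ge (sin_nonpos_of_nonpos_of_neg_pi_le h hl)
  · by_contra! h
    rw [← sin_sub_two_pi] at hx
    exact hx.not_ge (sin_nonpos_of_nonpos_of_neg_pi_le (by linarith) (by linarith))

namespace IsChord

variable {h : ℝ → ℝ} {a φ b : ℝ} (hc : IsChord h a φ b)
include hc

theorem lt : a < b := hc.left.1.trans hc.right.2

theorem lt_add_two_pi : b < a + 2 * π := by linarith [hc.left.2, hc.right.1]

theorem sub_mul_sin (p q : ℝ) :
    (supportAt h b p - supportAt h a p) * sin (φ - q) =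
      (supportAt h b q - supportAt h a q) * sin (φ - p) := by
  have identity (x : ℝ) : supportAt h x p * sin (φ - q) =
      supportAt h x q * sin (φ - p) + supportAt h x φ * sin (p - q) := by
    simp only [supportAt, sin_sub, cos_sub]
    ring
  linear_combination identity b - identity a - sin (p - q) * hc.eq

end IsChord

namespace IsSmoothSupport

variable {h : ℝ → ℝ} (hh : IsSmoothSupport h)
include hh

theorem hasDerivAt (x : ℝ) : HasDerivAt h (deriv h x) x :=
  ((hh.contDiff.differentiable two_ne_zero) x).hasDerivAt

theorem hasDerivAt_deriv (x : ℝ) : HasDerivAt (deriv h) (deriv (deriv h) x) x := by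
  have hC : ContDiff ℝ (1 + 1) h := by simpa only [one_add_one_eq_two] using hh.contDiff
  exact (((contDiff_succ_iff_deriv.1 hC).2.2.differentiable one_ne_zero) x).hasDerivAt

theorem hasDerivAt_supportAt (φ x : ℝ) :
    HasDerivAt (fun x => supportAt h x φ) ((h x + deriv (deriv h) x) * sin (φ - x)) x := by
  have hsub : HasDerivAt (fun x => φ - x) (-1) x := by simpa using (hasDerivAt_id x).const_sub φ
  refine (((hh.hasDerivAt x).mul hsub.cos).add
    ((hh.hasDerivAt_deriv x).mul hsub.sin)).congr_deriv ?_
  ring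

theorem supportAt_add_two_pi (x φ : ℝ) : supportAt h (x + 2 * π) φ = supportAt h x φ := by
  simp only [supportAt, hh.periodic x, periodic_deriv hh.periodic x,
    show φ - (x + 2 * π) = φ - x - 2 * π by ring, sin_sub_two_pi, cos_sub_two_pi]

theorem continuous_supportAt (φ : ℝ) : Continuous fun x => supportAt h x φ :=
  continuous_iff_continuousAt.2 fun x => (hh.hasDerivAt_supportAt φ x).continuousAt

theorem strictMonoOn_supportAt (φ : ℝ) :
    StrictMonoOn (fun x => supportAt h x φ) (Icc (φ - π) φ) := by
  refine strictMonoOn_of_deriv_pos (convex_Icc _ _) (hh.continuous_supportAt φ).continuousOn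
    fun x hx => ?_
  rw [interior_Icc] at hx
  rw [(hh.hasDerivAt_supportAt φ x).deriv]
  exact mul_pos (hh.pos x) (sin_pos_of_pos_of_lt_pi (by linarith [hx.2]) (by linarith [hx.1]))

theorem strictAntiOn_supportAt (φ : ℝ) :
    StrictAntiOn (fun x => supportAt h x φ) (Icc φ (φ + π)) := by
  refine strictAntiOn_of_deriv_neg (convex_Icc _ _) (hh.continuous_supportAt φ).continuousOn
    fun x hx => ?_
  rw [interior_Icc] at hx
  rw [(hh.hasDerivAt_supportAt φ x).deriv]
  exact mul_neg_of_pos_of_neg (hh.pos x)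
    (sin_neg_of_neg_of_neg_pi_lt (by linarith [hx.1]) (by linarith [hx.2]))

theorem supportAt_lt_right {a b : ℝ} (hab : a < b) (hba : b < a + 2 * π) :
    supportAt h a b < h b := by
  rw [← supportAt_self h b]
  rcases le_total (b - π) a with ha | ha
  · exact hh.strictMonoOn_supportAt b ⟨ha, hab.le⟩ ⟨by linarith [pi_pos], le_rfl⟩ hab
  · rw [← hh.supportAt_add_two_pi a b]
    exact hh.strictAntiOn_supportAt b ⟨le_rfl, by linarith [pi_pos]⟩ ⟨hba.le, by linarith⟩ hba

theorem supportAt_lt_left {a b : ℝ} (hab : a < b) (hba : b < a + 2 * π) :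
    supportAt h b a < h a := by
  have hlt := hh.supportAt_lt_right hba (by linarith)
  rwa [hh.periodic, show a + 2 * π = a + π + π by ring, supportAt_add_pi, supportAt_add_pi,
    neg_neg] at hlt

theorem exists_isChord_right {a φ : ℝ} (hφ : φ ∈ Ioo a (a + π)) : ∃ b, IsChord h a φ b := by
  have hmono := hh.strictMonoOn_supportAt φ
  have ha : a ∈ Icc (φ - π) φ := ⟨by linarith [hφ.2], hφ.1.le⟩
  have hupper : supportAt h a φ < supportAt h φ φ :=
    hmono ha ⟨by linarith [pi_pos], le_rfl⟩ hφ.1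
  have hlower : supportAt h (φ + π) φ < supportAt h a φ := by
    rw [show φ + π = φ - π + 2 * π by ring, hh.supportAt_add_two_pi]
    exact hmono ⟨le_rfl, by linarith [pi_pos]⟩ ha (by linarith [hφ.2])
  obtain ⟨b, hb, heq⟩ := intermediate_value_Ioo' (by linarith [pi_pos] : φ ≤ φ + π)
    (hh.continuous_supportAt φ).continuousOn ⟨hlower, hupper⟩
  exact ⟨b, hφ, ⟨by linarith [hb.2], hb.1⟩, heq.symm⟩

theorem exists_isChord_left {b φ : ℝ} (hφ : φ ∈ Ioo (b - π) b) : ∃ a, IsChord h a φ b := by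
  have hanti := hh.strictAntiOn_supportAt φ
  have hb : b ∈ Icc φ (φ + π) := ⟨hφ.2.le, by linarith [hφ.1]⟩
  have hupper : supportAt h b φ < supportAt h φ φ :=
    hanti ⟨le_rfl, by linarith [pi_pos]⟩ hb hφ.2
  have hlower : supportAt h (φ - π) φ < supportAt h b φ := by
    rw [← hh.supportAt_add_two_pi, show φ - π + 2 * π = φ + π by ring]
    exact hanti hb ⟨by linarith [pi_pos], le_rfl⟩ (by linarith [hφ.1])
  obtain ⟨a, ha, heq⟩ := intermediate_value_Ioo (by linarith [pi_pos] : φ - π ≤ φ)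
    (hh.continuous_supportAt φ).continuousOn ⟨hlower, hupper⟩
  exact ⟨a, ⟨ha.2, by linarith [ha.1]⟩, hφ, heq⟩

theorem right_unique {a φ b b' : ℝ} (hb : IsChord h a φ b) (hb' : IsChord h a φ b') : b = b' :=
  (hh.strictAntiOn_supportAt φ).injOn ⟨hb.right.2.le, by linarith [hb.right.1]⟩
    ⟨hb'.right.2.le, by linarith [hb'.right.1]⟩ (hb.eq.symm.trans hb'.eq)

theorem left_unique {a a' φ b : ℝ} (ha : IsChord h a φ b) (ha' : IsChord h a' φ b) : a = a' :=
  (hh.strictMonoOn_supportAt φ).injOn ⟨by linarith [ha.left.2], ha.left.1.le⟩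
    ⟨by linarith [ha'.left.2], ha'.left.1.le⟩ (ha.eq.trans ha'.eq.symm)

theorem right_lt_right {a φ φ' b b' : ℝ} (hb : IsChord h a φ b) (hb' : IsChord h a φ' b')
    (hφ : φ < φ') : b < b' := by
  rcases lt_or_ge b φ' with hbφ | hbφ
  · exact hbφ.trans hb'.right.2
  have hsupp : supportAt h b a < supportAt h a a := by
    rw [supportAt_self]
    exact hh.supportAt_lt_left hb.lt hb.lt_add_two_pi
  have hsin : 0 < sin (φ - a) :=
    sin_pos_of_pos_of_lt_pi (by linarith [hb.left.1]) (by linarith [hb.left.2])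
  have hsin' : sin (φ - φ') < 0 := sin_neg_of_neg_of_neg_pi_lt (by linarith)
    (by linarith [hb.left.1, hb'.left.2])
  have hpos : 0 < (supportAt h b φ' - supportAt h a φ') * sin (φ - a) := by
    rw [hb.sub_mul_sin]
    exact mul_pos_of_neg_of_neg (sub_neg.2 hsupp) hsin'
  refine ((hh.strictAntiOn_supportAt φ').lt_iff_gt ⟨hb'.right.2.le, by linarith [hb'.right.1]⟩
    ⟨hbφ, by linarith [hb.right.1]⟩).1 ?_
  rw [← hb'.eq]
  exact sub_pos.1 (pos_of_mul_pos_left hpos hsin.le)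

theorem left_lt_left {a a' φ φ' b : ℝ} (ha : IsChord h a φ b) (ha' : IsChord h a' φ' b)
    (hφ : φ < φ') : a < a' := by
  rcases lt_or_ge φ a' with haφ | haφ
  · exact ha.left.1.trans haφ
  have hsupp : supportAt h a' b < supportAt h b b := by
    rw [supportAt_self]
    exact hh.supportAt_lt_right ha'.lt ha'.lt_add_two_pi
  have hsin : 0 < sin (φ' - φ) :=
    sin_pos_of_pos_of_lt_pi (by linarith) (by linarith [ha.right.1, ha'.right.2])
  have hsin' : sin (φ' - b) < 0 := sin_neg_of_neg_of_neg_pi_lt (by linarith [ha'.right.2])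
    (by linarith [ha'.right.1])
  have hpos : 0 < (supportAt h b φ - supportAt h a' φ) * sin (φ' - b) := by
    rw [ha'.sub_mul_sin]
    exact mul_pos (sub_pos.2 hsupp) hsin
  refine ((hh.strictMonoOn_supportAt φ).lt_iff_lt ⟨by linarith [ha.left.2], ha.left.1.le⟩
    ⟨by linarith [ha'.left.2], haφ⟩).1 ?_
  rw [ha.eq]
  exact sub_neg.1 (neg_of_mul_pos_left hpos hsin'.le)

theorem angle_lt_of_left_lt {a a' φ φ' b : ℝ} (hc : IsChord h a φ b) (hc' : IsChord h a' φ' b)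
    (ha : a < a') : φ < φ' := by
  rcases lt_trichotomy φ φ' with hφ | rfl | hφ
  · exact hφ
  · exact absurd (hh.left_unique hc hc') ha.ne
  · exact absurd (hh.left_lt_left hc' hc hφ) ha.not_gt

theorem angle_unique {a φ φ' b : ℝ} (hc : IsChord h a φ b) (hc' : IsChord h a φ' b) : φ = φ' := by
  rcases lt_trichotomy φ φ' with hφ | hφ | hφ
  · exact absurd (hh.right_lt_right hc hc' hφ) (lt_irrefl _)
  · exact hφ
  · exact absurd (hh.right_lt_right hc' hc hφ) (lt_irrefl _)

end IsSmoothSupport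

/-- The value of the linear form `⟨·, (cos φ, sin φ)⟩`, by which points are compared with the
support function. -/
noncomputable def normalForm (v : Plane) (φ : ℝ) : ℝ := v 0 * cos φ + v 1 * sin φ

theorem normalForm_sub (v w : Plane) (φ : ℝ) :
    normalForm (v - w) φ = normalForm v φ - normalForm w φ := by
  simp only [normalForm, PiLp.sub_apply]
  ring

theorem normalForm_smul_unitTangent (s φ₀ φ : ℝ) :
    normalForm (s • unitTangent φ₀) φ = s * sin (φ - φ₀) := by
  simp [normalForm, unitTangent, sin_sub]
  ring

theorem normalForm_bdryPoint (Ω : Set Plane) (x φ : ℝ) :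
    normalForm (bdryPoint Ω x) φ = supportAt (supportFn Ω) x φ := by
  simp [normalForm, bdryPoint, supportAt, sin_sub, cos_sub]
  ring

theorem normalForm_of_sub_eq_smul {v w : Plane} {s φ : ℝ} (h : v - w = s • unitTangent φ) (p : ℝ) :
    normalForm v p = normalForm w p + s * sin (p - φ) := by
  rw [← normalForm_smul_unitTangent, ← h, normalForm_sub, add_sub_cancel]

theorem exists_eq_smul_unitTangent (v : Plane) (hv : v ≠ 0) (a : ℝ) :
    ∃ s : ℝ, 0 < s ∧ ∃ φ ∈ Ico a (a + 2 * π), v = s • unitTangent φ := by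
  set w : ℂ := ⟨v 1, -v 0⟩ with hw
  have hw₀ : w ≠ 0 := fun h0 => hv <| by
    ext i
    fin_cases i
    · simpa [hw] using congrArg Complex.im h0
    · simpa [hw] using congrArg Complex.re h0
  set φ := toIcoMod two_pi_pos a w.arg
  have hφ : (φ : Angle) = (w.arg : Angle) := Angle.coe_toIcoMod _ _
  have hsin : ‖w‖ * sin φ = -v 0 := by
    rw [← Angle.sin_coe, hφ, Angle.sin_coe, Complex.norm_mul_sin_arg]
  have hcos : ‖w‖ * cos φ = v 1 := by
    rw [← Angle.cos_coe, hφ, Angle.cos_coe, Complex.norm_mul_cos_arg]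
  refine ⟨‖w‖, norm_pos_iff.2 hw₀, φ, toIcoMod_mem_Ico two_pi_pos a _, ?_⟩
  ext i
  fin_cases i
  · simp [unitTangent, hsin]
  · simp [unitTangent, hcos]

theorem norm_unitTangent (φ : ℝ) : ‖unitTangent φ‖ = 1 := by
  simp [unitTangent, EuclideanSpace.norm_eq]

theorem angle_unitTangent_smul {a φ s : ℝ} (hs : 0 < s) (hφ : |φ - a| ≤ π) :
    InnerProductGeometry.angle (unitTangent a) (s • unitTangent φ) = |φ - a| := by
  have hinner : inner ℝ (unitTangent a) (unitTangent φ) = cos (φ - a) := by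
    simp [unitTangent, cos_sub, PiLp.inner_apply, Fin.sum_univ_two]
    ring
  rw [InnerProductGeometry.angle_smul_right_of_pos _ _ hs, InnerProductGeometry.angle, hinner,
    norm_unitTangent, norm_unitTangent, mul_one, div_one, ← cos_abs, arccos_cos (abs_nonneg _) hφ]

theorem IsChord.angle_left {h : ℝ → ℝ} {a φ b s : ℝ} (hc : IsChord h a φ b) (hs : 0 < s) :
    InnerProductGeometry.angle (unitTangent a) (s • unitTangent φ) = φ - a := by
  have habs : |φ - a| = φ - a := abs_of_pos (sub_pos.2 hc.left.1)
  rw [angle_unitTangent_smul hs (by linarith [hc.left.2]), habs]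

theorem IsChord.angle_right {h : ℝ → ℝ} {a φ b s : ℝ} (hc : IsChord h a φ b) (hs : 0 < s) :
    InnerProductGeometry.angle (unitTangent b) (s • unitTangent φ) = b - φ := by
  have habs : |φ - b| = b - φ := by rw [abs_sub_comm, abs_of_pos (sub_pos.2 hc.right.2)]
  rw [angle_unitTangent_smul hs (by linarith [hc.right.1]), habs]

section Billiard

variable {Ω : Set Plane} (hh : IsSmoothSupport (supportFn Ω))
include hh

theorem exists_isChord_of_lt {a b : ℝ} (hab : a < b) (hba : b < a + 2 * π) :
    ∃ s : ℝ, 0 < s ∧ ∃ φ, IsChord (supportFn Ω) a φ b ∧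
      bdryPoint Ω b - bdryPoint Ω a = s • unitTangent φ := by
  have hb := hh.supportAt_lt_right hab hba
  have ha := hh.supportAt_lt_left hab hba
  have hne : bdryPoint Ω b - bdryPoint Ω a ≠ 0 := fun h0 => by
    have hform := normalForm_bdryPoint Ω b b
    rw [sub_eq_zero.1 h0, normalForm_bdryPoint, supportAt_self] at hform
    exact hb.ne hform
  obtain ⟨s, hs, φ, hφ, hdir⟩ := exists_eq_smul_unitTangent _ hne a
  have hdiff (ψ : ℝ) :
      supportAt (supportFn Ω) b ψ - supportAt (supportFn Ω) a ψ = s * sin (ψ - φ) := by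
    rw [← normalForm_bdryPoint, ← normalForm_bdryPoint, normalForm_of_sub_eq_smul hdir,
      add_sub_cancel_left]
  have hsin_left : 0 < sin (φ - a) := by
    have hneg : s * -sin (φ - a) < 0 := by
      rw [← sin_neg, neg_sub, ← hdiff, supportAt_self]
      linarith
    exact neg_neg_iff_pos.1 (neg_of_mul_neg_right hneg hs.le)
  have hsin_right : 0 < sin (b - φ) := by
    have hpos : 0 < s * sin (b - φ) := by
      rw [← hdiff, supportAt_self]
      linarith
    exact pos_of_mul_pos_right hpos hs.le
  have hleft := mem_Ioo_zero_pi_of_sin_pos (by linarith [hφ.1, pi_pos]) (by linarith [hφ.2])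
    hsin_left
  have hright := mem_Ioo_zero_pi_of_sin_pos (by linarith [hleft.2]) (by linarith [hφ.1])
    hsin_right
  refine ⟨s, hs, φ, ⟨⟨by linarith [hleft.1], by linarith [hleft.2]⟩,
    ⟨by linarith [hright.2], by linarith [hright.1]⟩, ?_⟩, hdir⟩
  have hzero := hdiff φ
  rw [sub_self, sin_zero, mul_zero] at hzero
  exact (sub_eq_zero.1 hzero).symm

theorem IsChord.exists_sub_eq_smul {a φ b : ℝ} (hc : IsChord (supportFn Ω) a φ b) :
    ∃ s : ℝ, 0 < s ∧ bdryPoint Ω b - bdryPoint Ω a = s • unitTangent φ := by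
  obtain ⟨s, hs, φ', hc', hdir⟩ := exists_isChord_of_lt hh hc.lt hc.lt_add_two_pi
  rw [hh.angle_unique hc hc']
  exact ⟨s, hs, hdir⟩

theorem billiardStep_iff {p q : ℝ × ℝ} :
    BilliardStep Ω p q ↔ IsChord (supportFn Ω) p.1 (p.1 + p.2) q.1 ∧ q.2 = q.1 - (p.1 + p.2) := by
  constructor
  · rintro ⟨hlt, hgt, hp, hq⟩
    obtain ⟨s, hs, φ, hc, hdir⟩ := exists_isChord_of_lt hh hlt hgt
    rw [hdir, hc.angle_left hs] at hp
    rw [hdir, hc.angle_right hs] at hq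
    obtain rfl : p.1 + p.2 = φ := by linarith
    exact ⟨hc, hq⟩
  · rintro ⟨hc, hq⟩
    obtain ⟨s, hs, hdir⟩ := hc.exists_sub_eq_smul hh
    refine ⟨hc.lt, hc.lt_add_two_pi, ?_, ?_⟩
    · rw [hdir, hc.angle_left hs, add_sub_cancel_left]
    · rw [hdir, hc.angle_right hs, hq]

theorem BilliardStep.right_unique {p q q' : ℝ × ℝ} (hq : BilliardStep Ω p q)
    (hq' : BilliardStep Ω p q') : q = q' := by
  rw [billiardStep_iff hh] at hq hq'
  have hfst := hh.right_unique hq.1 hq'.1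
  exact Prod.ext hfst (by rw [hq.2, hq'.2, hfst])

theorem BilliardStep.left_unique {p p' q : ℝ × ℝ} (hp : BilliardStep Ω p q)
    (hp' : BilliardStep Ω p' q) : p = p' := by
  rw [billiardStep_iff hh] at hp hp'
  have hangle : p.1 + p.2 = p'.1 + p'.2 := by linarith [hp.2, hp'.2]
  have hfst : p.1 = p'.1 := hh.left_unique (hangle ▸ hp.1) hp'.1
  exact Prod.ext hfst (by linarith)

theorem exists_isOrbit {a φ : ℝ} (hφ : φ ∈ Ioo a (a + π)) :
    ∃ z, IsOrbit Ω z ∧ z 0 = (a, φ - a) := by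
  let S := {p : ℝ × ℝ // p.2 ∈ Ioo 0 π}
  have hexists : ∀ p : S, ∃ q : S, BilliardStep Ω p.1 q.1 := by
    rintro ⟨⟨x, θ⟩, hθ⟩
    obtain ⟨b, hb⟩ := hh.exists_isChord_right (a := x) (φ := x + θ)
      ⟨by linarith [hθ.1], by linarith [hθ.2]⟩
    exact ⟨⟨(b, b - (x + θ)), sub_pos.2 hb.right.2, sub_lt_comm.1 hb.right.1⟩,
      (billiardStep_iff hh).2 ⟨hb, rfl⟩⟩
  choose T hT using hexists
  have hinj : Function.Injective T := fun p p' hpp' =>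
    Subtype.ext ((hT p).left_unique hh (hpp' ▸ hT p'))
  have hsurj : Function.Surjective T := by
    rintro ⟨⟨x, θ⟩, hθ⟩
    obtain ⟨b, hb⟩ := hh.exists_isChord_left (b := x) (φ := x - θ)
      ⟨by linarith [hθ.2], by linarith [hθ.1]⟩
    refine ⟨⟨(b, x - θ - b), sub_pos.2 hb.left.1, sub_lt_iff_lt_add'.2 hb.left.2⟩,
      Subtype.ext ((hT _).right_unique hh ((billiardStep_iff hh).2 ⟨?_, ?_⟩))⟩
    · simpa using hb
    · simp
  let E : Equiv.Perm S := Equiv.ofBijective T ⟨hinj, hsurj⟩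
  let p : S := ⟨(a, φ - a), sub_pos.2 hφ.1, sub_lt_iff_lt_add'.2 hφ.2⟩
  refine ⟨fun k => ((E ^ k) p).1, fun k => ?_, by simp [p]⟩
  simp only [add_comm k, zpow_one_add]
  exact hT _

end Billiard

/-! ### The invariant curve of a caustic -/

/-- A continuous invariant curve of the billiard map, made up of 4-periodic orbits, as produced by
a 4-caustic: it is the graph of `d`, and `f` is the induced map of the boundary. -/
structure IsInvariantCurve (h d f : ℝ → ℝ) : Prop where
  angle_mem : ∀ x, d x ∈ Ioo 0 π
  chord : ∀ x, IsChord h x (x + d x) (f x)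
  next : ∀ x, f x = x + d x + d (f x)
  iterate_four : ∀ x, f (f (f (f x))) = x + 2 * π
  strictMono : StrictMono f
  strictMono_normal : StrictMono fun x => x + d x
  periodic : Function.Periodic d (2 * π)

/-- The line through `γ_Ω(a)` with right-hand normal angle `φ` touches `K` and has it on its
left. Through each boundary point there is one such line; together they form the invariant curve
of a caustic. -/
structure IsLeftTangent (Ω K : Set Plane) (a φ : ℝ) : Prop where
  mem : φ ∈ Ioo a (a + π)
  le : ∀ k ∈ K, normalForm k φ ≤ supportAt (supportFn Ω) a φ
  touch : ∃ k ∈ K, normalForm k φ = supportAt (supportFn Ω) a φ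

/-- The line through `γ_Ω(a)` with right-hand normal angle `φ` touches `K` and has it on its
right: the other way in which an orbit can be tangent to a caustic. -/
structure IsRightTangent (Ω K : Set Plane) (a φ : ℝ) : Prop where
  ge : ∀ k ∈ K, supportAt (supportFn Ω) a φ ≤ normalForm k φ
  touch : ∃ k ∈ K, normalForm k φ = supportAt (supportFn Ω) a φ

theorem continuous_normalForm (φ : ℝ) : Continuous fun v : Plane => normalForm v φ := by
  unfold normalForm
  fun_prop

theorem normalForm_add_smul_normal (v : Plane) (t φ : ℝ) :
    normalForm (v + t • !₂[cos φ, sin φ]) φ = normalForm v φ + t := by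
  simp [normalForm]
  linear_combination t * sin_sq_add_cos_sq φ

theorem normalForm_add_pi (v : Plane) (φ : ℝ) : normalForm v (φ + π) = -normalForm v φ := by
  simp [normalForm]
  ring

theorem exists_smul_unitTangent {v : Plane} {φ : ℝ} (h : normalForm v φ = 0) :
    ∃ s : ℝ, v = s • unitTangent φ := by
  have htrig := sin_sq_add_cos_sq φ
  unfold normalForm at h
  refine ⟨v 1 * cos φ - v 0 * sin φ, ?_⟩
  ext i
  fin_cases i
  · simp [unitTangent]
    linear_combination cos φ * h - v 0 * htrig
  · simp [unitTangent]
    linear_combination sin φ * h - v 1 * htrig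

theorem exists_normalForm_gt {A : Set Plane} {k : Plane} (hk : k ∈ interior A) (φ : ℝ) :
    ∃ k' ∈ A, normalForm k φ < normalForm k' φ := by
  have hcont : Continuous fun t : ℝ => k + t • (!₂[cos φ, sin φ] : Plane) := by fun_prop
  have hmem : ∀ᶠ t : ℝ in 𝓝[>] 0, k + t • (!₂[cos φ, sin φ] : Plane) ∈ A := by
    refine (hcont.continuousAt.eventually_mem ?_).filter_mono nhdsWithin_le_nhds
    simpa using mem_interior_iff_mem_nhds.1 hk
  obtain ⟨t, htA, ht⟩ := (hmem.and self_mem_nhdsWithin).exists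
  refine ⟨_, htA, ?_⟩
  rw [normalForm_add_smul_normal]
  exact lt_add_of_pos_right _ ht

theorem normalForm_lt_supportFn {Ω : Set Plane} (hΩ : IsCompact Ω) {k : Plane}
    (hk : k ∈ interior Ω) (φ : ℝ) : normalForm k φ < supportFn Ω φ := by
  obtain ⟨k', hk', hlt⟩ := exists_normalForm_gt hk φ
  exact hlt.trans_le (le_csSup (hΩ.bddAbove_image (continuous_normalForm φ).continuousOn)
    (mem_image_of_mem _ hk'))

theorem IsChord.lt_supportAt {h : ℝ → ℝ} (hh : IsSmoothSupport h) {a φ b x : ℝ}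
    (hc : IsChord h a φ b) (hax : a < x) (hxb : x < b) : supportAt h a φ < supportAt h x φ := by
  rcases le_total x φ with hx | hx
  · exact hh.strictMonoOn_supportAt φ ⟨by linarith [hc.left.2], hc.left.1.le⟩
      ⟨by linarith [hc.left.2], hx⟩ hax
  · rw [hc.eq]
    exact hh.strictAntiOn_supportAt φ ⟨hx, by linarith [hc.right.1]⟩
      ⟨hc.right.2.le, by linarith [hc.right.1]⟩ hxb

theorem IsChord.eq_add_two_pi_of_perpendicular {h : ℝ → ℝ} (hh : IsSmoothSupport h)
    {a φ b e : ℝ} (hc : IsChord h a φ b) (hc' : IsChord h b (φ + π) e) : e = a + 2 * π := by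
  refine hh.right_unique hc' ⟨⟨by linarith [hc.right.1], by linarith [hc.right.2]⟩,
    ⟨by linarith [hc.left.1], by linarith [hc.left.2]⟩, ?_⟩
  rw [hh.supportAt_add_two_pi, supportAt_add_pi, supportAt_add_pi, hc.eq]

section InteriorPoint

variable {Ω : Set Plane} (hΩ : IsCompact Ω) {k : Plane} (hk : k ∈ interior Ω)
include hΩ hk

theorem normalForm_sub_bdryPoint_neg (a : ℝ) : normalForm (k - bdryPoint Ω a) a < 0 := by
  rw [normalForm_sub, normalForm_bdryPoint, supportAt_self]
  linarith [normalForm_lt_supportFn hΩ hk a]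

theorem sub_bdryPoint_ne_zero (a : ℝ) : k - bdryPoint Ω a ≠ 0 := fun h0 => by
  simpa [h0, normalForm] using normalForm_sub_bdryPoint_neg hΩ hk a

theorem exists_sub_bdryPoint_eq_smul (a : ℝ) :
    ∃ s : ℝ, 0 < s ∧ ∃ φ ∈ Ioo a (a + π), k - bdryPoint Ω a = s • unitTangent φ := by
  obtain ⟨s, hs, φ, hφ, hdir⟩ := exists_eq_smul_unitTangent _ (sub_bdryPoint_ne_zero hΩ hk a) a
  have hneg := normalForm_sub_bdryPoint_neg hΩ hk a
  rw [hdir, normalForm_smul_unitTangent, ← neg_sub φ a, sin_neg, mul_neg, neg_lt_zero] at hneg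
  have hmem := mem_Ioo_zero_pi_of_sin_pos (by linarith [hφ.1, pi_pos]) (by linarith [hφ.2])
    (pos_of_mul_pos_right hneg hs.le)
  exact ⟨s, hs, φ, ⟨by linarith [hmem.1], by linarith [hmem.2]⟩, hdir⟩

theorem exists_forward_of_normalForm_eq {a φ : ℝ} (hφ : φ ∈ Ioo a (a + π))
    (heq : normalForm k φ = supportAt (supportFn Ω) a φ) :
    ∃ s : ℝ, 0 < s ∧ k - bdryPoint Ω a = s • unitTangent φ := by
  obtain ⟨s, hs⟩ := exists_smul_unitTangent (v := k - bdryPoint Ω a) (φ := φ)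
    (by rw [normalForm_sub, normalForm_bdryPoint, heq, sub_self])
  have hneg := normalForm_sub_bdryPoint_neg hΩ hk a
  rw [hs, normalForm_smul_unitTangent] at hneg
  have hsin : sin (a - φ) < 0 :=
    sin_neg_of_neg_of_neg_pi_lt (by linarith [hφ.1]) (by linarith [hφ.2])
  exact ⟨s, pos_of_mul_neg_left hneg hsin.le, hs⟩

theorem exists_backward_of_normalForm_eq {b φ : ℝ} (hφ : φ ∈ Ioo (b - π) b)
    (heq : normalForm k φ = supportAt (supportFn Ω) b φ) :
    ∃ s : ℝ, 0 < s ∧ bdryPoint Ω b - k = s • unitTangent φ := by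
  obtain ⟨s, hs⟩ := exists_smul_unitTangent (v := bdryPoint Ω b - k) (φ := φ)
    (by rw [normalForm_sub, normalForm_bdryPoint, heq, sub_self])
  have hneg := normalForm_sub_bdryPoint_neg hΩ hk b
  rw [← neg_sub, hs, ← neg_smul, normalForm_smul_unitTangent, neg_mul, neg_lt_zero] at hneg
  have hsin : 0 < sin (b - φ) :=
    sin_pos_of_pos_of_lt_pi (by linarith [hφ.2]) (by linarith [hφ.1])
  exact ⟨s, pos_of_mul_pos_left hneg hsin.le, hs⟩

theorem mem_segment_of_normalForm_eq {a φ b : ℝ} (hc : IsChord (supportFn Ω) a φ b)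
    (heq : normalForm k φ = supportAt (supportFn Ω) a φ) :
    k ∈ segment ℝ (bdryPoint Ω a) (bdryPoint Ω b) := by
  obtain ⟨s, hs, hforward⟩ := exists_forward_of_normalForm_eq hΩ hk hc.left heq
  obtain ⟨t, ht, hbackward⟩ := exists_backward_of_normalForm_eq hΩ hk hc.right (heq.trans hc.eq)
  rw [mem_segment_iff_sameRay, hforward, hbackward]
  exact ((SameRay.refl _).pos_smul_left hs).pos_smul_right ht

end InteriorPoint

theorem normalForm_of_mem_segment {Ω : Set Plane} {a φ b : ℝ} (hc : IsChord (supportFn Ω) a φ b)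
    {x : Plane} (hx : x ∈ segment ℝ (bdryPoint Ω a) (bdryPoint Ω b)) :
    normalForm x φ = supportAt (supportFn Ω) a φ := by
  obtain ⟨u, v, -, -, huv, rfl⟩ := hx
  have hlin : normalForm (u • bdryPoint Ω a + v • bdryPoint Ω b) φ =
      u * normalForm (bdryPoint Ω a) φ + v * normalForm (bdryPoint Ω b) φ := by
    simp [normalForm]
    ring
  rw [hlin, normalForm_bdryPoint, normalForm_bdryPoint, ← hc.eq, ← add_mul, huv, one_mul]

section Caustic

variable {Ω K : Set Plane} (hΩ : IsCompact Ω) (hh : IsSmoothSupport (supportFn Ω))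
  (hK : IsCompact K) (hKΩ : K ⊆ interior Ω)

include hΩ hK hKΩ in
theorem exists_isLeftTangent (hne : K.Nonempty) (a : ℝ) : ∃ φ, IsLeftTangent Ω K a φ := by
  have hcont : ContinuousOn (fun k => InnerProductGeometry.angle (unitTangent a)
      (k - bdryPoint Ω a)) K := fun k hk => by
    have hu : unitTangent a ≠ 0 := norm_ne_zero_iff.1 (by simp [norm_unitTangent])
    have hpair : ContinuousAt (fun k : Plane => (unitTangent a, k - bdryPoint Ω a)) k := by fun_prop
    exact (ContinuousAt.comp (f := fun k : Plane => (unitTangent a, k - bdryPoint Ω a))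
      (InnerProductGeometry.continuousAt_angle (x := (unitTangent a, k - bdryPoint Ω a)) hu
        (sub_bdryPoint_ne_zero hΩ (hKΩ hk) a)) hpair).continuousWithinAt
  have hangle {s φ : ℝ} (hs : 0 < s) (hφ : φ ∈ Ioo a (a + π)) :
      InnerProductGeometry.angle (unitTangent a) (s • unitTangent φ) = φ - a := by
    have habs : |φ - a| = φ - a := abs_of_pos (sub_pos.2 hφ.1)
    rw [angle_unitTangent_smul hs (by linarith [hφ.2]), habs]
  obtain ⟨k₀, hk₀, hmin⟩ := hK.exists_isMinOn hne hcont
  obtain ⟨s₀, hs₀, φ₀, hφ₀, hdir₀⟩ := exists_sub_bdryPoint_eq_smul hΩ (hKΩ hk₀) a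
  refine ⟨φ₀, hφ₀, fun k hk => ?_, k₀, hk₀, ?_⟩
  · obtain ⟨s, hs, φ, hφ, hdir⟩ := exists_sub_bdryPoint_eq_smul hΩ (hKΩ hk) a
    have hle : φ₀ ≤ φ := by
      have := isMinOn_iff.1 hmin k hk
      rwa [hdir, hdir₀, hangle hs₀ hφ₀, hangle hs hφ, sub_le_sub_iff_right] at this
    have hsin : sin (φ₀ - φ) ≤ 0 :=
      sin_nonpos_of_nonpos_of_neg_pi_le (by linarith) (by linarith [hφ.2, hφ₀.1])
    rw [normalForm_of_sub_eq_smul hdir, normalForm_bdryPoint]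
    linarith [mul_nonpos_of_nonneg_of_nonpos hs.le hsin]
  · rw [normalForm_of_sub_eq_smul hdir₀, normalForm_bdryPoint, sub_self, sin_zero, mul_zero,
      add_zero]

include hΩ hKΩ in
theorem IsLeftTangent.exists_normalForm_eq {a φ : ℝ} (ht : IsLeftTangent Ω K a φ) :
    ∃ k ∈ K, ∃ s : ℝ, 0 < s ∧
      ∀ p, normalForm k p = supportAt (supportFn Ω) a p + s * sin (p - φ) := by
  obtain ⟨k, hk, heq⟩ := ht.touch
  obtain ⟨s, hs, hdir⟩ := exists_forward_of_normalForm_eq hΩ (hKΩ hk) ht.mem heq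
  exact ⟨k, hk, s, hs, fun p => by rw [normalForm_of_sub_eq_smul hdir, normalForm_bdryPoint]⟩

include hΩ hKΩ in
theorem IsLeftTangent.exists_normalForm_eq_right {a φ b : ℝ} (ht : IsLeftTangent Ω K a φ)
    (hc : IsChord (supportFn Ω) a φ b) : ∃ k ∈ K, ∃ s : ℝ, 0 < s ∧
      ∀ p, normalForm k p = supportAt (supportFn Ω) b p - s * sin (p - φ) := by
  obtain ⟨k, hk, heq⟩ := ht.touch
  obtain ⟨s, hs, hdir⟩ :=
    exists_backward_of_normalForm_eq hΩ (hKΩ hk) hc.right (heq.trans hc.eq)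
  refine ⟨k, hk, s, hs, fun p => ?_⟩
  rw [← normalForm_bdryPoint, normalForm_of_sub_eq_smul hdir, add_sub_cancel_right]

include hΩ hKΩ in
theorem IsLeftTangent.unique {a φ φ' : ℝ} (ht : IsLeftTangent Ω K a φ)
    (ht' : IsLeftTangent Ω K a φ') : φ = φ' := by
  wlog hlt : φ < φ' generalizing φ φ'
  · exact (not_lt.1 hlt).eq_or_lt.elim Eq.symm fun hgt => (this ht' ht hgt).symm
  obtain ⟨k, hk, s, hs, hform⟩ := ht.exists_normalForm_eq hΩ hKΩ
  have hsin : 0 < sin (φ' - φ) :=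
    sin_pos_of_pos_of_lt_pi (by linarith) (by linarith [ht.mem.1, ht'.mem.2])
  linarith [ht'.le k hk, hform φ', mul_pos hs hsin]

include hΩ hh hKΩ in
theorem IsLeftTangent.angle_lt {a φ a' φ' : ℝ} (ht : IsLeftTangent Ω K a φ)
    (ht' : IsLeftTangent Ω K a' φ') (ha : a < a') : φ < φ' := by
  obtain ⟨b, hb⟩ := hh.exists_isChord_right ht.mem
  rcases le_or_gt b a' with hba | hab
  · exact hb.right.2.trans (hba.trans_lt ht'.mem.1)
  by_contra! hφ
  obtain ⟨k, hk, s, hs, hform⟩ := ht'.exists_normalForm_eq hΩ hKΩ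
  have hsin : 0 ≤ sin (φ - φ') :=
    sin_nonneg_of_nonneg_of_le_pi (by linarith) (by linarith [ht.mem.2, ht'.mem.1])
  linarith [ht.le k hk, hb.lt_supportAt hh ha hab, hform φ, mul_nonneg hs.le hsin]

include hΩ hh hKΩ in
theorem IsLeftTangent.right_lt_right {a φ b a' φ' b' : ℝ} (ht : IsLeftTangent Ω K a φ)
    (ht' : IsLeftTangent Ω K a' φ') (hb : IsChord (supportFn Ω) a φ b)
    (hb' : IsChord (supportFn Ω) a' φ' b') (ha : a < a') : b < b' := by
  have hφ := ht.angle_lt hΩ hh hKΩ ht' ha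
  by_contra! hle
  have hsupp : supportAt (supportFn Ω) b φ ≤ supportAt (supportFn Ω) b' φ :=
    (hh.strictAntiOn_supportAt φ).antitoneOn ⟨by linarith [hb'.right.2], by linarith [hb.right.1]⟩
      ⟨hb.right.2.le, by linarith [hb.right.1]⟩ hle
  obtain ⟨k, hk, s, hs, hform⟩ := ht'.exists_normalForm_eq_right hΩ hKΩ hb'
  have hsin : sin (φ - φ') < 0 :=
    sin_neg_of_neg_of_neg_pi_lt (by linarith) (by linarith [hb'.right.2, hb.right.1])
  linarith [ht.le k hk, hb.eq, hform φ, mul_neg_of_pos_of_neg hs hsin]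

include hΩ hK hKΩ in
theorem IsLeftTangent.segmentTangent {a φ b : ℝ} (ht : IsLeftTangent Ω K a φ)
    (hc : IsChord (supportFn Ω) a φ b) : SegmentTangent K (bdryPoint Ω a) (bdryPoint Ω b) := by
  have hne : ∀ x ∈ interior K, normalForm x φ ≠ supportAt (supportFn Ω) a φ := fun x hx heq => by
    obtain ⟨k, hk, hlt⟩ := exists_normalForm_gt hx φ
    linarith [ht.le k hk]
  constructor
  · obtain ⟨k, hk, heq⟩ := ht.touch
    refine ⟨k, mem_segment_of_normalForm_eq hΩ (hKΩ hk) hc heq, ?_⟩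
    rw [hK.isClosed.frontier_eq]
    exact ⟨hk, fun hint => hne k hint heq⟩
  · exact Set.disjoint_left.2 fun x hx hint => hne x hint (normalForm_of_mem_segment hc hx)

include hΩ hK hKΩ in
theorem SegmentTangent.isLeftTangent_or_isRightTangent (hconv : Convex ℝ K)
    (hint : (interior K).Nonempty) {a φ b : ℝ} (hc : IsChord (supportFn Ω) a φ b)
    (ht : SegmentTangent K (bdryPoint Ω a) (bdryPoint Ω b)) :
    IsLeftTangent Ω K a φ ∨ IsRightTangent Ω K a φ := by
  obtain ⟨⟨q, hq, hqK⟩, hdisj⟩ := ht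
  have htouch : ∃ k ∈ K, normalForm k φ = supportAt (supportFn Ω) a φ :=
    ⟨q, hK.isClosed.frontier_subset hqK, normalForm_of_mem_segment hc hq⟩
  have hne : ∀ x ∈ interior K, normalForm x φ ≠ supportAt (supportFn Ω) a φ := fun x hx heq =>
    Set.disjoint_left.1 hdisj
      (mem_segment_of_normalForm_eq hΩ (hKΩ (interior_subset hx)) hc heq) hx
  have hclosure : closure (interior K) = K := by
    rw [hconv.closure_interior_eq_closure_of_nonempty_interior hint, hK.isClosed.closure_eq]
  have hcont := continuous_normalForm φ
  by_cases hside : ∃ x ∈ interior K, normalForm x φ < supportAt (supportFn Ω) a φ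
  · obtain ⟨x, hx, hlt⟩ := hside
    have hall : interior K ⊆ {v | normalForm v φ ≤ supportAt (supportFn Ω) a φ} := by
      intro y hy
      by_contra! hgt
      obtain ⟨w, hw, heq⟩ := hconv.interior.isPreconnected.intermediate_value hx hy
        hcont.continuousOn ⟨hlt.le, (not_le.1 hgt).le⟩
      exact hne w hw heq
    refine Or.inl ⟨hc.left, fun k hk => ?_, htouch⟩
    exact closure_minimal hall (isClosed_le hcont continuous_const) (hclosure.ge hk)
  · push Not at hside
    refine Or.inr ⟨fun k hk => ?_, htouch⟩
    exact closure_minimal (t := {v | supportAt (supportFn Ω) a φ ≤ normalForm v φ}) hside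
      (isClosed_le continuous_const hcont) (hclosure.ge hk)

theorem le_pi_div_two_of_sin_two_mul_nonneg {θ : ℝ} (hθ : θ < π) (h : 0 ≤ sin (2 * θ)) :
    θ ≤ π / 2 := by
  by_contra! hgt
  rw [← sin_sub_two_pi] at h
  exact h.not_gt (sin_neg_of_neg_of_neg_pi_lt (by linarith) (by linarith))

include hΩ hKΩ in
theorem IsLeftTangent.eq_pi_div_two_of_isRightTangent {a φ b θ : ℝ} (ht : IsLeftTangent Ω K a φ)
    (hc : IsChord (supportFn Ω) a φ b) (hθ : θ = b - φ) (ht' : IsRightTangent Ω K b (b + θ)) :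
    θ = π / 2 := by
  have hθ₀ : 0 < θ := by linarith [hc.right.2]
  have hθπ : θ < π := by linarith [hc.right.1]
  have hsin_nonpos : sin (2 * θ) ≤ 0 := by
    obtain ⟨k, hk, s, hs, hform⟩ := ht.exists_normalForm_eq_right hΩ hKΩ hc
    have hge := ht'.ge k hk
    rw [hform, show b + θ - φ = 2 * θ by linarith] at hge
    exact nonpos_of_mul_nonpos_right (by linarith) hs
  have hsin_nonneg : 0 ≤ sin (2 * θ) := by
    obtain ⟨k, hk, heq⟩ := ht'.touch
    obtain ⟨s, hs, hdir⟩ := exists_forward_of_normalForm_eq hΩ (hKΩ hk)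
      ⟨by linarith, by linarith⟩ heq
    have hle := ht.le k hk
    rw [normalForm_of_sub_eq_smul hdir, normalForm_bdryPoint, hc.eq,
      show φ - (b + θ) = -(2 * θ) by linarith, sin_neg] at hle
    exact nonneg_of_mul_nonneg_right (by linarith : 0 ≤ s * sin (2 * θ)) hs
  refine (le_pi_div_two_of_sin_two_mul_nonneg hθπ hsin_nonneg).antisymm ?_
  by_contra! hlt
  exact hsin_nonpos.not_gt (sin_pos_of_pos_of_lt_pi (by linarith) (by linarith))

include hΩ hKΩ in
theorem IsLeftTangent.lt_pi_div_two_of_isLeftTangent (hint : (interior K).Nonempty)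
    {a φ b θ : ℝ} (ht : IsLeftTangent Ω K a φ) (hc : IsChord (supportFn Ω) a φ b)
    (hθ : θ = b - φ) (ht' : IsLeftTangent Ω K b (b + θ)) : θ < π / 2 := by
  have hsin : 0 ≤ sin (2 * θ) := by
    obtain ⟨k, hk, s, hs, hform⟩ := ht.exists_normalForm_eq_right hΩ hKΩ hc
    have hle := ht'.le k hk
    rw [hform, show b + θ - φ = 2 * θ by linarith] at hle
    exact nonneg_of_mul_nonneg_right (by linarith : 0 ≤ s * sin (2 * θ)) hs
  refine (le_pi_div_two_of_sin_two_mul_nonneg (by linarith [hc.right.1]) hsin).lt_of_ne ?_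
  -- At a perpendicular bounce `K` would lie on both sides of the same line.
  intro hperp
  obtain ⟨x, hx⟩ := hint
  obtain ⟨k, hk, hlt⟩ := exists_normalForm_gt hx φ
  obtain ⟨k', hk', hlt'⟩ := exists_normalForm_gt hx (φ + π)
  have hle := ht.le k hk
  have hle' := ht'.le k' hk'
  rw [hc.eq] at hle
  rw [show b + θ = φ + π by linarith, supportAt_add_pi] at hle'
  rw [normalForm_add_pi] at hlt'
  linarith

include hh in
theorem IsLeftTangent.add_two_pi {a φ : ℝ} (ht : IsLeftTangent Ω K a φ) :
    IsLeftTangent Ω K (a + 2 * π) (φ + 2 * π) := by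
  have hform (v : Plane) : normalForm v (φ + 2 * π) = normalForm v φ := by simp [normalForm]
  have hsupp : supportAt (supportFn Ω) (a + 2 * π) (φ + 2 * π) = supportAt (supportFn Ω) a φ := by
    rw [← normalForm_bdryPoint, hform, normalForm_bdryPoint, hh.supportAt_add_two_pi]
  obtain ⟨k, hk, heq⟩ := ht.touch
  refine ⟨⟨by linarith [ht.mem.1], by linarith [ht.mem.2]⟩, fun k hk => ?_, k, hk, ?_⟩
  · rw [hform, hsupp]
    exact ht.le k hk
  · rw [hform, hsupp, heq]

section Orbit

variable {z : ℤ → ℝ × ℝ} (hz : IsOrbit Ω z)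
include hh hz

theorem IsOrbit.angle_mem (k : ℤ) : (z k).2 ∈ Ioo 0 π := by
  have hmem := ((billiardStep_iff hh).1 (hz k)).1.left
  exact ⟨by linarith [hmem.1], by linarith [hmem.2]⟩

theorem IsOrbit.fst_succ (k : ℤ) : (z (k + 1)).1 = (z k).1 + (z k).2 + (z (k + 1)).2 := by
  linarith [((billiardStep_iff hh).1 (hz k)).2]

theorem IsOrbit.sum_angle {p : ℕ} (hp : IsPeriodicOrbit p 4 z) (k : ℤ) :
    (z k).2 + (z (k + 1)).2 + (z (k + 1 + 1)).2 + (z (k + 1 + 1 + 1)).2 = π * p := by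
  have hperiod : z (k + 1 + 1 + 1 + 1) = ((z k).1 + 2 * π * p, (z k).2) := by
    rw [← hp k]
    congr 1
    push_cast
    ring
  have hlast := hz.fst_succ hh (k + 1 + 1 + 1)
  rw [hperiod] at hlast
  linarith [hz.fst_succ hh k, hz.fst_succ hh (k + 1), hz.fst_succ hh (k + 1 + 1)]

end Orbit

section RationalCaustic

variable (hc : IsRationalCaustic 4 Ω K) {z : ℤ → ℝ × ℝ} (hz : IsOrbit Ω z)
  (ht : ∀ k, OrbitTangentAt Ω K z k)
include hΩ hh hc

include hz ht in
theorem IsRationalCaustic.isLeftTangent_succ {k : ℤ}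
    (hl : IsLeftTangent Ω K (z k).1 ((z k).1 + (z k).2)) :
    IsLeftTangent Ω K (z (k + 1)).1 ((z (k + 1)).1 + (z (k + 1)).2) ∧ (z (k + 1)).2 < π / 2 := by
  obtain ⟨hK, hconv, hint, hKΩ, -⟩ := hc.1
  obtain ⟨hchord, hangle⟩ := (billiardStep_iff hh).1 (hz k)
  obtain ⟨hchord', hangle'⟩ := (billiardStep_iff hh).1 (hz (k + 1))
  rcases (ht (k + 1)).isLeftTangent_or_isRightTangent hΩ hK hKΩ hconv hint hchord' with hl' | hr
  · exact ⟨hl', hl.lt_pi_div_two_of_isLeftTangent hΩ hKΩ hint hchord hangle hl'⟩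
  -- A perpendicular bounce sends the orbit back to its starting point after two steps, with total
  -- angle `3π / 2`; neither `π` nor `3π` is within reach of the one remaining angle.
  exfalso
  have hperp := hl.eq_pi_div_two_of_isRightTangent hΩ hKΩ hchord hangle hr
  rw [show (z (k + 1)).1 + (z (k + 1)).2 = (z k).1 + (z k).2 + π by linarith] at hchord' hangle'
  have hback := hchord.eq_add_two_pi_of_perpendicular hh hchord'
  have hmem := hz.angle_mem hh (k + 1 + 1 + 1)
  rcases hc.2 z hz ht with hp | hp
  · have hsum := hz.sum_angle hh hp k
    norm_num at hsum
    linarith [hmem.1, pi_pos]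
  · have hsum := hz.sum_angle hh hp k
    norm_num at hsum
    linarith [hmem.2, pi_pos]

theorem IsRationalCaustic.exists_isOrbit {a φ : ℝ} (hl : IsLeftTangent Ω K a φ) :
    ∃ z, IsOrbit Ω z ∧ z 0 = (a, φ - a) ∧ IsPeriodicOrbit 1 4 z ∧
      ∀ k : ℕ, IsLeftTangent Ω K (z k).1 ((z k).1 + (z k).2) := by
  obtain ⟨z, hz, hz₀⟩ := _root_.exists_isOrbit hh hl.mem
  have hl₀ : IsLeftTangent Ω K (z 0).1 ((z 0).1 + (z 0).2) := by simpa [hz₀] using hl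
  have ht : ∀ k, OrbitTangentAt Ω K z k := hc.1.tangent z hz 0
    (hl₀.segmentTangent hΩ hc.1.isCompact hc.1.subset_interior
      ((billiardStep_iff hh).1 (hz 0)).1)
  have hleft (k : ℕ) : IsLeftTangent Ω K (z k).1 ((z k).1 + (z k).2) := by
    induction k with
    | zero => exact hl₀
    | succ k ih => exact_mod_cast (hc.isLeftTangent_succ hΩ hh hz ht ih).1
  refine ⟨z, hz, hz₀, (hc.2 z hz ht).resolve_right fun hp => ?_, hleft⟩
  have hacute (k : ℕ) := (hc.isLeftTangent_succ hΩ hh hz ht (hleft k)).2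
  have hsum := hz.sum_angle hh hp 1
  have h₁ := hacute 0
  have h₂ := hacute 1
  have h₃ := hacute 2
  have h₄ := hacute 3
  norm_num at hsum h₁ h₂ h₃ h₄
  linarith [pi_pos]

theorem IsRationalCaustic.exists_isInvariantCurve :
    ∃ d f, IsInvariantCurve (supportFn Ω) d f := by
  have hKΩ := hc.1.subset_interior
  choose φ hφ using exists_isLeftTangent hΩ hc.1.isCompact hKΩ
    (hc.1.interior_nonempty.mono interior_subset)
  choose f hf using fun a => hh.exists_isChord_right (hφ a).mem
  choose z hz hz₀ hper hleft using fun a => hc.exists_isOrbit hΩ hh (hφ a)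
  have hangle (a : ℝ) (k : ℕ) : (z a k).1 + (z a k).2 = φ (z a k).1 :=
    (hleft a k).unique hΩ hKΩ (hφ _)
  have hfst (a : ℝ) (k : ℕ) : (z a (k + 1)).1 = f (z a k).1 := by
    have hchord := ((billiardStep_iff hh).1 (hz a k)).1
    rw [hangle] at hchord
    exact hh.right_unique hchord (hf _)
  refine ⟨fun a => φ a - a, f, fun a => ⟨by linarith [(hφ a).mem.1], by linarith [(hφ a).mem.2]⟩,
    fun a => by simpa using hf a, fun a => ?_, fun a => ?_,
    fun a b hab => (hφ a).right_lt_right hΩ hh hKΩ (hφ b) (hf a) (hf b) hab,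
    fun a b hab => by simpa using (hφ a).angle_lt hΩ hh hKΩ (hφ b) hab, fun a => ?_⟩
  · have hstep := (hz a).fst_succ hh 0
    have hf₀ := hfst a 0
    have hangle₁ := hangle a 1
    simp only [Nat.cast_zero, Nat.cast_one, zero_add, hz₀] at hstep hf₀ hangle₁
    rw [← hf₀]
    linarith
  · have hclose := congrArg Prod.fst (hper a 0)
    have hf₀ := hfst a 0
    have hf₁ := hfst a 1
    have hf₂ := hfst a 2
    have hf₃ := hfst a 3
    norm_num at hclose hf₀ hf₁ hf₂ hf₃
    rwa [hf₃, hf₂, hf₁, hf₀, hz₀] at hclose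
  · have := (hφ (a + 2 * π)).unique hΩ hKΩ ((hφ a).add_two_pi hh)
    linarith

end RationalCaustic

end Caustic

theorem IsOrbit.ext {Ω : Set Plane} (hh : IsSmoothSupport (supportFn Ω)) {z w : ℤ → ℝ × ℝ}
    (hz : IsOrbit Ω z) (hw : IsOrbit Ω w) (h0 : z 0 = w 0) : z = w := by
  funext k
  induction k using Int.induction_on with
  | zero => exact h0
  | succ k ih => exact (ih ▸ hz k).right_unique hh (hw k)
  | pred k ih =>
    have hzk := hz (-k - 1)
    have hwk := hw (-k - 1)
    rw [sub_add_cancel] at hzk hwk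
    exact (ih ▸ hzk).left_unique hh hwk

namespace IsInvariantCurve

variable {h d f : ℝ → ℝ} (hc : IsInvariantCurve h d f)
include hc

theorem iterate_add_four (k : ℕ) (x : ℝ) : f^[k + 4] x = f^[k] x + 2 * π := by
  rw [add_comm, Function.iterate_add_apply]
  exact hc.iterate_four _

theorem bijective : Function.Bijective f :=
  ⟨hc.strictMono.injective, fun y => ⟨f (f (f (y - 2 * π))), by rw [hc.iterate_four]; ring⟩⟩

theorem exists_isChord_left (y : ℝ) : ∃ x, f x = y ∧ IsChord h x (y - d y) y := by
  obtain ⟨x, rfl⟩ := hc.bijective.2 y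
  refine ⟨x, rfl, ?_⟩
  rw [show f x - d (f x) = x + d x by linarith [hc.next x]]
  exact hc.chord x

end IsInvariantCurve

section LoopAngle

variable {Ω : Set Plane} {d f : ℝ → ℝ} (hh : IsSmoothSupport (supportFn Ω))
  (hc : IsInvariantCurve (supportFn Ω) d f)
include hh hc

theorem BilliardStep.lt_of_angle_lt {p q : ℝ × ℝ} (hs : BilliardStep Ω p q) (hp : p.2 < d p.1) :
    q.1 < f p.1 ∧ q.2 < d q.1 := by
  obtain ⟨hchord, hq⟩ := (billiardStep_iff hh).1 hs
  have hlt : q.1 < f p.1 := hh.right_lt_right hchord (hc.chord p.1) (by linarith)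
  obtain ⟨x, hx, hchord'⟩ := hc.exists_isChord_left q.1
  have hxp : x < p.1 := hc.strictMono.lt_iff_lt.1 (hx ▸ hlt)
  exact ⟨hlt, by linarith [hh.angle_lt_of_left_lt hchord' hchord hxp]⟩

theorem BilliardStep.gt_of_lt_angle {p q : ℝ × ℝ} (hs : BilliardStep Ω p q) (hp : d p.1 < p.2) :
    f p.1 < q.1 ∧ d q.1 < q.2 := by
  obtain ⟨hchord, hq⟩ := (billiardStep_iff hh).1 hs
  have hlt : f p.1 < q.1 := hh.right_lt_right (hc.chord p.1) hchord (by linarith)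
  obtain ⟨x, hx, hchord'⟩ := hc.exists_isChord_left q.1
  have hpx : p.1 < x := hc.strictMono.lt_iff_lt.1 (hx ▸ hlt)
  exact ⟨hlt, by linarith [hh.angle_lt_of_left_lt hchord hchord' hpx]⟩

theorem lt_iterate_of_angle_lt {z : ℕ → ℝ × ℝ} {n : ℕ}
    (hz : ∀ k < n + 1, BilliardStep Ω (z k) (z (k + 1))) (h0 : (z 0).2 < d (z 0).1) :
    (z (n + 1)).1 < f^[n + 1] (z 0).1 ∧ (z (n + 1)).2 < d (z (n + 1)).1 := by
  induction n with
  | zero => exact (hz 0 zero_lt_one).lt_of_angle_lt hh hc h0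
  | succ n ih =>
    obtain ⟨hlt, hangle⟩ := ih fun k hk => hz k (by omega)
    obtain ⟨hlt', hangle'⟩ := (hz (n + 1) (by omega)).lt_of_angle_lt hh hc hangle
    refine ⟨hlt'.trans ?_, hangle'⟩
    rw [Function.iterate_succ_apply']
    exact hc.strictMono hlt

theorem iterate_lt_of_lt_angle {z : ℕ → ℝ × ℝ} {n : ℕ}
    (hz : ∀ k < n + 1, BilliardStep Ω (z k) (z (k + 1))) (h0 : d (z 0).1 < (z 0).2) :
    f^[n + 1] (z 0).1 < (z (n + 1)).1 ∧ d (z (n + 1)).1 < (z (n + 1)).2 := by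
  induction n with
  | zero => exact (hz 0 zero_lt_one).gt_of_lt_angle hh hc h0
  | succ n ih =>
    obtain ⟨hlt, hangle⟩ := ih fun k hk => hz k (by omega)
    obtain ⟨hlt', hangle'⟩ := (hz (n + 1) (by omega)).gt_of_lt_angle hh hc hangle
    refine ⟨hlt'.trans' ?_, hangle'⟩
    rw [Function.iterate_succ_apply']
    exact hc.strictMono hlt

theorem IsInvariantCurve.billiardStep (x : ℝ) : BilliardStep Ω (x, d x) (f x, d (f x)) :=
  (billiardStep_iff hh).2 ⟨hc.chord x, by linarith [hc.next x]⟩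

-- A loop starting below (above) the invariant curve stays below (above) it, hence lags behind
-- (runs ahead of) the orbit on the curve, which closes up exactly after four steps.
theorem IsInvariantCurve.isLoopAngle : IsLoopAngle Ω 4 d := by
  refine fun ψ => ⟨hc.angle_mem ψ, fun θ => ⟨?_, ?_⟩⟩
  · rintro ⟨z, h0, hz, h4⟩
    have hclose : (z 4).1 = f^[4] (z 0).1 := by
      rw [h4, h0]
      exact (hc.iterate_four ψ).symm
    rcases lt_trichotomy θ (d ψ) with hlt | heq | hgt
    · exact absurd hclose (lt_iterate_of_angle_lt (n := 3) hh hc hz (by rwa [h0])).1.ne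
    · exact heq
    · exact absurd hclose (iterate_lt_of_lt_angle (n := 3) hh hc hz (by rwa [h0])).1.ne'
  · rintro rfl
    refine ⟨fun k => (f^[k] ψ, d (f^[k] ψ)), rfl, fun k _ => ?_, hc.iterate_four ψ⟩
    simp only [Function.iterate_succ_apply']
    exact hc.billiardStep hh _

theorem IsInvariantCurve.exists_isPeriodicOrbit : ∃ z : ℝ → ℤ → ℝ × ℝ,
    (∀ ψ, IsOrbit Ω (z ψ) ∧ IsPeriodicOrbit 1 4 (z ψ) ∧ z ψ 0 = (ψ, d ψ)) ∧
    (∀ w, IsOrbit Ω w → IsPeriodicOrbit 1 4 w → w = z (w 0).1) ∧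
    ∀ ψ, ∀ k : ℕ, (z ψ k).1 = f^[k] ψ := by
  let E : Equiv.Perm ℝ := Equiv.ofBijective f hc.bijective
  let z : ℝ → ℤ → ℝ × ℝ := fun ψ k => ((E ^ k) ψ, d ((E ^ k) ψ))
  have hE (k : ℤ) (ψ : ℝ) : (E ^ (k + 1)) ψ = f ((E ^ k) ψ) := by
    rw [add_comm, zpow_one_add]
    rfl
  have horbit (ψ : ℝ) : IsOrbit Ω (z ψ) := fun k => by
    simp only [z, hE]
    exact hc.billiardStep hh _
  have hperiodic (ψ : ℝ) : IsPeriodicOrbit 1 4 (z ψ) := fun k => by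
    have hfour : (E ^ (k + (4 : ℕ))) ψ = (E ^ k) ψ + 2 * π := by
      rw [show k + ((4 : ℕ) : ℤ) = k + 1 + 1 + 1 + 1 by push_cast; ring, hE, hE, hE, hE,
        hc.iterate_four]
    simp only [z, hfour, hc.periodic ((E ^ k) ψ), Nat.cast_one, mul_one]
  refine ⟨z, fun ψ => ⟨horbit ψ, hperiodic ψ, by simp [z]⟩, fun w hw hp => ?_, fun ψ k => ?_⟩
  · have hloop : IsLoop Ω 4 (w 0).1 (w 0).2 :=
      ⟨fun k => w k, rfl, fun k _ => hw k, by simpa using congrArg Prod.fst (hp 0)⟩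
    refine hw.ext hh (horbit _) (Prod.ext (by simp [z]) ?_)
    simpa [z] using ((hc.isLoopAngle hh (w 0).1).2 _).1 hloop
  · induction k with
    | zero => simp [z]
    | succ k ih =>
      simp only [z, Nat.cast_succ, hE, Function.iterate_succ_apply'] at ih ⊢
      rw [ih]

end LoopAngle

/-! ### Bounds on the angles of an orbit -/

/-- A `C^6` support function `h` with an invariant curve of 4-periodic orbits, almost invariant
under the rotation by `π`: the standing data from which all estimates are derived, with constants
depending on `r` and `B` only. The radius of curvature is at least `r`, the `C^6` norm of `h` is at
most `B`, the defect of symmetry is measured by `ε`, and `R` is half the approximate diagonal of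
the circumscribed rectangles. -/
structure BilliardDatum (r B : ℝ) where
  h : ℝ → ℝ
  d : ℝ → ℝ
  f : ℝ → ℝ
  ε : ℝ
  R : ℝ
  r_pos : 0 < r
  bound : CBound 6 B h
  smooth : IsSmoothSupport h
  curv : ∀ x, r ≤ h x + deriv (deriv h) x
  curve : IsInvariantCurve h d f
  ε_nonneg : 0 ≤ ε
  near : CBound 5 (2 * ε) fun x => h (x + π) - h x
  R_nonneg : 0 ≤ R
  R_sq : |h 0 ^ 2 + h (π / 2) ^ 2 - R ^ 2| ≤ 6 * B * ε

theorem hasDerivAt_cos_sub (φ x : ℝ) : HasDerivAt (fun x => cos (φ - x)) (sin (φ - x)) x := by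
  simpa using ((hasDerivAt_id x).const_sub φ).cos

theorem le_of_hasDerivAt_mul_sin {G g : ℝ → ℝ} {φ : ℝ}
    (hG : ∀ x, HasDerivAt G (g x * sin (φ - x)) x) (hg : ∀ x, 0 ≤ g x) {x : ℝ}
    (hx : x ∈ Icc (φ - π) (φ + π)) : G x ≤ G φ := by
  have hc : Continuous G := continuous_iff_continuousAt.2 fun x => (hG x).continuousAt
  rcases le_total x φ with hxφ | hφx
  · refine monotoneOn_of_deriv_nonneg (convex_Icc (φ - π) φ) hc.continuousOn
      (fun y _ => (hG y).differentiableAt.differentiableWithinAt) (fun y hy => ?_) ⟨hx.1, hxφ⟩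
      ⟨by linarith [pi_pos], le_rfl⟩ hxφ
    rw [interior_Icc] at hy
    rw [(hG y).deriv]
    exact mul_nonneg (hg y)
      (sin_nonneg_of_nonneg_of_le_pi (by linarith [hy.2]) (by linarith [hy.1]))
  · refine antitoneOn_of_deriv_nonpos (convex_Icc φ (φ + π)) hc.continuousOn
      (fun y _ => (hG y).differentiableAt.differentiableWithinAt) (fun y hy => ?_)
      ⟨le_rfl, by linarith [pi_pos]⟩ ⟨hφx, hx.2⟩ hφx
    rw [interior_Icc] at hy
    rw [(hG y).deriv]
    exact mul_nonpos_of_nonneg_of_nonpos (hg y)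
      (sin_nonpos_of_nonpos_of_neg_pi_le (by linarith [hy.1]) (by linarith [hy.2]))

namespace BilliardDatum

variable {r B : ℝ}

/-- The filter of data whose defect of symmetry tends to zero; uniform estimates for small `ε` are
statements about eventual bounds along it. -/
def small (r B : ℝ) : Filter (BilliardDatum r B) := comap ε (𝓝 0)

/-- The normal angle of the `k`-th vertex of the orbit that starts at `ψ`, lifted to `ℝ`. -/
def X (k : ℕ) (D : BilliardDatum r B) (ψ : ℝ) : ℝ := D.f^[k] ψ

/-- The angle of reflection at the `k`-th vertex. -/
def δ (k : ℕ) (D : BilliardDatum r B) (ψ : ℝ) : ℝ := D.d (D.X k ψ)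

/-- The normal angle of the chord from the `k`-th vertex to the next one; the orbits are studied
through these angles. -/
def Y (k : ℕ) (D : BilliardDatum r B) (ψ : ℝ) : ℝ := D.X k ψ + D.δ k ψ

variable (D : BilliardDatum r B) (k : ℕ) (ψ : ℝ)

@[simp] theorem X_zero : D.X 0 ψ = ψ := rfl

theorem f_X : D.f (D.X k ψ) = D.X (k + 1) ψ := (Function.iterate_succ_apply' _ _ _).symm

theorem X_succ : D.X (k + 1) ψ = D.Y k ψ + D.δ (k + 1) ψ := by
  rw [Y, δ, δ, ← f_X]
  exact D.curve.next _

theorem X_add_four : D.X (k + 4) ψ = D.X k ψ + 2 * π := D.curve.iterate_add_four k ψ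

theorem δ_add_four : D.δ (k + 4) ψ = D.δ k ψ := by
  rw [δ, X_add_four, D.curve.periodic, δ]

theorem Y_add_four : D.Y (k + 4) ψ = D.Y k ψ + 2 * π := by
  rw [Y, X_add_four, δ_add_four, Y]
  ring

theorem X_succ_eq : D.X (k + 1) ψ = (D.Y k ψ + D.Y (k + 1) ψ) / 2 := by
  linarith [D.X_succ k ψ, show D.Y (k + 1) ψ = D.X (k + 1) ψ + D.δ (k + 1) ψ from rfl]

theorem δ_succ_eq : D.δ (k + 1) ψ = (D.Y (k + 1) ψ - D.Y k ψ) / 2 := by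
  linarith [D.X_succ k ψ, show D.Y (k + 1) ψ = D.X (k + 1) ψ + D.δ (k + 1) ψ from rfl]

theorem Y_three_eq : D.Y 3 ψ = ψ - D.d ψ + 2 * π := by
  have hnext := D.X_succ 3 ψ
  rw [X_add_four D 0, δ_add_four D 0] at hnext
  simp only [δ, X_zero] at hnext
  linarith

theorem sum_δ : D.δ 0 ψ + D.δ 1 ψ + D.δ 2 ψ + D.δ 3 ψ = π := by
  have hX₁ := D.X_succ 0 ψ
  have hX₂ := D.X_succ 1 ψ
  have hX₃ := D.X_succ 2 ψ
  have hX₄ := D.X_succ 3 ψ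
  rw [X_add_four D 0, δ_add_four D 0] at hX₄
  norm_num only [Y] at hX₁ hX₂ hX₃ hX₄
  linarith

theorem δ_mem : D.δ k ψ ∈ Ioo 0 π := D.curve.angle_mem _

theorem δ_succ_le : D.δ k ψ + D.δ (k + 1) ψ ≤ π := by
  have hsum := D.sum_δ (D.X k ψ)
  have h₁ : D.δ 1 (D.X k ψ) = D.δ (k + 1) ψ := by rw [δ, δ, ← f_X, ← f_X, X_zero]
  rw [show D.δ 0 (D.X k ψ) = D.δ k ψ from rfl, h₁] at hsum
  linarith [(D.δ_mem 2 (D.X k ψ)).1, (D.δ_mem 3 (D.X k ψ)).1]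

theorem isChord : IsChord D.h (D.X k ψ) (D.Y k ψ) (D.X (k + 1) ψ) := by
  rw [← f_X]
  exact D.curve.chord _

theorem chord_eq : supportAt D.h ((D.Y k ψ + D.Y (k + 1) ψ) / 2) (D.Y (k + 1) ψ) =
    supportAt D.h ((D.Y (k + 1) ψ + D.Y (k + 2) ψ) / 2) (D.Y (k + 1) ψ) := by
  rw [← X_succ_eq, ← X_succ_eq D (k + 1)]
  exact (D.isChord (k + 1) ψ).eq

theorem strictMono_X : StrictMono (D.X k) := D.curve.strictMono.iterate k

theorem strictMono_Y : StrictMono (D.Y k) := fun _ _ hab =>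
  D.curve.strictMono_normal (D.strictMono_X k hab)

theorem abs_d_sub_le (x y : ℝ) : |D.d x - D.d y| ≤ |x - y| := by
  wlog hxy : y ≤ x generalizing x y
  · rw [abs_sub_comm, abs_sub_comm x]
    exact this y x (le_of_not_ge hxy)
  have hY₀ := (D.strictMono_Y 0).monotone hxy
  have hY₃ := (D.strictMono_Y 3).monotone hxy
  rw [Y_three_eq, Y_three_eq] at hY₃
  simp only [Y, δ, X_zero] at hY₀
  rw [abs_of_nonneg (sub_nonneg.2 hxy), abs_le]
  constructor <;> linarith

theorem continuous_d : Continuous D.d :=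
  (LipschitzWith.of_dist_le_mul (K := 1) fun x y => by
    simpa only [Real.dist_eq, NNReal.coe_one, one_mul] using D.abs_d_sub_le x y).continuous

theorem continuous_X : Continuous (D.X k) :=
  (D.curve.strictMono.monotone.continuous_of_surjective D.curve.bijective.2).iterate k

theorem continuous_δ : Continuous (D.δ k) := D.continuous_d.comp (D.continuous_X k)

theorem continuous_Y : Continuous (D.Y k) := (D.continuous_X k).add (D.continuous_δ k)

theorem X_mem : D.X k ψ ∈ Icc ψ (ψ + 2 * π * k) := by
  induction k with
  | zero => simp
  | succ k ih =>
    have hnext := D.X_succ k ψ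
    have hδ := D.δ_mem k ψ
    have hδ' := D.δ_mem (k + 1) ψ
    rw [Y] at hnext
    push_cast
    constructor <;> linarith [hδ.1, hδ.2, hδ'.1, hδ'.2, ih.1, ih.2]

theorem abs_Y_sub_le : |D.Y k ψ - ψ| ≤ 2 * π * k + π := by
  have hX := D.X_mem k ψ
  have hδ := D.δ_mem k ψ
  rw [Y, abs_le]
  have : 0 ≤ 2 * π * k := by positivity
  constructor <;> linarith [hX.1, hX.2, hδ.1, hδ.2]

theorem surjective_Y : Function.Surjective (D.Y k) := by
  refine (D.continuous_Y k).surjective ?_ ?_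
  · refine tendsto_atTop_mono (fun x => ?_) (tendsto_atTop_add_const_right atTop
      (-(2 * π * k + π)) tendsto_id)
    rw [id]
    linarith [(abs_le.1 (D.abs_Y_sub_le k x)).1]
  · refine tendsto_atBot_mono (fun x => ?_) (tendsto_atBot_add_const_right atBot
      (2 * π * k + π) tendsto_id)
    rw [id]
    linarith [(abs_le.1 (D.abs_Y_sub_le k x)).2]

theorem abs_h_le (x : ℝ) : |D.h x| ≤ B := D.bound.abs_le x

theorem abs_deriv_h_le (x : ℝ) : |deriv D.h x| ≤ B := (CBound.succ_iff.1 D.bound).2.2.abs_le x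

theorem abs_deriv_deriv_h_le (x : ℝ) : |deriv (deriv D.h) x| ≤ B :=
  (CBound.succ_iff.1 (CBound.succ_iff.1 D.bound).2.2).2.2.abs_le x

theorem curv_le (x : ℝ) : D.h x + deriv (deriv D.h) x ≤ 2 * B := by
  linarith [(abs_le.1 (D.abs_h_le x)).2, (abs_le.1 (D.abs_deriv_deriv_h_le x)).2]

include D in
theorem B_pos : 0 < B := by linarith [D.r_pos, D.curv 0, D.curv_le 0]

theorem mul_one_sub_cos_le {φ x : ℝ} (hx : x ∈ Icc (φ - π) (φ + π)) :
    r * (1 - cos (φ - x)) ≤ D.h φ - supportAt D.h x φ := by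
  have hle := le_of_hasDerivAt_mul_sin (G := fun x => supportAt D.h x φ - r * cos (φ - x))
    (g := fun x => D.h x + deriv (deriv D.h) x - r)
    (fun x => ((D.smooth.hasDerivAt_supportAt φ x).sub
      ((hasDerivAt_cos_sub φ x).const_mul r)).congr_deriv (by ring))
    (fun x => sub_nonneg.2 (D.curv x)) hx
  simp only [supportAt_self, sub_self, cos_zero] at hle
  linarith

theorem le_mul_one_sub_cos {φ x : ℝ} (hx : x ∈ Icc (φ - π) (φ + π)) :
    D.h φ - supportAt D.h x φ ≤ 2 * B * (1 - cos (φ - x)) := by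
  have hle := le_of_hasDerivAt_mul_sin (G := fun x => 2 * B * cos (φ - x) - supportAt D.h x φ)
    (g := fun x => 2 * B - (D.h x + deriv (deriv D.h) x))
    (fun x => (((hasDerivAt_cos_sub φ x).const_mul (2 * B)).sub
      (D.smooth.hasDerivAt_supportAt φ x)).congr_deriv (by ring))
    (fun x => sub_nonneg.2 (D.curv_le x)) hx
  simp only [supportAt_self, sub_self, cos_zero] at hle
  linarith

theorem one_sub_cos_δ_succ_le :
    1 - cos (D.δ (k + 1) ψ) ≤ 2 * B / r * (1 - cos (D.δ k ψ)) := by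
  have hc := D.isChord k ψ
  have hleft := D.le_mul_one_sub_cos (φ := D.Y k ψ) (x := D.X k ψ)
    ⟨by linarith [hc.left.2], by linarith [hc.left.1, pi_pos]⟩
  have hright := D.mul_one_sub_cos_le (φ := D.Y k ψ) (x := D.X (k + 1) ψ)
    ⟨by linarith [hc.right.2, pi_pos], by linarith [hc.right.1]⟩
  rw [show D.Y k ψ - D.X k ψ = D.δ k ψ by rw [Y, add_sub_cancel_left]] at hleft
  rw [show D.Y k ψ - D.X (k + 1) ψ = -D.δ (k + 1) ψ by linarith [D.X_succ k ψ],
    cos_neg] at hright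
  rw [div_mul_eq_mul_div, le_div_iff₀ D.r_pos]
  linarith [hc.eq]

theorem one_sub_cos_δ_le {n k : ℕ} (hk : k ≤ n) :
    1 - cos (D.δ k ψ) ≤ max 1 (2 * B / r) ^ n * (1 - cos (D.δ 0 ψ)) := by
  have hmax : 1 ≤ max 1 (2 * B / r) := le_max_left _ _
  have hpow : ∀ k, 1 - cos (D.δ k ψ) ≤ max 1 (2 * B / r) ^ k * (1 - cos (D.δ 0 ψ)) := by
    intro k
    induction k with
    | zero => simp
    | succ k ih =>
      calc 1 - cos (D.δ (k + 1) ψ) ≤ 2 * B / r * (1 - cos (D.δ k ψ)) :=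
            D.one_sub_cos_δ_succ_le k ψ
        _ ≤ max 1 (2 * B / r) * (1 - cos (D.δ k ψ)) :=
          mul_le_mul_of_nonneg_right (le_max_right _ _) (sub_nonneg.2 (cos_le_one _))
        _ ≤ max 1 (2 * B / r) * (max 1 (2 * B / r) ^ k * (1 - cos (D.δ 0 ψ))) := by gcongr
        _ = max 1 (2 * B / r) ^ (k + 1) * (1 - cos (D.δ 0 ψ)) := by ring
  exact (hpow k).trans (mul_le_mul_of_nonneg_right (pow_le_pow_right₀ hmax hk)
    (sub_nonneg.2 (cos_le_one _)))

theorem le_one_sub_cos_δ :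
    (1 - cos (π / 4)) / max 1 (2 * B / r) ^ 3 ≤ 1 - cos (D.δ k ψ) := by
  rw [div_le_iff₀' (by positivity)]
  by_contra! hlt
  have hδ : ∀ j ≤ 3, D.δ j (D.X k ψ) < π / 4 := by
    intro j hj
    by_contra! hge
    have hcos := cos_le_cos_of_nonneg_of_le_pi (by linarith [pi_pos])
      (D.δ_mem j (D.X k ψ)).2.le hge
    have hle := D.one_sub_cos_δ_le (D.X k ψ) hj
    rw [show D.δ 0 (D.X k ψ) = D.δ k ψ from rfl] at hle
    linarith
  linarith [D.sum_δ (D.X k ψ), hδ 0 (by norm_num), hδ 1 (by norm_num), hδ 2 (by norm_num),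
    hδ 3 le_rfl]

theorem exists_angle_bound (r B : ℝ) : ∃ c, 0 < c ∧ ∀ D : BilliardDatum r B, ∀ k ψ,
    c ≤ D.δ k ψ ∧ D.δ k ψ ≤ π - c ∧ c ≤ sin (D.δ k ψ) := by
  set c := (1 - cos (π / 4)) / max 1 (2 * B / r) ^ 3
  have hcos : cos (π / 4) < 1 := by
    rw [← cos_zero]
    exact cos_lt_cos_of_nonneg_of_le_pi le_rfl (by linarith [pi_pos]) (by linarith [pi_pos])
  have hc : 0 < c := div_pos (sub_pos.2 hcos) (by positivity)
  have hδ : ∀ (D : BilliardDatum r B) k ψ, c ≤ D.δ k ψ := by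
    intro D k ψ
    have hquad := one_sub_sq_div_two_le_cos (x := D.δ k ψ)
    rcases le_or_gt (D.δ k ψ) 2 with hle | hgt
    · nlinarith [(D.δ_mem k ψ).1, D.le_one_sub_cos_δ k ψ]
    · linarith [neg_one_le_cos (D.δ k ψ), D.le_one_sub_cos_δ k ψ]
  refine ⟨c, hc, fun D k ψ => ⟨hδ D k ψ, ?_, ?_⟩⟩
  · linarith [D.δ_succ_le k ψ, hδ D (k + 1) ψ]
  · have hlow : c ≤ 1 - cos (D.δ k ψ) := D.le_one_sub_cos_δ k ψ
    have hlow' : c ≤ 1 - cos (D.δ (k + 1) ψ) := D.le_one_sub_cos_δ (k + 1) ψ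
    have hcos_le : cos (π - D.δ (k + 1) ψ) ≤ cos (D.δ k ψ) :=
      cos_le_cos_of_nonneg_of_le_pi (D.δ_mem k ψ).1.le (by linarith [(D.δ_mem (k + 1) ψ).1])
        (by linarith [D.δ_succ_le k ψ])
    rw [cos_pi_sub] at hcos_le
    refine le_of_sq_le_sq ?_ (sin_pos_of_pos_of_lt_pi (D.δ_mem k ψ).1 (D.δ_mem k ψ).2).le
    nlinarith [sin_sq_add_cos_sq (D.δ k ψ)]

end BilliardDatum

/-! ### The linearized orbit equations -/

/-- The support function, at the normal angle `v` of a chord, of the vertex between two consecutive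
chords with normal angles `u` and `v`, by which the orbit equation reads
`chordForm h u v = chordForm h w v`. It is the derivative in `v` of the generating function
`2 h((u + v) / 2) sin((v - u) / 2)` of the billiard map. -/
noncomputable def chordForm (h : ℝ → ℝ) (u v : ℝ) : ℝ := supportAt h ((u + v) / 2) v

/-- The derivative of `chordForm` in the first variable, used to linearize the orbit equation. -/
noncomputable def chordForm₁ (h : ℝ → ℝ) (u v : ℝ) : ℝ :=
  (h ((u + v) / 2) + deriv (deriv h) ((u + v) / 2)) * sin ((v - u) / 2) / 2

/-- The derivative of `chordForm` in the second variable, used to linearize the orbit equation. -/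
noncomputable def chordForm₂ (h : ℝ → ℝ) (u v : ℝ) : ℝ :=
  (deriv (deriv h) ((u + v) / 2) - h ((u + v) / 2)) * sin ((v - u) / 2) / 2 +
    deriv h ((u + v) / 2) * cos ((v - u) / 2)

namespace IsSmoothSupport

variable {h : ℝ → ℝ} (hh : IsSmoothSupport h)
include hh

theorem hasDerivAt_chordForm₁ (u v : ℝ) :
    HasDerivAt (fun u => chordForm h u v) (chordForm₁ h u v) u := by
  have hmid : HasDerivAt (fun u => (u + v) / 2) (1 / 2) u :=
    ((hasDerivAt_id u).add_const v).div_const 2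
  refine ((hh.hasDerivAt_supportAt v ((u + v) / 2)).comp u hmid).congr_deriv ?_
  rw [chordForm₁, show v - (u + v) / 2 = (v - u) / 2 by ring]
  ring

theorem hasDerivAt_chordForm₂ (u v : ℝ) :
    HasDerivAt (fun v => chordForm h u v) (chordForm₂ h u v) v := by
  have hmid : HasDerivAt (fun v => (u + v) / 2) (1 / 2) v :=
    ((hasDerivAt_id v).const_add u).div_const 2
  have hsub : HasDerivAt (fun v => v - (u + v) / 2) (1 - 1 / 2) v := (hasDerivAt_id v).sub hmid
  have hval := (hh.hasDerivAt ((u + v) / 2)).comp v hmid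
  have hder := (hh.hasDerivAt_deriv ((u + v) / 2)).comp v hmid
  refine ((hval.mul hsub.cos).add (hder.mul hsub.sin)).congr_deriv ?_
  simp only [Function.comp]
  rw [chordForm₂, show v - (u + v) / 2 = (v - u) / 2 by ring]
  ring

theorem continuous_deriv : Continuous (deriv h) :=
  continuous_iff_continuousAt.2 fun x => (hh.hasDerivAt_deriv x).continuousAt

theorem continuous_deriv_deriv : Continuous (deriv (deriv h)) := by
  have hsucc : ContDiff ℝ (1 + 1) h := by simpa only [one_add_one_eq_two] using hh.contDiff
  have hderiv : ContDiff ℝ (0 + 1) (deriv h) := by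
    simpa only [zero_add] using (contDiff_succ_iff_deriv.1 hsucc).2.2
  exact (contDiff_succ_iff_deriv.1 hderiv).2.2.continuous

theorem continuous_chordForm₁ : Continuous fun p : ℝ × ℝ => chordForm₁ h p.1 p.2 := by
  have := hh.contDiff.continuous
  have := hh.continuous_deriv_deriv
  unfold chordForm₁
  fun_prop

theorem continuous_chordForm₂ : Continuous fun p : ℝ × ℝ => chordForm₂ h p.1 p.2 := by
  have := hh.contDiff.continuous
  have := hh.continuous_deriv
  have := hh.continuous_deriv_deriv
  unfold chordForm₂
  fun_prop

end IsSmoothSupport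

theorem exists_sub_eq_mul_of_hasDerivAt {G g : ℝ → ℝ} (hG : ∀ x, HasDerivAt G (g x) x) (a b : ℝ) :
    ∃ ξ, |ξ - a| ≤ |b - a| ∧ G b - G a = g ξ * (b - a) := by
  have hc : Continuous G := continuous_iff_continuousAt.2 fun x => (hG x).continuousAt
  rcases lt_trichotomy a b with hab | rfl | hba
  · obtain ⟨ξ, hξ, hslope⟩ := exists_hasDerivAt_eq_slope G g hab hc.continuousOn fun x _ => hG x
    refine ⟨ξ, ?_, ((eq_div_iff (sub_pos.2 hab).ne').1 hslope).symm⟩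
    rw [abs_of_pos (sub_pos.2 hξ.1), abs_of_pos (sub_pos.2 hab)]
    exact sub_le_sub_right hξ.2.le a
  · exact ⟨a, le_rfl, by simp⟩
  · obtain ⟨ξ, hξ, hslope⟩ := exists_hasDerivAt_eq_slope G g hba hc.continuousOn fun x _ => hG x
    refine ⟨ξ, ?_, ?_⟩
    · rw [abs_of_neg (sub_neg.2 hξ.2), abs_of_neg (sub_neg.2 hba)]
      linarith [hξ.1]
    · rw [eq_div_iff (sub_pos.2 hba).ne'] at hslope
      linarith

theorem exists_tendsto_mul_slope_eq {G g : ℝ → ℝ → ℝ} (hG : ∀ v u, HasDerivAt (G v) (g v u) u)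
    (hg : Continuous fun p : ℝ × ℝ => g p.1 p.2) {U V : ℝ → ℝ} {t : ℝ} (hU : ContinuousAt U t)
    (hV : ContinuousAt V t) :
    ∃ p : ℝ → ℝ, Tendsto p (𝓝[≠] t) (𝓝 (g (V t) (U t))) ∧
      ∀ s, p s * slope U t s = (G (V s) (U s) - G (V s) (U t)) / (s - t) := by
  choose ξ hξ hGξ using fun s => exists_sub_eq_mul_of_hasDerivAt (hG (V s)) (U t) (U s)
  have hξt : Tendsto ξ (𝓝 t) (𝓝 (U t)) := by
    rw [tendsto_iff_norm_sub_tendsto_zero]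
    exact squeeze_zero (fun _ => norm_nonneg _) hξ (tendsto_iff_norm_sub_tendsto_zero.1 hU.tendsto)
  refine ⟨fun s => g (V s) (ξ s), ((hg.tendsto (V t, U t)).comp
    (hV.tendsto.prodMk_nhds hξt)).mono_left nhdsWithin_le_nhds, fun s => ?_⟩
  rw [slope_def_field, hGξ, mul_div_assoc]

/-- The coefficients of the equations `p k * u k + q k * u (k + 2) = a k * u (k + 1)`, where
`k = 0, 1, 2` and the index of `u` is taken modulo 4. The linearized equations of a 4-periodic
orbit have this form; the equation for `k = 3` is replaced by the normalization of
`JacobiSystem.IsSolution`. -/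
structure JacobiSystem where
  p : Fin 3 → ℝ
  q : Fin 3 → ℝ
  a : Fin 3 → ℝ

namespace JacobiSystem

/-- The solutions of a Jacobi system with `u 3 + u 0 = 2`, the normalization that holds for the
derivatives of the normal angles of the chords. -/
structure IsSolution (S : JacobiSystem) (u : Fin 4 → ℝ) : Prop where
  eq_zero : S.p 0 * u 0 + S.q 0 * u 2 = S.a 0 * u 1
  eq_one : S.p 1 * u 1 + S.q 1 * u 3 = S.a 1 * u 2
  eq_two : S.p 2 * u 2 + S.q 2 * u 0 = S.a 2 * u 3
  sum : u 3 + u 0 = 2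

variable (S : JacobiSystem)

/-- The leading principal minor of order 2 of the system, the pivot for eliminating `u 2`. -/
def det₂ : ℝ := S.a 0 * S.a 1 - S.p 1 * S.q 0

/-- The leading principal minor of order 3 of the system, the pivot for eliminating `u 3`. -/
def det₃ : ℝ := S.det₂ * S.a 2 - S.p 2 * S.q 1 * S.a 0

/-- The coefficient with `det₃ * u 3 = num * u 0` for every solution `u`. -/
def num : ℝ := S.p 2 * S.p 1 * S.p 0 + S.det₂ * S.q 2

/-- The solution of a Jacobi system obtained by elimination; it is meaningful when `a 0`, `det₂`
and `det₃ + num` do not vanish. -/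
noncomputable def sol : Fin 4 → ℝ :=
  let u₀ := 2 * S.det₃ / (S.det₃ + S.num)
  let u₂ := (S.p 1 * S.p 0 * u₀ + S.a 0 * S.q 1 * (2 - u₀)) / S.det₂
  ![u₀, (S.p 0 * u₀ + S.q 0 * u₂) / S.a 0, u₂, 2 - u₀]

theorem sol_zero : S.sol 0 = 2 * S.det₃ / (S.det₃ + S.num) := rfl

theorem sol_one : S.sol 1 = (S.p 0 * S.sol 0 + S.q 0 * S.sol 2) / S.a 0 := rfl

theorem sol_two : S.sol 2 = (S.p 1 * S.p 0 * S.sol 0 + S.a 0 * S.q 1 * S.sol 3) / S.det₂ := rfl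

theorem sol_three : S.sol 3 = 2 - S.sol 0 := rfl

variable {S} {u : Fin 4 → ℝ}

theorem IsSolution.det₂_mul (h : S.IsSolution u) :
    S.det₂ * u 2 = S.p 1 * S.p 0 * u 0 + S.a 0 * S.q 1 * u 3 := by
  unfold det₂
  linear_combination (-S.a 0) * h.eq_one - S.p 1 * h.eq_zero

theorem IsSolution.det₃_mul (h : S.IsSolution u) : S.det₃ * u 3 = S.num * u 0 := by
  unfold det₃ num
  linear_combination (-S.det₂) * h.eq_two + S.p 2 * h.det₂_mul

theorem IsSolution.pos (h : S.IsSolution u) (hp : ∀ i, 0 < S.p i) (hq : ∀ i, 0 < S.q i)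
    (hu : ∀ i, 0 < u i) : 0 < S.a 0 ∧ 0 < S.det₂ ∧ 0 < S.det₃ := by
  have ha : 0 < S.a 0 := pos_of_mul_pos_left (h.eq_zero ▸ add_pos (mul_pos (hp 0) (hu 0))
    (mul_pos (hq 0) (hu 2))) (hu 1).le
  have hdet₂ : 0 < S.det₂ := pos_of_mul_pos_left (h.det₂_mul ▸
    add_pos (mul_pos (mul_pos (hp 1) (hp 0)) (hu 0)) (mul_pos (mul_pos ha (hq 1)) (hu 3))) (hu 2).le
  have hnum : 0 < S.num :=
    add_pos (mul_pos (mul_pos (hp 2) (hp 1)) (hp 0)) (mul_pos hdet₂ (hq 2))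
  exact ⟨ha, hdet₂, pos_of_mul_pos_left (h.det₃_mul ▸ mul_pos hnum (hu 0)) (hu 3).le⟩

theorem IsSolution.eq_sol (h : S.IsSolution u) (ha : S.a 0 ≠ 0) (hdet₂ : S.det₂ ≠ 0)
    (hdet₃ : S.det₃ + S.num ≠ 0) : u = S.sol := by
  have h₀ : u 0 = S.sol 0 := by
    rw [sol_zero, eq_div_iff hdet₃]
    linear_combination S.det₃ * h.sum - h.det₃_mul
  have h₃ : u 3 = S.sol 3 := by rw [sol_three, ← h₀, ← h.sum, add_sub_cancel_right]
  have h₂ : u 2 = S.sol 2 := by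
    rw [sol_two, ← h₀, ← h₃, ← h.det₂_mul, mul_div_cancel_left₀ _ hdet₂]
  have h₁ : u 1 = S.sol 1 := by rw [sol_one, ← h₀, ← h₂, h.eq_zero, mul_div_cancel_left₀ _ ha]
  funext i
  fin_cases i <;> assumption

theorem pos_of_nonneg (hp : ∀ i, 0 < S.p i) (hq : ∀ i, 0 < S.q i) (ha : 0 ≤ S.a 0)
    (hdet₂ : 0 ≤ S.det₂) (hdet₃ : 0 ≤ S.det₃) : 0 < S.a 0 ∧ 0 < S.det₂ ∧ 0 < S.det₃ + S.num := by
  have ha' : 0 < S.a 0 := by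
    refine ha.lt_of_ne fun h => ?_
    rw [det₂, ← h] at hdet₂
    linarith [mul_pos (hp 1) (hq 0)]
  have hdet₂' : 0 < S.det₂ := by
    refine hdet₂.lt_of_ne fun h => ?_
    rw [det₃, ← h] at hdet₃
    linarith [mul_pos (mul_pos (hp 2) (hq 1)) ha']
  exact ⟨ha', hdet₂', add_pos_of_nonneg_of_pos hdet₃
    (add_pos (mul_pos (mul_pos (hp 2) (hp 1)) (hp 0)) (mul_pos hdet₂' (hq 2)))⟩

section Limit

variable {α : Type*} {l : Filter α} {S : α → JacobiSystem} {T : JacobiSystem}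
  (hp : ∀ i, Tendsto (fun s => (S s).p i) l (𝓝 (T.p i)))
  (hq : ∀ i, Tendsto (fun s => (S s).q i) l (𝓝 (T.q i)))
  (ha : ∀ i, Tendsto (fun s => (S s).a i) l (𝓝 (T.a i)))
include hp hq ha

theorem tendsto_det₂ : Tendsto (fun s => (S s).det₂) l (𝓝 T.det₂) :=
  ((ha 0).mul (ha 1)).sub ((hp 1).mul (hq 0))

theorem tendsto_det₃ : Tendsto (fun s => (S s).det₃) l (𝓝 T.det₃) :=
  ((tendsto_det₂ hp hq ha).mul (ha 2)).sub (((hp 2).mul (hq 1)).mul (ha 0))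

theorem tendsto_num : Tendsto (fun s => (S s).num) l (𝓝 T.num) :=
  (((hp 2).mul (hp 1)).mul (hp 0)).add ((tendsto_det₂ hp hq ha).mul (hq 2))

theorem tendsto_sol (ha₀ : T.a 0 ≠ 0) (hdet₂ : T.det₂ ≠ 0) (hdet₃ : T.det₃ + T.num ≠ 0) :
    ∀ i, Tendsto (fun s => (S s).sol i) l (𝓝 (T.sol i)) := by
  have h₀ : Tendsto (fun s => (S s).sol 0) l (𝓝 (T.sol 0)) :=
    ((tendsto_det₃ hp hq ha).const_mul 2).div
      ((tendsto_det₃ hp hq ha).add (tendsto_num hp hq ha)) hdet₃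
  have h₃ : Tendsto (fun s => (S s).sol 3) l (𝓝 (T.sol 3)) := h₀.const_sub 2
  have h₂ : Tendsto (fun s => (S s).sol 2) l (𝓝 (T.sol 2)) :=
    ((((hp 1).mul (hp 0)).mul h₀).add (((ha 0).mul (hq 1)).mul h₃)).div
      (tendsto_det₂ hp hq ha) hdet₂
  have h₁ : Tendsto (fun s => (S s).sol 1) l (𝓝 (T.sol 1)) :=
    (((hp 0).mul h₀).add ((hq 0).mul h₂)).div (ha 0) ha₀
  intro i
  fin_cases i <;> assumption

variable [l.NeBot] (hpT : ∀ i, 0 < T.p i) (hqT : ∀ i, 0 < T.q i) {u : α → Fin 4 → ℝ}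
  (hsol : ∀ᶠ s in l, (S s).IsSolution (u s)) (hu : ∀ᶠ s in l, ∀ i, 0 < u s i)
include hpT hqT hsol hu

theorem nonneg_of_tendsto : 0 ≤ T.a 0 ∧ 0 ≤ T.det₂ ∧ 0 ≤ T.det₃ := by
  have hpos : ∀ᶠ s in l, 0 < (S s).a 0 ∧ 0 < (S s).det₂ ∧ 0 < (S s).det₃ := by
    filter_upwards [hsol, hu, eventually_all.2 fun i => (hp i).eventually_const_lt (hpT i),
      eventually_all.2 fun i => (hq i).eventually_const_lt (hqT i)] with s hs hus hps hqs
    exact hs.pos hps hqs hus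
  exact ⟨ge_of_tendsto (ha 0) (hpos.mono fun s hs => hs.1.le),
    ge_of_tendsto (tendsto_det₂ hp hq ha) (hpos.mono fun s hs => hs.2.1.le),
    ge_of_tendsto (tendsto_det₃ hp hq ha) (hpos.mono fun s hs => hs.2.2.le)⟩

theorem tendsto_of_isSolution (i : Fin 4) : Tendsto (fun s => u s i) l (𝓝 (T.sol i)) := by
  obtain ⟨ha₀, hdet₂, hdet₃⟩ := nonneg_of_tendsto hp hq ha hpT hqT hsol hu
  obtain ⟨ha₀, hdet₂, hdet₃⟩ := pos_of_nonneg hpT hqT ha₀ hdet₂ hdet₃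
  refine (tendsto_sol hp hq ha ha₀.ne' hdet₂.ne' hdet₃.ne' i).congr' ?_
  filter_upwards [hsol, (ha 0).eventually_ne ha₀.ne',
    (tendsto_det₂ hp hq ha).eventually_ne hdet₂.ne',
    ((tendsto_det₃ hp hq ha).add (tendsto_num hp hq ha)).eventually_ne hdet₃.ne'] with s hs h₁ h₂ h₃
  rw [hs.eq_sol h₁ h₂ h₃]

end Limit

end JacobiSystem

namespace BilliardDatum

variable {r B : ℝ}

/-- The off-diagonal coefficients of the linearized orbit equations (see `linear_eq`). -/
noncomputable def b (k : ℕ) (D : BilliardDatum r B) (ψ : ℝ) : ℝ :=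
  (D.h (D.X k ψ) + deriv (deriv D.h) (D.X k ψ)) * sin (D.δ k ψ) / 2

/-- The diagonal coefficients of the linearized orbit equations (see `linear_eq`). -/
noncomputable def A (k : ℕ) (D : BilliardDatum r B) (ψ : ℝ) : ℝ :=
  (D.h (D.X (k + 1) ψ) - deriv (deriv D.h) (D.X (k + 1) ψ)) * sin (D.δ (k + 1) ψ) / 2 +
    deriv D.h (D.X (k + 1) ψ) * cos (D.δ (k + 1) ψ) -
  ((deriv (deriv D.h) (D.X k ψ) - D.h (D.X k ψ)) * sin (D.δ k ψ) / 2 +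
    deriv D.h (D.X k ψ) * cos (D.δ k ψ))

variable (D : BilliardDatum r B) (k : ℕ) (ψ : ℝ)

theorem chordForm_eq : chordForm D.h (D.Y k ψ) (D.Y (k + 1) ψ) =
    chordForm D.h (D.Y (k + 2) ψ) (D.Y (k + 1) ψ) := by
  rw [chordForm, D.chord_eq, chordForm, add_comm (D.Y (k + 2) ψ)]

theorem chordForm₁_eq : chordForm₁ D.h (D.Y k ψ) (D.Y (k + 1) ψ) = D.b (k + 1) ψ := by
  rw [b, X_succ_eq, δ_succ_eq, chordForm₁]

theorem chordForm₁_add_two_eq :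
    chordForm₁ D.h (D.Y (k + 2) ψ) (D.Y (k + 1) ψ) = -D.b (k + 2) ψ := by
  rw [b, X_succ_eq, δ_succ_eq, chordForm₁, add_comm (D.Y (k + 2) ψ),
    show (D.Y (k + 1) ψ - D.Y (k + 2) ψ) / 2 = -((D.Y (k + 2) ψ - D.Y (k + 1) ψ) / 2) by ring,
    sin_neg]
  ring

theorem chordForm₂_sub_eq : chordForm₂ D.h (D.Y (k + 2) ψ) (D.Y (k + 1) ψ) -
    chordForm₂ D.h (D.Y k ψ) (D.Y (k + 1) ψ) = D.A (k + 1) ψ := by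
  rw [A, X_succ_eq, δ_succ_eq, X_succ_eq, δ_succ_eq, chordForm₂, chordForm₂,
    add_comm (D.Y (k + 2) ψ),
    show (D.Y (k + 1) ψ - D.Y (k + 2) ψ) / 2 = -((D.Y (k + 2) ψ - D.Y (k + 1) ψ) / 2) by ring,
    sin_neg, cos_neg]
  ring

theorem slope_Y_pos {s : ℝ} (hs : s ≠ ψ) : 0 < slope (D.Y k) ψ s := by
  rw [slope_def_field]
  rcases hs.lt_or_gt with h | h
  · exact div_pos_of_neg_of_neg (sub_neg.2 (D.strictMono_Y k h)) (sub_neg.2 h)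
  · exact div_pos (sub_pos.2 (D.strictMono_Y k h)) (sub_pos.2 h)

theorem exists_tendsto_mul_slope_left (j : ℕ) : ∃ p : ℝ → ℝ,
    Tendsto p (𝓝[≠] ψ) (𝓝 (chordForm₁ D.h (D.Y j ψ) (D.Y k ψ))) ∧
      ∀ s, p s * slope (D.Y j) ψ s = (chordForm D.h (D.Y j s) (D.Y k s) -
        chordForm D.h (D.Y j ψ) (D.Y k s)) / (s - ψ) :=
  exists_tendsto_mul_slope_eq (G := fun v u => chordForm D.h u v)
    (g := fun v u => chordForm₁ D.h u v) (fun v u => D.smooth.hasDerivAt_chordForm₁ u v)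
    (D.smooth.continuous_chordForm₁.comp continuous_swap) (D.continuous_Y j).continuousAt
    (D.continuous_Y k).continuousAt

theorem exists_tendsto_mul_slope_right (v : ℝ) : ∃ p : ℝ → ℝ,
    Tendsto p (𝓝[≠] ψ) (𝓝 (chordForm₂ D.h v (D.Y k ψ))) ∧
      ∀ s, p s * slope (D.Y k) ψ s =
        (chordForm D.h v (D.Y k s) - chordForm D.h v (D.Y k ψ)) / (s - ψ) :=
  exists_tendsto_mul_slope_eq (G := fun v u => chordForm D.h v u)
    (g := fun v u => chordForm₂ D.h v u) (V := fun _ => v)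
    (fun v u => D.smooth.hasDerivAt_chordForm₂ v u) D.smooth.continuous_chordForm₂
    (D.continuous_Y k).continuousAt continuousAt_const

theorem exists_slope_system : ∃ p q a : ℝ → ℝ,
    Tendsto p (𝓝[≠] ψ) (𝓝 (D.b (k + 1) ψ)) ∧ Tendsto q (𝓝[≠] ψ) (𝓝 (D.b (k + 2) ψ)) ∧
    Tendsto a (𝓝[≠] ψ) (𝓝 (D.A (k + 1) ψ)) ∧ ∀ s,
      p s * slope (D.Y k) ψ s + q s * slope (D.Y (k + 2)) ψ s =
        a s * slope (D.Y (k + 1)) ψ s := by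
  obtain ⟨p, hp, hp_eq⟩ := D.exists_tendsto_mul_slope_left (k + 1) ψ k
  obtain ⟨q, hq, hq_eq⟩ := D.exists_tendsto_mul_slope_left (k + 1) ψ (k + 2)
  obtain ⟨a₀, ha₀, ha₀_eq⟩ := D.exists_tendsto_mul_slope_right (k + 1) ψ (D.Y k ψ)
  obtain ⟨a₂, ha₂, ha₂_eq⟩ := D.exists_tendsto_mul_slope_right (k + 1) ψ (D.Y (k + 2) ψ)
  have hq_neg := hq.neg
  rw [chordForm₁_add_two_eq, neg_neg] at hq_neg
  refine ⟨p, fun s => -q s, fun s => a₂ s - a₀ s, chordForm₁_eq D k ψ ▸ hp, hq_neg,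
    chordForm₂_sub_eq D k ψ ▸ ha₂.sub ha₀, fun s => ?_⟩
  rw [hp_eq, neg_mul, hq_eq, sub_mul, ha₀_eq, ha₂_eq, D.chordForm_eq k s, D.chordForm_eq k ψ]
  ring

theorem b_add_four : D.b (k + 4) ψ = D.b k ψ := by
  rw [b, b, X_add_four, δ_add_four, D.smooth.periodic,
    periodic_deriv (periodic_deriv D.smooth.periodic)]

theorem slope_Y_add_four (s : ℝ) : slope (D.Y (k + 4)) ψ s = slope (D.Y k) ψ s := by
  simp only [slope_def_field, Y_add_four]
  ring

theorem slope_Y_sum {s : ℝ} (hs : s ≠ ψ) : slope (D.Y 3) ψ s + slope (D.Y 0) ψ s = 2 := by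
  have hsum : ∀ x, D.Y 3 x + D.Y 0 x = 2 * x + 2 * π := fun x => by
    rw [Y_three_eq, Y]
    simp only [δ, X_zero]
    ring
  rw [slope_def_field, slope_def_field, ← add_div, div_eq_iff (sub_ne_zero.2 hs)]
  linarith [hsum s, hsum ψ]

theorem b_pos : 0 < D.b k ψ :=
  half_pos (mul_pos (D.r_pos.trans_le (D.curv _))
    (sin_pos_of_pos_of_lt_pi (D.δ_mem k ψ).1 (D.δ_mem k ψ).2))

/-- The linearized orbit equations at `ψ`, for the derivatives of the normal angles of the
chords. -/
noncomputable def linearization (D : BilliardDatum r B) (ψ : ℝ) : JacobiSystem where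
  p i := D.b (i + 1) ψ
  q i := D.b (i + 2) ψ
  a i := D.A (i + 1) ψ

theorem linearization_nonneg_and_tendsto_slope :
    (0 ≤ (D.linearization ψ).a 0 ∧ 0 ≤ (D.linearization ψ).det₂ ∧ 0 ≤ (D.linearization ψ).det₃) ∧
    ∀ i : Fin 4, Tendsto (slope (D.Y i) ψ) (𝓝[≠] ψ) (𝓝 ((D.linearization ψ).sol i)) := by
  choose p q a hp hq ha heq using fun i : Fin 3 => D.exists_slope_system i ψ
  have hsol : ∀ᶠ s in 𝓝[≠] ψ, JacobiSystem.IsSolution ⟨(p · s), (q · s), (a · s)⟩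
      fun i : Fin 4 => slope (D.Y i) ψ s := by
    filter_upwards [self_mem_nhdsWithin] with s hs
    exact ⟨heq 0 s, heq 1 s, D.slope_Y_add_four 0 ψ s ▸ heq 2 s, D.slope_Y_sum ψ hs⟩
  have hpos : ∀ᶠ s in 𝓝[≠] ψ, ∀ i : Fin 4, 0 < slope (D.Y i) ψ s :=
    eventually_mem_nhdsWithin.mono fun s hs i => D.slope_Y_pos i ψ hs
  have hb : ∀ k, 0 < D.b k ψ := fun k => D.b_pos k ψ
  exact ⟨JacobiSystem.nonneg_of_tendsto hp hq ha (fun _ => hb _) (fun _ => hb _) hsol hpos,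
    JacobiSystem.tendsto_of_isSolution hp hq ha (fun _ => hb _) (fun _ => hb _) hsol hpos⟩

theorem linearization_nonneg : 0 ≤ (D.linearization ψ).a 0 ∧ 0 ≤ (D.linearization ψ).det₂ ∧
    0 ≤ (D.linearization ψ).det₃ := (D.linearization_nonneg_and_tendsto_slope ψ).1

/-- The speed of the normal angle of the `k`-th chord, the unknown of the linearized orbit
equations. -/
noncomputable def U (k : ℕ) (D : BilliardDatum r B) (ψ : ℝ) : ℝ := deriv (D.Y k) ψ

theorem hasDerivAt_Y_sol (i : Fin 4) : HasDerivAt (D.Y i) ((D.linearization ψ).sol i) ψ :=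
  hasDerivAt_iff_tendsto_slope.2 ((D.linearization_nonneg_and_tendsto_slope ψ).2 i)

theorem U_eq_sol (i : Fin 4) : D.U i ψ = (D.linearization ψ).sol i :=
  (D.hasDerivAt_Y_sol ψ i).deriv

theorem U_three : D.U 3 ψ = 2 - D.U 0 ψ := by
  rw [show D.U 3 ψ = (D.linearization ψ).sol 3 from D.U_eq_sol ψ 3,
    show D.U 0 ψ = (D.linearization ψ).sol 0 from D.U_eq_sol ψ 0, JacobiSystem.sol_three]

theorem hasDerivAt_Y : HasDerivAt (D.Y k) (D.U k ψ) ψ := by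
  rw [U, hasDerivAt_deriv_iff]
  induction k using Nat.strong_induction_on with
  | _ k ih =>
    rcases lt_or_ge k 4 with hk | hk
    · exact (D.hasDerivAt_Y_sol ψ ⟨k, hk⟩).differentiableAt
    · obtain ⟨j, rfl⟩ := Nat.exists_eq_add_of_le' hk
      rw [show D.Y (j + 4) = fun x => D.Y j x + 2 * π from funext (D.Y_add_four j)]
      exact (ih j (by omega)).add_const _

theorem U_add_four : D.U (k + 4) ψ = D.U k ψ := by
  rw [U, show D.Y (k + 4) = fun x => D.Y k x + 2 * π from funext (D.Y_add_four k),
    deriv_add_const, U]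

theorem U_nonneg : 0 ≤ D.U k ψ := (D.strictMono_Y k).monotone.deriv_nonneg

theorem linear_eq : D.b (k + 1) ψ * D.U k ψ + D.b (k + 2) ψ * D.U (k + 2) ψ =
    D.A (k + 1) ψ * D.U (k + 1) ψ := by
  obtain ⟨p, q, a, hp, hq, ha, heq⟩ := D.exists_slope_system k ψ
  have hslope := fun k => hasDerivAt_iff_tendsto_slope.1 (D.hasDerivAt_Y k ψ)
  refine tendsto_nhds_unique ((hp.mul (hslope k)).add (hq.mul (hslope (k + 2)))) ?_
  exact (ha.mul (hslope (k + 1))).congr fun s => (heq s).symm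

variable {l : Filter (BilliardDatum r B)} {n : ℕ}

theorem uniformO_h (hn : n ≤ 6) : UniformO l n 1 fun D : BilliardDatum r B => D.h :=
  UniformO.of_le ⟨max B 0, le_max_right _ _, Eventually.of_forall fun D =>
    D.bound.mono le_rfl (by simp)⟩ hn

theorem uniformO_deriv_h (hn : n ≤ 5) :
    UniformO l n 1 fun D : BilliardDatum r B => deriv D.h :=
  (uniformO_h le_rfl).deriv.of_le hn

theorem uniformO_deriv_deriv_h (hn : n ≤ 4) :
    UniformO l n 1 fun D : BilliardDatum r B => deriv (deriv D.h) :=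
  (uniformO_deriv_h le_rfl).deriv.of_le hn

section Bootstrap

variable {k : ℕ} (hY : ∀ k, UniformO l n 1 fun (D : BilliardDatum r B) x => D.Y k x - x)
include hY

theorem uniformO_X_succ : UniformO l n 1 fun D x => X (k + 1) D x - x :=
  (((hY k).add (hY (k + 1))).const_mul (1 / 2)).congr fun D x => by
    rw [X_succ_eq]
    ring

theorem uniformO_δ_succ : UniformO l n 1 (δ (k + 1)) :=
  (((hY (k + 1)).sub (hY k)).const_mul (1 / 2)).congr fun D x => by
    rw [δ_succ_eq]
    ring

theorem uniformO_b_succ (hn : n ≤ 4) : UniformO l n 1 (b (k + 1)) := by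
  have hX := uniformO_X_succ (k := k) hY
  have hsin := UniformO.bdd_sin.comp_bdd (uniformO_δ_succ (k := k) hY)
  have hh := (uniformO_h (hn.trans (by norm_num))).comp hX
  have hh₂ := (uniformO_deriv_deriv_h hn).comp hX
  exact (((hh.add hh₂).mul_bdd hsin).const_mul (1 / 2)).congr fun D x => by
    rw [b]
    ring

theorem uniformO_A_succ (hn : n ≤ 4) : UniformO l n 1 (A (k + 1)) := by
  have hX := fun k => uniformO_X_succ (k := k) hY
  have hsin := fun k => UniformO.bdd_sin.comp_bdd (uniformO_δ_succ (k := k) hY)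
  have hcos := fun k => UniformO.bdd_cos.comp_bdd (uniformO_δ_succ (k := k) hY)
  have hh := fun k => (uniformO_h (hn.trans (by norm_num))).comp (hX k)
  have hh₁ := fun k => (uniformO_deriv_h (hn.trans (by norm_num))).comp (hX k)
  have hh₂ := fun k => (uniformO_deriv_deriv_h hn).comp (hX k)
  exact ((((((hh (k + 1)).sub (hh₂ (k + 1))).mul_bdd (hsin (k + 1))).const_mul (1 / 2)).add
    ((hh₁ (k + 1)).mul_bdd (hcos (k + 1)))).sub
    (((((hh₂ k).sub (hh k)).mul_bdd (hsin k)).const_mul (1 / 2)).add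
    ((hh₁ k).mul_bdd (hcos k)))).congr fun D x => by
      rw [A]
      ring

end Bootstrap

theorem uniformPos_sin_δ (k : ℕ) : UniformPos l fun (D : BilliardDatum r B) x => sin (D.δ k x) := by
  obtain ⟨c, hc, h⟩ := exists_angle_bound r B
  exact ⟨c, hc, Eventually.of_forall fun D x => (h D k x).2.2⟩

theorem uniformPos_radius (r B : ℝ) {l : Filter (BilliardDatum r B)} :
    UniformPos l fun (D : BilliardDatum r B) x => D.h x + deriv (deriv D.h) x := by
  rcases le_or_gt r 0 with hr | hr
  · exact ⟨1, one_pos, Eventually.of_forall fun D => absurd D.r_pos hr.not_gt⟩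
  · exact ⟨r, hr, Eventually.of_forall fun D => D.curv⟩

theorem uniformPos_b (k : ℕ) : UniformPos l (b (r := r) (B := B) k) := by
  refine ((UniformPos.mul ⟨1 / 2, by norm_num, Eventually.of_forall fun _ _ => le_rfl⟩
    ((uniformPos_radius r B).comp (X := X k))).mul (uniformPos_sin_δ k)).mono
    (Eventually.of_forall fun D x => ?_)
  rw [b]
  exact le_of_eq (by ring)

theorem uniformO_Y_zero (k : ℕ) : UniformO l 0 1 fun (D : BilliardDatum r B) x => Y k D x - x := by
  refine UniformO.zero_of_abs_le (C := 2 * π * k + π)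
    (Eventually.of_forall fun D => (D.continuous_Y k).sub continuous_id) (by positivity)
    (Eventually.of_forall fun D x => ?_)
  simpa using D.abs_Y_sub_le k x

theorem uniformPos_A_one : UniformPos l (A (r := r) (B := B) 1) := by
  refine ((uniformPos_b 2).mul (uniformPos_b 2)).of_mul_ge
    (uniformO_A_succ (k := 1) uniformO_Y_zero (Nat.zero_le _))
    (Eventually.of_forall fun D x => (D.linearization_nonneg x).1)
    (Eventually.of_forall fun D x => ?_)
  exact sub_nonneg.1 (D.linearization_nonneg x).2.1

theorem uniformPos_det₂ :
    UniformPos l fun (D : BilliardDatum r B) x => (D.linearization x).det₂ := by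
  refine (((uniformPos_b 3).mul (uniformPos_b 3)).mul uniformPos_A_one).of_mul_ge
    (uniformO_A_succ (k := 2) uniformO_Y_zero (Nat.zero_le _))
    (Eventually.of_forall fun D x => (D.linearization_nonneg x).2.1)
    (Eventually.of_forall fun D x => ?_)
  exact sub_nonneg.1 (D.linearization_nonneg x).2.2

theorem uniformPos_det₃_add_num : UniformPos l fun (D : BilliardDatum r B) x =>
    (D.linearization x).det₃ + (D.linearization x).num := by
  refine (((uniformPos_b 3).mul (uniformPos_b 2)).mul (uniformPos_b 1)).mono
    (Eventually.of_forall fun D x => ?_)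
  obtain ⟨-, hdet₂, hdet₃⟩ := D.linearization_nonneg x
  exact le_add_of_nonneg_of_le hdet₃ (le_add_of_nonneg_right (mul_nonneg hdet₂ (D.b_pos 4 x).le))

theorem uniformO_sol (hn : n ≤ 4)
    (hY : ∀ k, UniformO l n 1 fun (D : BilliardDatum r B) x => Y k D x - x) (i : Fin 4) :
    UniformO l n 1 fun (D : BilliardDatum r B) x => (D.linearization x).sol i := by
  have hb := fun k => uniformO_b_succ (k := k) hY hn
  have hA := fun k => uniformO_A_succ (k := k) hY hn
  have hdet₂ : UniformO l n 1 fun (D : BilliardDatum r B) x => (D.linearization x).det₂ :=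
    ((hA 0).mul_bdd (hA 1)).sub ((hb 1).mul_bdd (hb 1))
  have hdet₃ : UniformO l n 1 fun (D : BilliardDatum r B) x => (D.linearization x).det₃ :=
    (hdet₂.mul_bdd (hA 2)).sub (((hb 2).mul_bdd (hb 2)).mul_bdd (hA 0))
  have hnum : UniformO l n 1 fun (D : BilliardDatum r B) x => (D.linearization x).num :=
    (((hb 2).mul_bdd (hb 1)).mul_bdd (hb 0)).add (hdet₂.mul_bdd (hb 3))
  have h₀ : UniformO l n 1 fun (D : BilliardDatum r B) x => (D.linearization x).sol 0 :=
    (hdet₃.const_mul 2).div (hdet₃.add hnum) uniformPos_det₃_add_num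
  have h₃ : UniformO l n 1 fun (D : BilliardDatum r B) x => (D.linearization x).sol 3 :=
    (UniformO.bdd_const 2).sub h₀
  have h₂ : UniformO l n 1 fun (D : BilliardDatum r B) x => (D.linearization x).sol 2 :=
    ((((hb 1).mul_bdd (hb 0)).mul_bdd h₀).add (((hA 0).mul_bdd (hb 2)).mul_bdd h₃)).div hdet₂
      uniformPos_det₂
  have h₁ : UniformO l n 1 fun (D : BilliardDatum r B) x => (D.linearization x).sol 1 :=
    (((hb 0).mul_bdd h₀).add ((hb 1).mul_bdd h₂)).div (hA 0) uniformPos_A_one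
  fin_cases i <;> assumption

theorem uniformO_U_of_uniformO_Y (hn : n ≤ 4)
    (hY : ∀ k, UniformO l n 1 fun (D : BilliardDatum r B) x => Y k D x - x) (k : ℕ) :
    UniformO l n 1 (U (r := r) (B := B) k) := by
  induction k using Nat.strong_induction_on with
  | _ k ih =>
    rcases lt_or_ge k 4 with hk | hk
    · exact (uniformO_sol hn hY ⟨k, hk⟩).congr fun D x => (D.U_eq_sol x ⟨k, hk⟩).symm
    · obtain ⟨j, rfl⟩ := Nat.exists_eq_add_of_le' hk
      exact (ih j (by omega)).congr fun D x => (D.U_add_four j x).symm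

theorem uniformO_Y (hn : n ≤ 5) (k : ℕ) :
    UniformO l n 1 fun (D : BilliardDatum r B) x => Y k D x - x := by
  induction n generalizing k with
  | zero => exact uniformO_Y_zero k
  | succ n ih =>
    have hU := uniformO_U_of_uniformO_Y (by omega) (ih (by omega)) k
    exact UniformO.succ_of_hasDerivAt (uniformO_Y_zero k)
      (Eventually.of_forall fun D x => (D.hasDerivAt_Y k x).sub (hasDerivAt_id x))
      (hU.sub (UniformO.bdd_const 1))

theorem uniformO_U (hn : n ≤ 4) (k : ℕ) : UniformO l n 1 (U (r := r) (B := B) k) :=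
  uniformO_U_of_uniformO_Y hn (fun k => uniformO_Y (by omega) k) k

theorem uniformO_δ (hn : n ≤ 5) (k : ℕ) : UniformO l n 1 (δ (r := r) (B := B) k) :=
  (uniformO_δ_succ (k := k + 3) (uniformO_Y hn)).congr fun D x => D.δ_add_four k x

theorem uniformO_X (hn : n ≤ 5) (k : ℕ) :
    UniformO l n 1 fun (D : BilliardDatum r B) x => X k D x - x :=
  ((uniformO_X_succ (k := k + 3) (uniformO_Y hn)).sub (UniformO.bdd_const (2 * π))).congr
    fun D x => by
      rw [show k + 3 + 1 = k + 4 by ring, X_add_four]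
      ring

theorem uniformO_d (hn : n ≤ 5) : UniformO l n 1 fun D : BilliardDatum r B => D.d :=
  uniformO_δ hn 0

theorem uniformPos_U_zero : UniformPos l (U (r := r) (B := B) 0) := by
  have hb : UniformPos l fun (D : BilliardDatum r B) x => 2 * D.b 4 x :=
    UniformPos.mul ⟨2, two_pos, Eventually.of_forall fun _ _ => le_rfl⟩ (uniformPos_b 4)
  refine hb.of_mul_ge ((uniformO_A_succ (k := 3) uniformO_Y_zero (Nat.zero_le _)).add
    (uniformO_b_succ (k := 3) uniformO_Y_zero (Nat.zero_le _)))
    (Eventually.of_forall fun D x => D.U_nonneg 0 x) (Eventually.of_forall fun D x => ?_)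
  have hlin := D.linear_eq 3 x
  norm_num only at hlin
  rw [b_add_four D 1, U_add_four D 1, U_add_four D 0, U_three] at hlin
  linarith [mul_nonneg (D.b_pos 1 x).le (D.U_nonneg 1 x)]

end BilliardDatum

/-! ### Comparison with the reflected orbit -/

theorem sin_le_sin_of_mem_Icc {a x : ℝ} (ha : 0 ≤ a) (hx : x ∈ Icc a (π - a)) :
    sin a ≤ sin x := by
  rcases le_total x (π / 2) with h | h
  · exact sin_le_sin_of_le_of_le_pi_div_two (by linarith [pi_pos]) h hx.1
  · rw [← sin_pi_sub x]
    exact sin_le_sin_of_le_of_le_pi_div_two (by linarith [pi_pos]) (by linarith)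
      (by linarith [hx.2])

theorem le_of_periodic_of_neighbours {g : ℕ → ℝ} {a β L c : ℝ} {j : ℕ} (hβ : 0 < β) (hL : 0 ≤ L)
    (ha : 0 ≤ a) (hac : a / β ≤ c) (hper : Function.Periodic g 4) (hg : ∀ k, 0 ≤ g k)
    (hj : g j = 0) (h : ∀ k, g (k + 1) ≤ c → β * (g k + g (k + 2)) ≤ a + L * g (k + 1)) (k : ℕ) :
    g k ≤ a / β + (a + L * (a / β)) / β := by
  have hfirst : 0 ≤ a / β := div_nonneg ha hβ.le
  have hsecond : 0 ≤ (a + L * (a / β)) / β := by positivity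
  have hle {u v b : ℝ} (hv : 0 ≤ v) (huv : β * (u + v) ≤ b) : u ≤ b / β := by
    rw [le_div_iff₀' hβ]
    linarith [mul_nonneg hβ.le hv]
  have hj_four : g (j + 4) = 0 := (hper j).trans hj
  have hj_touch : β * (g (j + 3) + g (j + 1)) ≤ a := by
    simpa only [hj_four, hper (j + 1), add_right_comm j 1, mul_zero, add_zero]
      using h (j + 3) (hj_four.trans_le (hfirst.trans hac))
  have hj_one : g (j + 1) ≤ a / β := hle (hg (j + 3)) (by rwa [add_comm])
  have hj_two : g (j + 2) ≤ (a + L * (a / β)) / β := hle (hg j) <| by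
    linarith [h j (hj_one.trans hac), mul_le_mul_of_nonneg_left hj_one hL]
  have hk : g k = g (j + (k + 3 * j) % 4) := by
    rw [← hper.map_mod_nat k, ← hper.map_mod_nat (j + _)]
    congr 1
    omega
  have hlt : (k + 3 * j) % 4 < 4 := Nat.mod_lt _ (by norm_num)
  rw [hk]
  interval_cases (k + 3 * j) % 4
  · rw [add_zero, hj]
    exact add_nonneg hfirst hsecond
  · linarith
  · linarith
  · linarith [hle (hg (j + 1)) hj_touch]

namespace BilliardDatum

variable {r B : ℝ}

section ChordForm

variable (D : BilliardDatum r B) {a u u' v : ℝ} (ha : 0 ≤ a) (hu : u ≤ u')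
include ha hu

theorem mul_sub_le_chordForm_sub_left (hlow : 2 * a ≤ v - u') (hup : v - u ≤ 2 * π - 2 * a) :
    r * sin a / 2 * (u' - u) ≤ chordForm D.h u' v - chordForm D.h u v := by
  have hderiv := fun u => D.smooth.hasDerivAt_chordForm₁ u v
  refine (convex_Icc u u').mul_sub_le_image_sub_of_le_deriv
    (fun x _ => (hderiv x).continuousAt.continuousWithinAt)
    (fun x _ => (hderiv x).differentiableAt.differentiableWithinAt) (fun x hx => ?_) u
    (left_mem_Icc.2 hu) u' (right_mem_Icc.2 hu) hu
  rw [interior_Icc] at hx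
  rw [(hderiv x).deriv, chordForm₁]
  have hsin : sin a ≤ sin ((v - x) / 2) :=
    sin_le_sin_of_mem_Icc ha ⟨by linarith [hx.2], by linarith [hx.1]⟩
  have hsin_nonneg : 0 ≤ sin a := sin_nonneg_of_nonneg_of_le_pi ha (by linarith)
  have hmul := mul_le_mul (D.curv ((x + v) / 2)) hsin hsin_nonneg (D.r_pos.le.trans (D.curv _))
  linarith

theorem mul_sub_le_chordForm_sub_right (hlow : 2 * a ≤ u - v) (hup : u' - v ≤ 2 * π - 2 * a) :
    r * sin a / 2 * (u' - u) ≤ chordForm D.h u v - chordForm D.h u' v := by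
  have hderiv := fun u => (D.smooth.hasDerivAt_chordForm₁ u v).neg
  suffices h : r * sin a / 2 * (u' - u) ≤ -chordForm D.h u' v - -chordForm D.h u v by linarith
  refine (convex_Icc u u').mul_sub_le_image_sub_of_le_deriv
    (f := -fun u => chordForm D.h u v)
    (fun x _ => (hderiv x).continuousAt.continuousWithinAt)
    (fun x _ => (hderiv x).differentiableAt.differentiableWithinAt) (fun x hx => ?_) u
    (left_mem_Icc.2 hu) u' (right_mem_Icc.2 hu) hu
  rw [interior_Icc] at hx
  rw [(hderiv x).deriv, chordForm₁, show (v - x) / 2 = -((x - v) / 2) by ring, sin_neg]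
  have hsin : sin a ≤ sin ((x - v) / 2) :=
    sin_le_sin_of_mem_Icc ha ⟨by linarith [hx.1], by linarith [hx.2]⟩
  have hsin_nonneg : 0 ≤ sin a := sin_nonneg_of_nonneg_of_le_pi ha (by linarith)
  have hmul := mul_le_mul (D.curv ((x + v) / 2)) hsin hsin_nonneg (D.r_pos.le.trans (D.curv _))
  linarith

end ChordForm

section Reflection

variable (D : BilliardDatum r B)

theorem abs_chordForm_sub_le (u v v' : ℝ) :
    |chordForm D.h u v' - chordForm D.h u v| ≤ 2 * B * |v' - v| := by
  have hderiv := fun v => D.smooth.hasDerivAt_chordForm₂ u v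
  refine Convex.norm_image_sub_le_of_norm_deriv_le
    (fun z _ => (hderiv z).differentiableAt) (fun z _ => ?_) convex_univ (mem_univ v) (mem_univ v')
  rw [(hderiv z).deriv, chordForm₂, Real.norm_eq_abs]
  set m := (u + z) / 2
  set q := (z - u) / 2
  have hsin : |(deriv (deriv D.h) m - D.h m) * sin q| ≤ 2 * B * 1 := by
    rw [abs_mul]
    refine mul_le_mul ?_ (abs_sin_le_one q) (abs_nonneg _) (by linarith [D.B_pos])
    exact (abs_sub _ _).trans (by linarith [D.abs_h_le m, D.abs_deriv_deriv_h_le m])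
  have hcos : |deriv D.h m * cos q| ≤ B * 1 := by
    rw [abs_mul]
    exact mul_le_mul (D.abs_deriv_h_le m) (abs_cos_le_one q) (abs_nonneg _) D.B_pos.le
  refine (abs_add_le _ _).trans ?_
  rw [abs_div, abs_of_pos (two_pos : (0 : ℝ) < 2)]
  linarith

theorem deriv_h_add_pi_sub (x : ℝ) :
    deriv (fun x => D.h (x + π) - D.h x) x = deriv D.h (x + π) - deriv D.h x :=
  ((HasDerivAt.comp_add_const x π (D.smooth.hasDerivAt (x + π))).sub
    (D.smooth.hasDerivAt x)).deriv

theorem abs_chordForm_add_pi_sub_le (u v : ℝ) :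
    |chordForm D.h (u + π) (v + π) - chordForm D.h u v| ≤ 4 * D.ε := by
  set m := (u + v) / 2 with hm
  have hnear : |D.h (m + π) - D.h m| ≤ 2 * D.ε := D.near.abs_le m
  have hnear' : |deriv D.h (m + π) - deriv D.h m| ≤ 2 * D.ε := by
    rw [← deriv_h_add_pi_sub]
    exact (CBound.succ_iff.1 D.near).2.2.abs_le m
  have hsplit : chordForm D.h (u + π) (v + π) - chordForm D.h u v =
      (D.h (m + π) - D.h m) * cos (v - m) + (deriv D.h (m + π) - deriv D.h m) * sin (v - m) := by
    rw [chordForm, chordForm, supportAt, supportAt, show (u + π + (v + π)) / 2 = m + π by ring,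
      show v + π - (m + π) = v - m by ring, ← hm]
    ring
  rw [hsplit]
  have hcos : |(D.h (m + π) - D.h m) * cos (v - m)| ≤ 2 * D.ε * 1 := by
    rw [abs_mul]
    exact mul_le_mul hnear (abs_cos_le_one _) (abs_nonneg _) (by linarith [D.ε_nonneg])
  have hsin : |(deriv D.h (m + π) - deriv D.h m) * sin (v - m)| ≤ 2 * D.ε * 1 := by
    rw [abs_mul]
    exact mul_le_mul hnear' (abs_sin_le_one _) (abs_nonneg _) (by linarith [D.ε_nonneg])
  exact (abs_add_le _ _).trans (by linarith)

theorem abs_chordForm_reflected_sub_le (k : ℕ) (ψ : ℝ) :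
    |chordForm D.h (D.Y (k + 2) ψ - π) (D.Y (k + 3) ψ - π) -
      chordForm D.h (D.Y (k + 4) ψ - π) (D.Y (k + 3) ψ - π)| ≤ 8 * D.ε := by
  have hleft := D.abs_chordForm_add_pi_sub_le (D.Y (k + 2) ψ - π) (D.Y (k + 3) ψ - π)
  have hright := D.abs_chordForm_add_pi_sub_le (D.Y (k + 4) ψ - π) (D.Y (k + 3) ψ - π)
  simp only [sub_add_cancel] at hleft hright
  rw [D.chordForm_eq (k + 2) ψ] at hleft
  rw [abs_le] at *
  constructor <;> linarith [hleft.1, hleft.2, hright.1, hright.2]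

/-- The distance in the normal angle of the `k`-th chord between the orbit that starts at `t` and
the reflection in the origin of the orbit that starts at `ψ`, which is shifted by two chords so that
both are lifted to the same branch. -/
noncomputable def gap (t ψ : ℝ) (k : ℕ) : ℝ := D.Y k t - (D.Y (k + 2) ψ - π)

theorem gap_add_four (t ψ : ℝ) (k : ℕ) : D.gap t ψ (k + 4) = D.gap t ψ k := by
  rw [gap, show k + 4 + 2 = k + 2 + 4 by ring, Y_add_four, Y_add_four, gap]
  ring

theorem X_sub_X_add_two (t ψ : ℝ) (k : ℕ) :
    D.X k t - (D.X (k + 2) ψ - π) = (D.gap t ψ (k + 3) + D.gap t ψ (k + 4)) / 2 := by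
  have ht := D.X_succ_eq (k + 3) t
  have hψ := D.X_succ_eq (k + 5) ψ
  rw [show k + 3 + 1 = k + 4 by ring, X_add_four] at ht
  rw [show k + 5 + 1 = k + 2 + 4 by ring, X_add_four] at hψ
  simp only [gap]
  rw [show k + 3 + 2 = k + 5 by ring, show k + 4 + 2 = k + 2 + 4 by ring]
  linarith

theorem exists_gap_eq_zero (ψ : ℝ) : ∃ t j, D.gap t ψ j = 0 ∧ ∀ k, 0 ≤ D.gap t ψ k := by
  choose s hs using fun k => D.surjective_Y k (D.Y (k + 2) ψ - π)
  obtain ⟨j, -, hmax⟩ := Finset.exists_max_image (Finset.range 4) s ⟨0, by simp⟩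
  refine ⟨s j, j, by rw [gap, hs, sub_self], fun k => ?_⟩
  induction k using Nat.strong_induction_on with
  | _ k ih =>
    rcases lt_or_ge k 4 with hk | hk
    · rw [gap, ← hs k, sub_nonneg]
      exact (D.strictMono_Y k).monotone (hmax k (by simpa using hk))
    · obtain ⟨i, rfl⟩ := Nat.exists_eq_add_of_le' hk
      rw [gap_add_four]
      exact ih i (by omega)

-- The reflected orbit almost solves the chord equation at index `k + 1`, and `chordForm` is
-- strictly monotone in its first argument, so nonnegative gaps control their neighbours.
theorem mul_gap_add_gap_le {c t ψ : ℝ} {k : ℕ} (hc : 0 ≤ c)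
    (hδ : ∀ j φ, c ≤ D.δ j φ ∧ D.δ j φ ≤ π - c) (hgap : ∀ j, 0 ≤ D.gap t ψ j)
    (hsmall : D.gap t ψ (k + 1) ≤ c) :
    r * sin (c / 2) / 2 * (D.gap t ψ k + D.gap t ψ (k + 2)) ≤
      8 * D.ε + 4 * B * D.gap t ψ (k + 1) := by
  have hstep : ∀ j φ, 2 * c ≤ D.Y (j + 1) φ - D.Y j φ ∧ D.Y (j + 1) φ - D.Y j φ ≤ 2 * π - 2 * c :=
    fun j φ => by
      have := D.δ_succ_eq j φ
      constructor <;> linarith [(hδ (j + 1) φ).1, (hδ (j + 1) φ).2]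
  have hstep_left := hstep (k + 2) ψ
  have hstep_right := hstep (k + 3) ψ
  have hgap_left := hgap k
  have hgap_mid := hgap (k + 1)
  have hgap_right := hgap (k + 2)
  simp only [gap, add_assoc, Nat.reduceAdd] at *
  have hleft := D.mul_sub_le_chordForm_sub_left (a := c / 2) (u := D.Y (k + 2) ψ - π)
    (u' := D.Y k t) (v := D.Y (k + 1) t) (by linarith) (by linarith)
    (by linarith [(hstep k t).1]) (by linarith)
  have hright := D.mul_sub_le_chordForm_sub_right (a := c / 2) (u := D.Y (k + 4) ψ - π)
    (u' := D.Y (k + 2) t) (v := D.Y (k + 1) t) (by linarith) (by linarith)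
    (by linarith) (by linarith [(hstep (k + 1) t).2])
  have hmove_left := D.abs_chordForm_sub_le (D.Y (k + 2) ψ - π) (D.Y (k + 3) ψ - π) (D.Y (k + 1) t)
  have hmove_right := D.abs_chordForm_sub_le (D.Y (k + 4) ψ - π) (D.Y (k + 3) ψ - π)
    (D.Y (k + 1) t)
  rw [abs_of_nonneg hgap_mid, abs_le] at hmove_left hmove_right
  have hreflected := (abs_le.1 (D.abs_chordForm_reflected_sub_le k ψ)).1
  rw [D.chordForm_eq k t] at hleft
  rw [mul_add]
  linarith [hmove_left.1, hmove_right.2]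

end Reflection

theorem tendsto_ε : Tendsto ε (small r B) (𝓝 0) := tendsto_comap

theorem exists_gap_le (r B : ℝ) : ∃ C, 0 ≤ C ∧ ∀ᶠ D in small r B, ∀ ψ, ∃ t, ∀ k,
    0 ≤ D.gap t ψ k ∧ D.gap t ψ k ≤ C * D.ε := by
  obtain ⟨c, hc, hδ⟩ := exists_angle_bound r B
  set β := r * sin (c / 2) / 2
  set C := 8 / β + (8 + 4 * B * (8 / β)) / β
  have hsmall : ∀ᶠ D in small r B, 8 / β * D.ε < c := by
    have hlim : Tendsto (fun D => 8 / β * D.ε) (small r B) (𝓝 0) := by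
      simpa using tendsto_ε.const_mul (8 / β)
    exact hlim.eventually_lt_const hc
  refine ⟨max 0 C, le_max_left _ _, ?_⟩
  filter_upwards [hsmall] with D hD ψ
  obtain ⟨t, j, hj, hgap⟩ := D.exists_gap_eq_zero ψ
  have hβ : 0 < β := by
    have hr := D.r_pos
    have hsin : 0 < sin (c / 2) :=
      sin_pos_of_pos_of_lt_pi (by linarith) (by linarith [hδ D 0 0])
    positivity
  have hneighbours (k : ℕ) (hk : D.gap t ψ (k + 1) ≤ c) :
      β * (D.gap t ψ k + D.gap t ψ (k + 2)) ≤ 8 * D.ε + 4 * B * D.gap t ψ (k + 1) :=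
    D.mul_gap_add_gap_le hc.le (fun j φ => ⟨(hδ D j φ).1, (hδ D j φ).2.1⟩) hgap hk
  refine ⟨t, fun k => ⟨hgap k, ?_⟩⟩
  calc D.gap t ψ k ≤ 8 * D.ε / β + (8 * D.ε + 4 * B * (8 * D.ε / β)) / β :=
        le_of_periodic_of_neighbours hβ (mul_nonneg (by norm_num) D.B_pos.le)
          (mul_nonneg (by norm_num) D.ε_nonneg) (by linarith [mul_div_right_comm 8 D.ε β])
          (D.gap_add_four t ψ) hgap hj hneighbours k
    _ = C * D.ε := by ring
    _ ≤ max 0 C * D.ε := mul_le_mul_of_nonneg_right (le_max_right _ _) D.ε_nonneg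

theorem exists_orbit_near_reflected (r B : ℝ) : ∃ C, 0 ≤ C ∧ ∀ᶠ D in small r B, ∀ ψ,
    ∃ t ∈ Icc ψ (ψ + C * D.ε), ∀ k, D.gap t ψ k ∈ Icc 0 (C * D.ε) := by
  obtain ⟨C, hC, h⟩ := exists_gap_le r B
  refine ⟨2 * C, by positivity, ?_⟩
  filter_upwards [h] with D hD ψ
  obtain ⟨t, ht⟩ := hD ψ
  have hε : 0 ≤ C * D.ε := mul_nonneg hC D.ε_nonneg
  have hX (k : ℕ) : D.X k t - (D.X (k + 2) ψ - π) ∈ Icc 0 (C * D.ε) := by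
    rw [X_sub_X_add_two]
    constructor <;> linarith [ht (k + 3), ht (k + 4)]
  obtain ⟨hlow₀, hup₀⟩ := hX 0
  obtain ⟨hlow₂, hup₂⟩ := hX 2
  rw [X_zero] at hlow₀ hup₀
  rw [X_add_four D 0, X_zero] at hlow₂ hup₂
  rw [zero_add] at hlow₀ hup₀
  refine ⟨t, ?_, fun k => ⟨(ht k).1, by linarith [(ht k).2]⟩⟩
  rcases le_total ψ t with hle | hle
  · have := (D.strictMono_X 2).monotone hle
    exact ⟨hle, by linarith⟩
  · have := (D.strictMono_X 2).monotone hle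
    constructor <;> linarith

theorem uniformO_Y_add_two_sub_zero (k : ℕ) :
    UniformO (small r B) 0 ε fun D x => Y (k + 2) D x - Y k D x - π := by
  obtain ⟨C, hC, hclose⟩ := exists_orbit_near_reflected r B
  obtain ⟨L, hL, hlip⟩ :=
    (uniformO_Y (B := B) (l := small r B) (n := 1) (by norm_num) k).exists_abs_sub_le
  refine UniformO.zero_of_abs_le (C := (L + 2) * C) (Eventually.of_forall fun D =>
    ((D.continuous_Y _).sub (D.continuous_Y _)).sub continuous_const) (by positivity) ?_
  filter_upwards [hclose, hlip] with D hclose hlip ψ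
  obtain ⟨t, ht, hgap⟩ := hclose ψ
  have hshift : |D.Y k t - t - (D.Y k ψ - ψ)| ≤ L * (C * D.ε) := by
    refine (hlip t ψ).trans ?_
    rw [Pi.one_apply, abs_one, mul_one, abs_of_nonneg (sub_nonneg.2 ht.1)]
    exact mul_le_mul_of_nonneg_left (by linarith [ht.2]) hL
  have hgap_eq : D.gap t ψ k = D.Y k t - (D.Y (k + 2) ψ - π) := rfl
  rw [abs_of_nonneg D.ε_nonneg]
  rw [abs_le] at hshift ⊢
  constructor <;> linarith [ht.1, ht.2, (hgap k).1, (hgap k).2, hshift.1, hshift.2]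

end BilliardDatum

/-! ### Almost symmetry -/

namespace BilliardDatum

variable {r B : ℝ} {n : ℕ}

theorem uniformO_h_add_pi_sub : UniformO (small r B) 5 ε fun D x => D.h (x + π) - D.h x := by
  refine ⟨2, by norm_num, Eventually.of_forall fun D => ?_⟩
  rw [abs_of_nonneg D.ε_nonneg]
  exact D.near

theorem uniformO_deriv_h_add_pi_sub :
    UniformO (small r B) 4 ε fun D x => deriv D.h (x + π) - deriv D.h x :=
  uniformO_h_add_pi_sub.deriv.congr fun D x => D.deriv_h_add_pi_sub x

theorem uniformO_deriv_deriv_h_add_pi_sub :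
    UniformO (small r B) 3 ε fun D x => deriv (deriv D.h) (x + π) - deriv (deriv D.h) x :=
  uniformO_deriv_h_add_pi_sub.deriv.congr fun D x =>
    ((HasDerivAt.comp_add_const x π (D.smooth.hasDerivAt_deriv (x + π))).sub
      (D.smooth.hasDerivAt_deriv x)).deriv

theorem uniformO_comp_X_sub_comp_X {j k : ℕ} (hn : n ≤ 5) {G : BilliardDatum r B → ℝ → ℝ}
    (hG : UniformO (small r B) (n + 1) 1 G)
    (hGπ : UniformO (small r B) n ε fun D x => G D (x + π) - G D x)
    (hX : UniformO (small r B) n ε fun D x => X k D x - X j D x - π) :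
    UniformO (small r B) n ε fun D x => G D (D.X k x) - G D (D.X j x) := by
  have hXj := uniformO_X (r := r) (B := B) (l := small r B) hn j
  have hXjπ : UniformO (small r B) n 1 fun D x => X j D x + π - x :=
    (hXj.add (UniformO.bdd_const π)).congr fun D x => by ring
  exact ((hG.comp_sub_comp (uniformO_X hn k) hXjπ (hX.congr fun D x => by ring)).add
    (hGπ.comp hXj)).congr fun D x => by ring

section Symmetry

variable (hY : ∀ k, UniformO (small r B) n ε fun D x => Y (k + 2) D x - Y k D x - π)
include hY

theorem uniformO_X_add_two_sub_of_uniformO_Y (k : ℕ) :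
    UniformO (small r B) n ε fun D x => X (k + 2) D x - X k D x - π :=
  (((hY (k + 3)).add (hY (k + 4))).const_mul (1 / 2)).congr fun D x => by
    have hX := D.X_succ_eq (k + 3) x
    have hX₂ := D.X_succ_eq (k + 5) x
    rw [show k + 3 + 1 = k + 4 by ring, X_add_four] at hX
    rw [show k + 5 + 1 = k + 2 + 4 by ring, X_add_four] at hX₂
    rw [show k + 3 + 2 = k + 5 by ring, show k + 4 + 2 = k + 2 + 4 by ring]
    linarith

theorem uniformO_δ_add_two_sub_of_uniformO_Y (k : ℕ) :
    UniformO (small r B) n ε fun D x => δ (k + 2) D x - δ k D x :=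
  ((hY k).sub (uniformO_X_add_two_sub_of_uniformO_Y hY k)).congr fun D x => by
    rw [Y, Y]
    ring

theorem uniformO_sin_δ_add_two_sub (hn : n ≤ 5) (k : ℕ) :
    UniformO (small r B) n ε fun D x => sin (δ (k + 2) D x) - sin (δ k D x) :=
  UniformO.bdd_sin.comp_bdd_sub_comp_bdd (uniformO_δ hn _) (uniformO_δ hn _)
    (uniformO_δ_add_two_sub_of_uniformO_Y hY k)

theorem uniformO_cos_δ_add_two_sub (hn : n ≤ 5) (k : ℕ) :
    UniformO (small r B) n ε fun D x => cos (δ (k + 2) D x) - cos (δ k D x) :=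
  UniformO.bdd_cos.comp_bdd_sub_comp_bdd (uniformO_δ hn _) (uniformO_δ hn _)
    (uniformO_δ_add_two_sub_of_uniformO_Y hY k)

theorem uniformO_comp_X_mul_sin_δ_add_two_sub (hn : n ≤ 5) {G : BilliardDatum r B → ℝ → ℝ}
    (hG : UniformO (small r B) (n + 1) 1 G)
    (hGπ : UniformO (small r B) n ε fun D x => G D (x + π) - G D x) (k : ℕ) :
    UniformO (small r B) n ε fun D x =>
      G D (D.X (k + 2) x) * sin (D.δ (k + 2) x) - G D (D.X k x) * sin (D.δ k x) :=
  ((hG.of_le n.le_succ).comp (uniformO_X hn _)).mul_sub_mul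
    (UniformO.bdd_sin.comp_bdd (uniformO_δ hn _))
    (uniformO_comp_X_sub_comp_X hn hG hGπ (uniformO_X_add_two_sub_of_uniformO_Y hY k))
    (uniformO_sin_δ_add_two_sub hY hn k)

theorem uniformO_comp_X_mul_cos_δ_add_two_sub (hn : n ≤ 5) {G : BilliardDatum r B → ℝ → ℝ}
    (hG : UniformO (small r B) (n + 1) 1 G)
    (hGπ : UniformO (small r B) n ε fun D x => G D (x + π) - G D x) (k : ℕ) :
    UniformO (small r B) n ε fun D x =>
      G D (D.X (k + 2) x) * cos (D.δ (k + 2) x) - G D (D.X k x) * cos (D.δ k x) :=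
  ((hG.of_le n.le_succ).comp (uniformO_X hn _)).mul_sub_mul
    (UniformO.bdd_cos.comp_bdd (uniformO_δ hn _))
    (uniformO_comp_X_sub_comp_X hn hG hGπ (uniformO_X_add_two_sub_of_uniformO_Y hY k))
    (uniformO_cos_δ_add_two_sub hY hn k)

theorem uniformO_b_add_two_sub (hn : n ≤ 3) (k : ℕ) :
    UniformO (small r B) n ε fun D x => D.b (k + 2) x - D.b k x := by
  have hh := uniformO_comp_X_mul_sin_δ_add_two_sub hY (by omega) (uniformO_h (by omega))
    (uniformO_h_add_pi_sub.of_le (by omega)) k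
  have hh₂ := uniformO_comp_X_mul_sin_δ_add_two_sub hY (by omega)
    (uniformO_deriv_deriv_h (by omega)) (uniformO_deriv_deriv_h_add_pi_sub.of_le hn) k
  refine ((hh.add hh₂).const_mul (1 / 2)).congr fun D x => ?_
  rw [b, b]
  ring

theorem uniformO_A_add_two_sub (hn : n ≤ 3) (k : ℕ) :
    UniformO (small r B) n ε fun D x => D.A (k + 2) x - D.A k x := by
  have hh := uniformO_comp_X_mul_sin_δ_add_two_sub hY (by omega) (uniformO_h (by omega))
    (uniformO_h_add_pi_sub.of_le (by omega))
  have hh₁ := uniformO_comp_X_mul_cos_δ_add_two_sub hY (by omega) (uniformO_deriv_h (by omega))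
    (uniformO_deriv_h_add_pi_sub.of_le (by omega))
  have hh₂ := uniformO_comp_X_mul_sin_δ_add_two_sub hY (by omega)
    (uniformO_deriv_deriv_h (by omega)) (uniformO_deriv_deriv_h_add_pi_sub.of_le hn)
  refine ((((((hh (k + 1)).sub (hh₂ (k + 1))).const_mul (1 / 2)).add (hh₁ (k + 1))).add
    (((hh k).sub (hh₂ k)).const_mul (1 / 2))).sub (hh₁ k)).congr fun D x => ?_
  rw [A, A, show k + 2 + 1 = k + 1 + 2 by ring]
  ring

/-- The orbit equations two bounces later are those with `U k` and `U (k + 2)` exchanged, up to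
the error in the coefficients. -/
theorem uniformO_linear_exchanged (hn : n ≤ 3) (k : ℕ) : UniformO (small r B) n ε fun D x =>
    D.A (k + 1) x * D.U (k + 3) x - (D.b (k + 1) x * D.U (k + 2) x + D.b (k + 2) x * D.U k x) := by
  have hU := fun k => uniformO_U (r := r) (B := B) (l := small r B) (hn.trans (by norm_num)) k
  refine ((((uniformO_b_add_two_sub hY hn (k + 1)).mul_bdd (hU (k + 2))).add
    ((uniformO_b_add_two_sub hY hn (k + 2)).mul_bdd (hU k))).sub
    ((uniformO_A_add_two_sub hY hn (k + 1)).mul_bdd (hU (k + 3)))).congr fun D x => ?_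
  have hlin := D.linear_eq (k + 2) x
  simp only [add_assoc, Nat.reduceAdd, U_add_four] at hlin ⊢
  linear_combination hlin

theorem uniformO_linear_sum (hn : n ≤ 3) (k : ℕ) : UniformO (small r B) n ε fun D x =>
    D.A (k + 1) x * (D.U (k + 1) x + D.U (k + 3) x) -
      (D.b (k + 1) x + D.b (k + 2) x) * (D.U k x + D.U (k + 2) x) :=
  (uniformO_linear_exchanged hY hn k).congr fun D x => by
    linear_combination D.linear_eq k x

theorem uniformO_linear_sub (hn : n ≤ 3) (k : ℕ) : UniformO (small r B) n ε fun D x =>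
    D.A (k + 1) x * (D.U (k + 3) x - D.U (k + 1) x) -
      (D.b (k + 1) x - D.b (k + 2) x) * (D.U (k + 2) x - D.U k x) :=
  (uniformO_linear_exchanged hY hn k).congr fun D x => by
    linear_combination -D.linear_eq k x

/-- The sums `U k + U (k + 2)` almost solve a homogeneous `2 × 2` system and are bounded below, so
its determinant almost vanishes. -/
theorem uniformO_A_mul_A_sub_sq (hn : n ≤ 3) : UniformO (small r B) n ε fun D x =>
    D.A 1 x * D.A 2 x - (D.b 1 x + D.b 2 x) ^ 2 := by
  have hY₁ := fun k => uniformO_Y (r := r) (B := B) (l := small r B) (n := n) (by omega) k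
  have hU := fun k => uniformO_U (r := r) (B := B) (l := small r B) (n := n) (by omega) k
  have hb := fun k => uniformO_b_succ (k := k) hY₁ (by omega)
  have hA₁ := uniformO_A_succ (k := 0) hY₁ (by omega)
  have hpos : UniformPos (small r B) fun D x => D.U 0 x + D.U 2 x :=
    uniformPos_U_zero.mono (Eventually.of_forall fun D x => by linarith [D.U_nonneg 2 x])
  refine ((((hA₁.bdd_mul (uniformO_linear_sum hY hn 1)).add
    (((hb 0).add (hb 1)).bdd_mul (uniformO_linear_sum hY hn 0))).add
    ((uniformO_b_add_two_sub hY hn 1).mul_bdd (hA₁.mul_bdd ((hU 1).add (hU 3))))).congr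
    fun D x => ?_).of_mul_left ((hU 0).add (hU 2)) hpos
  have hU₄ := D.U_add_four 0 x
  norm_num only at hU₄ ⊢
  rw [hU₄]
  ring

/-- The differences `U (k + 2) - U k` almost solve the system with `b 2` replaced by `-b 2`, whose
determinant is larger by `4 * b 1 * b 2`. -/
theorem uniformO_U_two_sub_U_zero (hn : n ≤ 3) :
    UniformO (small r B) n ε fun D x => D.U 2 x - D.U 0 x := by
  have hY₁ := fun k => uniformO_Y (r := r) (B := B) (l := small r B) (n := n) (by omega) k
  have hU := fun k => uniformO_U (r := r) (B := B) (l := small r B) (n := n) (by omega) k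
  have hb := fun k => uniformO_b_succ (k := k) hY₁ (by omega)
  have hA₁ := uniformO_A_succ (k := 0) hY₁ (by omega)
  refine ((((((((hb 0).sub (hb 1)).bdd_mul (uniformO_linear_sub hY hn 0)).sub
    (hA₁.bdd_mul (uniformO_linear_sub hY hn 1))).add
    ((uniformO_b_add_two_sub hY hn 1).mul_bdd (hA₁.mul_bdd ((hU 3).sub (hU 1))))).sub
    ((uniformO_A_mul_A_sub_sq hY hn).mul_bdd ((hU 2).sub (hU 0)))).const_mul (1 / 4)).congr
    fun D x => ?_).of_mul_left ((hb 0).mul_bdd (hb 1)) ((uniformPos_b 1).mul (uniformPos_b 2))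
  have hU₄ := D.U_add_four 0 x
  norm_num only at hU₄ ⊢
  rw [hU₄]
  ring

theorem uniformO_U_three_sub_U_one (hn : n ≤ 3) :
    UniformO (small r B) n ε fun D x => D.U 3 x - D.U 1 x := by
  have hY₁ := fun k => uniformO_Y (r := r) (B := B) (l := small r B) (n := n) (by omega) k
  have hb := fun k => uniformO_b_succ (k := k) hY₁ (by omega)
  exact (((uniformO_linear_sub hY hn 0).add
    (((hb 0).sub (hb 1)).bdd_mul (uniformO_U_two_sub_U_zero hY hn))).congr fun D x => by
      norm_num only
      ring).of_mul_left (uniformO_A_succ hY₁ (by omega)) uniformPos_A_one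

theorem uniformO_U_add_two_sub (hn : n ≤ 3) (k : ℕ) :
    UniformO (small r B) n ε fun D x => D.U (k + 2) x - D.U k x := by
  induction k using Nat.twoStepInduction with
  | zero => exact uniformO_U_two_sub_U_zero hY hn
  | one => exact uniformO_U_three_sub_U_one hY hn
  | more k ih _ =>
    refine ih.neg.congr fun D x => ?_
    rw [show k + 2 + 2 = k + 4 by ring, U_add_four]
    ring

theorem uniformO_Y_add_two_sub_succ (hn : n ≤ 3) (k : ℕ) :
    UniformO (small r B) (n + 1) ε fun D x => Y (k + 2) D x - Y k D x - π :=
  UniformO.succ_of_hasDerivAt ((hY k).of_le n.zero_le) (Eventually.of_forall fun D x =>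
    ((D.hasDerivAt_Y (k + 2) x).sub (D.hasDerivAt_Y k x)).sub_const π)
    (uniformO_U_add_two_sub hY hn k)

end Symmetry

theorem uniformO_Y_add_two_sub (hn : n ≤ 4) (k : ℕ) :
    UniformO (small r B) n ε fun D x => Y (k + 2) D x - Y k D x - π := by
  induction n generalizing k with
  | zero => exact uniformO_Y_add_two_sub_zero k
  | succ n ih => exact uniformO_Y_add_two_sub_succ (ih (by omega)) (by omega) k

theorem uniformO_X_add_two_sub (hn : n ≤ 4) (k : ℕ) :
    UniformO (small r B) n ε fun D x => X (k + 2) D x - X k D x - π :=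
  uniformO_X_add_two_sub_of_uniformO_Y (uniformO_Y_add_two_sub hn) k

theorem uniformO_δ_add_two_sub (hn : n ≤ 4) (k : ℕ) :
    UniformO (small r B) n ε fun D x => δ (k + 2) D x - δ k D x :=
  uniformO_δ_add_two_sub_of_uniformO_Y (uniformO_Y_add_two_sub hn) k

theorem uniformO_X_one_sub (hn : n ≤ 4) :
    UniformO (small r B) n ε fun D x => X 1 D x - (x + π / 2) :=
  (((uniformO_δ_add_two_sub hn 0).add (uniformO_δ_add_two_sub hn 1)).const_mul (-1 / 2)).congr
    fun D x => by
      have hX := D.X_succ 0 x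
      have hδ := D.sum_δ x
      rw [Y, X_zero] at hX
      norm_num only at hX ⊢
      linarith

theorem uniformO_δ_one_sub (hn : n ≤ 4) :
    UniformO (small r B) n ε fun D x => δ 1 D x - (π / 2 - D.d x) :=
  (uniformO_X_one_sub hn).congr fun D x => by
    have hX := D.X_succ 0 x
    rw [Y, X_zero] at hX
    change D.X 1 x = x + D.d x + D.δ 1 x at hX
    linarith

theorem uniformO_add_const_sub (a : ℝ) :
    UniformO (small r B) n 1 fun (_ : BilliardDatum r B) x => x + a - x :=
  (UniformO.bdd_const a).congr fun _ x => by ring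

theorem uniformO_comp_X_one_sub (hn : n ≤ 4) {G : BilliardDatum r B → ℝ → ℝ}
    (hG : UniformO (small r B) (n + 1) 1 G) :
    UniformO (small r B) n ε fun D x => G D (D.X 1 x) - G D (x + π / 2) :=
  hG.comp_sub_comp (uniformO_X (by omega) 1) (uniformO_add_const_sub _) (uniformO_X_one_sub hn)

theorem uniformO_d_add_pi_sub (hn : n ≤ 4) :
    UniformO (small r B) n ε fun D x => D.d (x + π) - D.d x :=
  ((uniformO_δ_add_two_sub hn 0).sub ((uniformO_d (by omega)).comp_sub_comp
    (uniformO_X (by omega) 2) (uniformO_add_const_sub π)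
    ((uniformO_X_add_two_sub hn 0).congr fun D x => by rw [X_zero]; ring))).congr fun D x => by
      simp only [δ, X_zero]
      ring

theorem uniformO_d_add_pi_div_two_sub (hn : n ≤ 4) :
    UniformO (small r B) n ε fun D x => D.d (x + π / 2) - (π / 2 - D.d x) :=
  ((uniformO_δ_one_sub hn).sub (uniformO_comp_X_one_sub hn (uniformO_d (by omega)))).congr
    fun D x => by
      simp only [δ]
      ring

theorem uniformO_cos_δ_one_sub (hn : n ≤ 4) :
    UniformO (small r B) n ε fun D x => cos (D.δ 1 x) - sin (D.d x) :=
  (UniformO.bdd_cos.comp_bdd_sub_comp_bdd (uniformO_δ (by omega) 1)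
    ((UniformO.bdd_const (π / 2)).sub (uniformO_d (by omega)))
    (uniformO_δ_one_sub hn)).congr fun D x => by rw [cos_pi_div_two_sub]

theorem uniformO_sin_δ_one_sub (hn : n ≤ 4) :
    UniformO (small r B) n ε fun D x => sin (D.δ 1 x) - cos (D.d x) :=
  (UniformO.bdd_sin.comp_bdd_sub_comp_bdd (uniformO_δ (by omega) 1)
    ((UniformO.bdd_const (π / 2)).sub (uniformO_d (by omega)))
    (uniformO_δ_one_sub hn)).congr fun D x => by rw [sin_pi_div_two_sub]

theorem uniformPos_cos_d : UniformPos (small r B) fun D x => cos (D.d x) :=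
  (uniformPos_sin_δ 1).of_sub tendsto_ε (uniformO_sin_δ_one_sub (Nat.zero_le 4))

theorem uniformO_sin_d (hn : n ≤ 5) : UniformO (small r B) n 1 fun D x => sin (D.d x) :=
  UniformO.bdd_sin.comp_bdd (uniformO_d hn)

theorem uniformO_cos_d (hn : n ≤ 5) : UniformO (small r B) n 1 fun D x => cos (D.d x) :=
  UniformO.bdd_cos.comp_bdd (uniformO_d hn)

theorem uniformO_h_add_pi_div_two (hn : n ≤ 6) :
    UniformO (small r B) n 1 fun D x => D.h (x + π / 2) :=
  (uniformO_h hn).comp (uniformO_add_const_sub (π / 2))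

theorem h_mul_cos_add_deriv_h_mul_sin (D : BilliardDatum r B) (k : ℕ) (x : ℝ) :
    D.h (D.X k x) * cos (D.δ k x) + deriv D.h (D.X k x) * sin (D.δ k x) =
      D.h (D.X (k + 1) x) * cos (D.δ (k + 1) x) -
        deriv D.h (D.X (k + 1) x) * sin (D.δ (k + 1) x) := by
  have hchord := (D.isChord k x).eq
  rw [supportAt, supportAt, show D.Y k x - D.X k x = D.δ k x by rw [Y]; ring,
    show D.Y k x - D.X (k + 1) x = -D.δ (k + 1) x by rw [X_succ]; ring, cos_neg, sin_neg] at hchord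
  linarith

theorem uniformO_h_X_one_mul_cos_sub (hn : n ≤ 4) : UniformO (small r B) n ε fun D x =>
    D.h (D.X 1 x) * cos (D.δ 1 x) - D.h (x + π / 2) * sin (D.d x) :=
  ((uniformO_h (by omega)).comp (uniformO_X (by omega) 1)).mul_sub_mul (uniformO_sin_d (by omega))
    (uniformO_comp_X_one_sub hn (uniformO_h (by omega))) (uniformO_cos_δ_one_sub hn)

theorem uniformO_deriv_h_X_one_mul_sin_sub (hn : n ≤ 4) : UniformO (small r B) n ε fun D x =>
    deriv D.h (D.X 1 x) * sin (D.δ 1 x) - deriv D.h (x + π / 2) * cos (D.d x) :=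
  ((uniformO_deriv_h (by omega)).comp (uniformO_X (by omega) 1)).mul_sub_mul
    (uniformO_cos_d (by omega))
    (uniformO_comp_X_one_sub hn (uniformO_deriv_h (by omega))) (uniformO_sin_δ_one_sub hn)

theorem uniformO_h_sub_deriv_h_X_two (hn : n ≤ 4) : UniformO (small r B) n ε fun D x =>
    D.h (D.X 2 x) * cos (D.δ 2 x) - deriv D.h (D.X 2 x) * sin (D.δ 2 x) -
      (D.h x * cos (D.d x) - deriv D.h x * sin (D.d x)) :=
  ((uniformO_comp_X_mul_cos_δ_add_two_sub (uniformO_Y_add_two_sub hn) (by omega)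
    (uniformO_h (by omega)) (uniformO_h_add_pi_sub.of_le (by omega)) 0).sub
  (uniformO_comp_X_mul_sin_δ_add_two_sub (uniformO_Y_add_two_sub hn) (by omega)
    (uniformO_deriv_h (by omega)) (uniformO_deriv_h_add_pi_sub.of_le hn) 0)).congr fun D x => by
      simp only [zero_add, X_zero, show D.δ 0 x = D.d x from rfl]
      ring

theorem uniformO_h_mul_cos_sub (hn : n ≤ 4) : UniformO (small r B) n ε fun D x =>
    D.h x * cos (D.d x) - D.h (x + π / 2) * sin (D.d x) :=
  ((uniformO_h_X_one_mul_cos_sub hn).sub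
    ((uniformO_h_sub_deriv_h_X_two hn).const_mul (1 / 2))).congr fun D x => by
      have hchord := D.h_mul_cos_add_deriv_h_mul_sin 0 x
      simp only [zero_add, X_zero, show D.δ 0 x = D.d x from rfl] at hchord
      linear_combination (1 / 2) * D.h_mul_cos_add_deriv_h_mul_sin 1 x - (1 / 2) * hchord

theorem uniformO_deriv_h_mul_sin_add (hn : n ≤ 4) : UniformO (small r B) n ε fun D x =>
    deriv D.h x * sin (D.d x) + deriv D.h (x + π / 2) * cos (D.d x) :=
  (((uniformO_h_sub_deriv_h_X_two hn).const_mul (1 / 2)).sub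
    (uniformO_deriv_h_X_one_mul_sin_sub hn)).congr fun D x => by
      have hchord := D.h_mul_cos_add_deriv_h_mul_sin 0 x
      simp only [zero_add, X_zero, show D.δ 0 x = D.d x from rfl] at hchord
      linear_combination -(1 / 2) * D.h_mul_cos_add_deriv_h_mul_sin 1 x - (1 / 2) * hchord

theorem uniformO_h_mul_deriv_h_add (hn : n ≤ 4) : UniformO (small r B) n ε fun D x =>
    D.h x * deriv D.h x + D.h (x + π / 2) * deriv D.h (x + π / 2) :=
  ((((uniformO_deriv_h_mul_sin_add hn).mul_bdd (uniformO_h_add_pi_div_two (by omega))).add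
    ((uniformO_h_mul_cos_sub hn).mul_bdd (uniformO_deriv_h (by omega)))).congr fun D x => by
      ring).of_mul_left (uniformO_cos_d (by omega)) uniformPos_cos_d

theorem hasDerivAt_h_sq_add (D : BilliardDatum r B) (x : ℝ) :
    HasDerivAt (fun x => D.h x ^ 2 + D.h (x + π / 2) ^ 2 - D.R ^ 2)
      (2 * (D.h x * deriv D.h x + D.h (x + π / 2) * deriv D.h (x + π / 2))) x := by
  refine ((((D.smooth.hasDerivAt x).pow 2).add
    (((D.smooth.hasDerivAt (x + π / 2)).comp_add_const x (π / 2)).pow 2)).sub_const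
    _).congr_deriv ?_
  norm_num
  ring

theorem uniformO_h_sq_add_sub (hn : n ≤ 5) :
    UniformO (small r B) n ε fun D x => D.h x ^ 2 + D.h (x + π / 2) ^ 2 - D.R ^ 2 := by
  refine (UniformO.succ_of_hasDerivAt_of_periodic (C := 6 * |B|) two_pi_pos
    (Eventually.of_forall fun D x => ?_) (by positivity) (Eventually.of_forall fun D => ?_)
    (Eventually.of_forall fun D x => D.hasDerivAt_h_sq_add x)
    ((uniformO_h_mul_deriv_h_add le_rfl).const_mul 2)).of_le hn
  · simp only [show x + 2 * π + π / 2 = x + π / 2 + 2 * π by ring, D.smooth.periodic _]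
  · rw [abs_of_pos D.B_pos, abs_of_nonneg D.ε_nonneg, zero_add]
    exact D.R_sq

theorem uniformPos_h : UniformPos (small r B) fun D => D.h := by
  obtain hr | hr := le_or_gt r 0
  · exact ⟨1, one_pos, Eventually.of_forall fun D => absurd D.r_pos hr.not_gt⟩
  have hmean : UniformPos (small r B) fun D x => (1 / 2) * (D.h x + D.h (x + π)) := by
    refine ⟨r, hr, Eventually.of_forall fun D x => ?_⟩
    have := D.mul_one_sub_cos_le (φ := x + π) (x := x)
      ⟨by linarith, by linarith [pi_pos]⟩
    rw [supportAt_add_pi, supportAt_self, add_sub_cancel_left, cos_pi] at this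
    linarith
  exact hmean.of_sub tendsto_ε ((uniformO_h_add_pi_sub.const_mul (1 / 2)).congr fun D x => by ring)

theorem uniformPos_h_add_pi_div_two : UniformPos (small r B) fun D x => D.h (x + π / 2) :=
  uniformPos_h.comp fun _ x => x + π / 2

theorem uniformPos_R : UniformPos (small r B) fun D _ => D.R := by
  have hsum : UniformPos (small r B) fun D x =>
      D.h x * D.h x + D.h (x + π / 2) * D.h (x + π / 2) :=
    (uniformPos_h.mul uniformPos_h).add
      (uniformPos_h_add_pi_div_two.mul uniformPos_h_add_pi_div_two)
  obtain ⟨c, hc, hR⟩ := hsum.of_sub (G := fun D _ => D.R ^ 2) tendsto_ε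
    ((uniformO_h_sq_add_sub (Nat.zero_le 5)).congr fun D x => by ring)
  exact ⟨√c, sqrt_pos.2 hc, hR.mono fun D hD x => sqrt_le_iff.2 ⟨D.R_nonneg, hD x⟩⟩

theorem uniformO_R : UniformO (small r B) n 1 fun D _ => D.R := by
  refine UniformO.const (C := 2 * |B| + 2) (by positivity) ?_
  obtain ⟨C, -, hsum⟩ := (uniformO_h_sq_add_sub (r := r) (B := B) (Nat.zero_le 5)).exists_abs_le
  have hlim : Tendsto (fun D : BilliardDatum r B => C * |D.ε|) (small r B) (𝓝 0) := by
    simpa using tendsto_ε.abs.const_mul C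
  filter_upwards [hsum, hlim.eventually_lt_const one_pos] with D hsum hlt
  have hR := (abs_le.1 ((hsum 0).trans hlt.le)).1
  have hB := D.B_pos
  have hh₀ := sq_le_sq' (abs_le.1 (D.bound.abs_le 0)).1 (abs_le.1 (D.bound.abs_le 0)).2
  have hh₁ := sq_le_sq' (abs_le.1 (D.bound.abs_le (0 + π / 2))).1
    (abs_le.1 (D.bound.abs_le (0 + π / 2))).2
  rw [abs_of_nonneg D.R_nonneg, abs_of_pos hB, Pi.one_apply, abs_one, mul_one]
  exact abs_le_of_sq_le_sq' (by nlinarith) (by positivity) |>.2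

theorem uniformO_h_sub (hn : n ≤ 4) :
    UniformO (small r B) n ε fun D x => D.h x - D.R * sin (D.d x) := by
  have hsin := uniformO_sin_d (r := r) (B := B) (n := n) (by omega)
  have hh := uniformO_h (r := r) (B := B) (l := small r B) (n := n) (by omega)
  exact ((((uniformO_h_mul_cos_sub hn).mul_bdd ((hh.mul_bdd (uniformO_cos_d (by omega))).add
    ((uniformO_h_add_pi_div_two (by omega)).mul_bdd hsin))).add
    ((uniformO_h_sq_add_sub (by omega)).mul_bdd (hsin.mul_bdd hsin))).congr fun D x => by
      linear_combination D.h x ^ 2 * sin_sq_add_cos_sq (D.d x)).of_mul_left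
    (hh.add (uniformO_R.mul_bdd hsin)) (uniformPos_h.add (uniformPos_R.mul (uniformPos_sin_δ 0)))

theorem uniformO_h_add_pi_div_two_sub (hn : n ≤ 4) :
    UniformO (small r B) n ε fun D x => D.h (x + π / 2) - D.R * cos (D.d x) := by
  have hcos := uniformO_cos_d (r := r) (B := B) (n := n) (by omega)
  have hh := uniformO_h_add_pi_div_two (r := r) (B := B) (n := n) (by omega)
  exact ((((uniformO_h_sq_add_sub (by omega)).mul_bdd (hcos.mul_bdd hcos)).sub
    ((uniformO_h_mul_cos_sub hn).mul_bdd (((uniformO_h (by omega)).mul_bdd hcos).add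
      (hh.mul_bdd (uniformO_sin_d (by omega)))))).congr fun D x => by
      linear_combination D.h (x + π / 2) ^ 2 * sin_sq_add_cos_sq (D.d x)).of_mul_left
    (hh.add (uniformO_R.mul_bdd hcos))
    (uniformPos_h_add_pi_div_two.add (uniformPos_R.mul uniformPos_cos_d))

theorem hasDerivAt_d (D : BilliardDatum r B) (x : ℝ) : HasDerivAt D.d (D.U 0 x - 1) x := by
  have := (D.hasDerivAt_Y 0 x).sub (hasDerivAt_id x)
  rwa [show D.Y 0 - id = D.d from funext fun x => by simp [Y, δ]] at this

/-- The support function of the first chord is `h cos d + h' sin d`; inserting `h ≈ R sin d` turns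
it into `R sin d cos d (1 + d')`. -/
theorem uniformPos_supportAt_Y_zero :
    UniformPos (small r B) fun D x => supportAt D.h x (D.Y 0 x) := by
  have hpos : UniformPos (small r B) fun D x =>
      D.R * (sin (D.d x) * (cos (D.d x) * D.U 0 x)) :=
    uniformPos_R.mul ((uniformPos_sin_δ 0).mul (uniformPos_cos_d.mul uniformPos_U_zero))
  have hh := uniformO_h_sub (r := r) (B := B) (show 1 ≤ 4 by norm_num)
  refine hpos.of_sub tendsto_ε ((((hh.of_le zero_le_one).mul_bdd
    (uniformO_cos_d (Nat.zero_le _))).add (hh.deriv.mul_bdd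
    (uniformO_sin_d (Nat.zero_le _)))).neg.congr fun D x => ?_)
  rw [((D.smooth.hasDerivAt x).fun_sub (((D.hasDerivAt_d x).sin).const_mul D.R)).deriv, supportAt,
    show D.Y 0 x - x = D.d x by simp [Y, δ]]
  ring

end BilliardDatum

/-! ### Parallelograms and rectangles -/

/-- The point with outer normal angle `x` of the convex curve with support function `h`, so that
`bdryPoint Ω` is `curvePoint (supportFn Ω)`; it expresses vertices of orbits without a table. -/
noncomputable def curvePoint (h : ℝ → ℝ) (x : ℝ) : Plane :=
  !₂[h x * cos x - deriv h x * sin x, h x * sin x + deriv h x * cos x]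

/-- The intersection point of the lines with normal angles `a`, `b` and support numbers `p`, `q`,
for the vertices of circumscribed quadrilaterals; it is a junk value if the lines are parallel. -/
noncomputable def lineMeet (a b p q : ℝ) : Plane :=
  !₂[(p * sin b - q * sin a) / sin (b - a), (q * cos a - p * cos b) / sin (b - a)]

/-- The parallelogram with center `0` and consecutive vertices `v`, `w`, the model for the vertices
of an orbit. -/
def centralParallelogram (v w : Plane) : Fin 4 → Plane := ![v, w, -v, -w]

/-- The rectangle with center `0` and half side lengths `p`, `q` whose sides have the normal angles
`x` and `x + π / 2`, the model for the tangent lines at the vertices of an orbit. -/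
noncomputable def centralRectangle (p q x : ℝ) : Fin 4 → Plane :=
  centralParallelogram !₂[p * cos x - q * sin x, q * cos x + p * sin x]
    !₂[-(q * sin x) - p * cos x, q * cos x - p * sin x]

theorem mem_tangentLine_iff {Ω : Set Plane} {a : ℝ} {v : Plane} :
    v ∈ tangentLine Ω a ↔ normalForm v a = supportFn Ω a := by
  rw [← supportAt_self (supportFn Ω) a, ← normalForm_bdryPoint, ← sub_eq_zero, ← normalForm_sub]
  constructor
  · rintro ⟨s, rfl⟩
    rw [add_sub_cancel_left, normalForm_smul_unitTangent, sub_self, sin_zero, mul_zero]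
  · intro h
    obtain ⟨s, hs⟩ := exists_smul_unitTangent h
    exact ⟨s, by rw [← hs, add_sub_cancel]⟩

theorem normalForm_eq_and_normalForm_eq_iff {a b p q : ℝ} {v : Plane} (h : sin (b - a) ≠ 0) :
    normalForm v a = p ∧ normalForm v b = q ↔ v = lineMeet a b p q := by
  have hsin := sin_sub b a
  constructor
  · rintro ⟨rfl, rfl⟩
    ext i
    fin_cases i
    all_goals
      simp only [lineMeet, normalForm, Fin.zero_eta, Fin.mk_one, Matrix.cons_val_zero,
        Matrix.cons_val_one, Matrix.cons_val_fin_one]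
      rw [eq_div_iff h, hsin]
      ring
  · rintro rfl
    simp only [normalForm, lineMeet, Matrix.cons_val_zero, Matrix.cons_val_one,
      Matrix.cons_val_fin_one]
    constructor
    all_goals
      rw [div_mul_eq_mul_div, div_mul_eq_mul_div, ← add_div, div_eq_iff h, hsin]
      ring

theorem tangentLine_inter_tangentLine {Ω : Set Plane} {a b : ℝ} (h : sin (b - a) ≠ 0) :
    tangentLine Ω a ∩ tangentLine Ω b = {lineMeet a b (supportFn Ω a) (supportFn Ω b)} := by
  ext v
  rw [mem_inter_iff, mem_tangentLine_iff, mem_tangentLine_iff,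
    normalForm_eq_and_normalForm_eq_iff h, mem_singleton_iff]

theorem isParallelogram_centralParallelogram {v w : Plane} (h : v 0 * w 1 - v 1 * w 0 ≠ 0) :
    IsParallelogram (centralParallelogram v w) := by
  refine ⟨by simp [centralParallelogram], ?_⟩
  rw [affineIndependent_iff_not_collinear_set]
  intro hcol
  obtain ⟨u, hu⟩ := (collinear_iff_of_mem (p₀ := v) (by simp [centralParallelogram])).1 hcol
  obtain ⟨s, hw⟩ := hu w (by simp [centralParallelogram])
  obtain ⟨t, hv⟩ := hu (-v) (by simp [centralParallelogram])
  have hw_coord (i : Fin 2) : w i = s * u i + v i := by rw [hw]; simp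
  have hv_coord (i : Fin 2) : -v i = t * u i + v i := by
    simpa using congrArg (fun p : Plane => p i) hv
  apply h
  linear_combination v 0 * hw_coord 1 - v 1 * hw_coord 0 - s * u 1 / 2 * hv_coord 0 +
    s * u 0 / 2 * hv_coord 1

theorem isRectangle_centralRectangle {p q : ℝ} (hp : 0 < p) (hq : 0 < q) (x : ℝ) :
    IsRectangle (centralRectangle p q x) := by
  have hcross : (p * cos x - q * sin x) * (q * cos x - p * sin x) -
      (q * cos x + p * sin x) * (-(q * sin x) - p * cos x) = 2 * (p * q) := by
    linear_combination 2 * p * q * sin_sq_add_cos_sq x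
  refine ⟨isParallelogram_centralParallelogram ?_, ?_⟩
  · simp only [Matrix.cons_val_zero, Matrix.cons_val_one, Matrix.cons_val_fin_one]
    rw [hcross]
    positivity
  · simp [centralRectangle, centralParallelogram, PiLp.inner_apply, Fin.sum_univ_two]
    ring

theorem IsChord.isParallelogram_bdryPoint {Ω : Set Plane} (hh : IsSmoothSupport (supportFn Ω))
    {a φ b : ℝ} (hc : IsChord (supportFn Ω) a φ b) (hp : 0 < supportAt (supportFn Ω) a φ) :
    IsParallelogram (centralParallelogram (bdryPoint Ω a) (bdryPoint Ω b)) := by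
  obtain ⟨s, hs, hsub⟩ := hc.exists_sub_eq_smul hh
  rw [← normalForm_bdryPoint] at hp
  have hcross : bdryPoint Ω a 0 * bdryPoint Ω b 1 - bdryPoint Ω a 1 * bdryPoint Ω b 0 =
      s * normalForm (bdryPoint Ω a) φ := by
    rw [sub_eq_iff_eq_add.1 hsub]
    simp [normalForm, unitTangent]
    ring
  exact isParallelogram_centralParallelogram (hcross ▸ (mul_pos hs hp).ne')

theorem supportFn_periodic (Ω : Set Plane) : Function.Periodic (supportFn Ω) (2 * π) := fun x => by
  simp [supportFn]

theorem supportFn_add_pi {Ω : Set Plane} (h : ∀ x ∈ Ω, -x ∈ Ω) (ψ : ℝ) :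
    supportFn Ω (ψ + π) = supportFn Ω ψ := by
  have himage : (fun x : Plane => x 0 * cos (ψ + π) + x 1 * sin (ψ + π)) '' Ω =
      (fun x : Plane => x 0 * cos ψ + x 1 * sin ψ) '' Ω := by
    ext t
    constructor <;>
    · rintro ⟨x, hx, rfl⟩
      exact ⟨-x, h x hx, by simp⟩
  rw [supportFn, himage, supportFn]

namespace BilliardDatum

variable {r B : ℝ} {n : ℕ}

theorem uniformO_zero : UniformO (small r B) n ε fun _ _ => 0 :=
  UniformO.const le_rfl (by simp)

theorem uniformO_X_sub_add_mul (hn : n ≤ 4) (k : ℕ) :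
    UniformO (small r B) n ε fun D x => X k D x - (x + k * (π / 2)) := by
  induction k using Nat.twoStepInduction with
  | zero => exact uniformO_zero.congr fun D x => by simp
  | one => exact (uniformO_X_one_sub hn).congr fun D x => by simp
  | more k ih _ =>
    refine (ih.add (uniformO_X_add_two_sub hn k)).congr fun D x => ?_
    push_cast
    ring

theorem uniformO_h_X_sub (hn : n ≤ 4) (k : ℕ) :
    UniformO (small r B) n ε fun D x => D.h (D.X k x) - D.h (x + (k % 2 : ℕ) * (π / 2)) := by
  induction k using Nat.twoStepInduction with
  | zero => exact uniformO_zero.congr fun D x => by simp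
  | one => exact (uniformO_comp_X_one_sub hn (uniformO_h (by omega))).congr fun D x => by simp
  | more k ih _ =>
    refine (ih.add (uniformO_comp_X_sub_comp_X (by omega) (uniformO_h (by omega))
      (uniformO_h_add_pi_sub.of_le (by omega)) (uniformO_X_add_two_sub hn k))).congr fun D x => ?_
    rw [Nat.add_mod_right]
    ring

theorem uniformO_sin_X_sub (hn : n ≤ 4) (k : ℕ) :
    UniformO (small r B) n ε fun D x => sin (D.X k x) - sin (x + k * (π / 2)) :=
  UniformO.bdd_sin.comp_sub_comp (uniformO_X (by omega) k) (uniformO_add_const_sub _)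
    (uniformO_X_sub_add_mul hn k)

theorem uniformO_cos_X_sub (hn : n ≤ 4) (k : ℕ) :
    UniformO (small r B) n ε fun D x => cos (D.X k x) - cos (x + k * (π / 2)) :=
  UniformO.bdd_cos.comp_sub_comp (uniformO_X (by omega) k) (uniformO_add_const_sub _)
    (uniformO_X_sub_add_mul hn k)

theorem uniformO_X_succ_sub (hn : n ≤ 5) (k : ℕ) :
    UniformO (small r B) n 1 fun D x => D.X (k + 1) x - D.X k x :=
  ((uniformO_X hn (k + 1)).sub (uniformO_X hn k)).congr fun D x => by ring

theorem uniformO_one_sub_sin_X_succ_sub (hn : n ≤ 4) (k : ℕ) :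
    UniformO (small r B) n ε fun D x => 1 - sin (D.X (k + 1) x - D.X k x) :=
  (UniformO.bdd_sin.comp_bdd_sub_comp_bdd (UniformO.bdd_const (π / 2))
    (uniformO_X_succ_sub (by omega) k) (((uniformO_X_sub_add_mul hn k).sub
    (uniformO_X_sub_add_mul hn (k + 1))).congr fun D x => by push_cast; ring)).congr
    fun D x => by rw [sin_pi_div_two]

theorem uniformPos_sin_X_succ_sub (k : ℕ) :
    UniformPos (small r B) fun D x => sin (D.X (k + 1) x - D.X k x) :=
  UniformPos.of_sub (n := 0) (F := fun _ _ => 1)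
    ⟨1, one_pos, Eventually.of_forall fun _ _ => le_rfl⟩ tendsto_ε
    (uniformO_one_sub_sin_X_succ_sub (Nat.zero_le 4) k)

theorem uniformO_div_sin_X_succ_sub (hn : n ≤ 4) (k : ℕ) {N N' : BilliardDatum r B → ℝ → ℝ}
    (hN' : UniformO (small r B) n 1 N')
    (hN : UniformO (small r B) n ε fun D x => N D x - N' D x) :
    UniformO (small r B) n ε fun D x => N D x / sin (D.X (k + 1) x - D.X k x) - N' D x := by
  have hpos := uniformPos_sin_X_succ_sub (r := r) (B := B) k
  refine UniformO.of_mul_left ((hN.add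
    (hN'.bdd_mul (uniformO_one_sub_sin_X_succ_sub hn k))).congr' ?_)
    (UniformO.bdd_sin.comp_bdd (uniformO_X_succ_sub (by omega) k)) hpos
  filter_upwards [hpos.eventually_pos] with D hD x
  rw [mul_sub (sin _), mul_div_cancel₀ _ (hD x).ne']
  ring

theorem uniformO_h_add (hn : n ≤ 5) (a : ℝ) :
    UniformO (small r B) n 1 fun D x => D.h (x + a) :=
  (uniformO_h (by omega)).comp (uniformO_add_const_sub a)

theorem uniformO_h_X_mul_sin_X_sub (hn : n ≤ 4) (j k : ℕ) : UniformO (small r B) n ε fun D x =>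
    D.h (D.X j x) * sin (D.X k x) - D.h (x + (j % 2 : ℕ) * (π / 2)) * sin (x + k * (π / 2)) :=
  ((uniformO_h (by omega)).comp (uniformO_X (by omega) j)).mul_sub_mul
    (UniformO.bdd_sin.comp (uniformO_add_const_sub _)) (uniformO_h_X_sub hn j)
    (uniformO_sin_X_sub hn k)

theorem uniformO_h_X_mul_cos_X_sub (hn : n ≤ 4) (j k : ℕ) : UniformO (small r B) n ε fun D x =>
    D.h (D.X j x) * cos (D.X k x) - D.h (x + (j % 2 : ℕ) * (π / 2)) * cos (x + k * (π / 2)) :=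
  ((uniformO_h (by omega)).comp (uniformO_X (by omega) j)).mul_sub_mul
    (UniformO.bdd_cos.comp (uniformO_add_const_sub _)) (uniformO_h_X_sub hn j)
    (uniformO_cos_X_sub hn k)

theorem uniformO_lineMeet_zero_sub (hn : n ≤ 4) (k : ℕ) : UniformO (small r B) n ε fun D x =>
    lineMeet (D.X k x) (D.X (k + 1) x) (D.h (D.X k x)) (D.h (D.X (k + 1) x)) 0 -
      (D.h (x + (k % 2 : ℕ) * (π / 2)) * sin (x + (k + 1 : ℕ) * (π / 2)) -
        D.h (x + ((k + 1) % 2 : ℕ) * (π / 2)) * sin (x + k * (π / 2))) :=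
  have hmodel (j k : ℕ) : UniformO (small r B) n 1 fun D x =>
      D.h (x + (j % 2 : ℕ) * (π / 2)) * sin (x + k * (π / 2)) :=
    (uniformO_h_add (by omega) _).mul_bdd (UniformO.bdd_sin.comp (uniformO_add_const_sub _))
  uniformO_div_sin_X_succ_sub hn k ((hmodel k (k + 1)).sub (hmodel (k + 1) k))
    (((uniformO_h_X_mul_sin_X_sub hn k (k + 1)).sub
      (uniformO_h_X_mul_sin_X_sub hn (k + 1) k)).congr fun D x => sub_sub_sub_comm _ _ _ _)

theorem uniformO_lineMeet_one_sub (hn : n ≤ 4) (k : ℕ) : UniformO (small r B) n ε fun D x =>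
    lineMeet (D.X k x) (D.X (k + 1) x) (D.h (D.X k x)) (D.h (D.X (k + 1) x)) 1 -
      (D.h (x + ((k + 1) % 2 : ℕ) * (π / 2)) * cos (x + k * (π / 2)) -
        D.h (x + (k % 2 : ℕ) * (π / 2)) * cos (x + (k + 1 : ℕ) * (π / 2))) :=
  have hmodel (j k : ℕ) : UniformO (small r B) n 1 fun D x =>
      D.h (x + (j % 2 : ℕ) * (π / 2)) * cos (x + k * (π / 2)) :=
    (uniformO_h_add (by omega) _).mul_bdd (UniformO.bdd_cos.comp (uniformO_add_const_sub _))
  uniformO_div_sin_X_succ_sub hn k ((hmodel (k + 1) k).sub (hmodel k (k + 1)))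
    (((uniformO_h_X_mul_cos_X_sub hn (k + 1) k).sub
      (uniformO_h_X_mul_cos_X_sub hn k (k + 1))).congr fun D x => sub_sub_sub_comm _ _ _ _)

theorem uniformO_lineMeet_sub_centralRectangle (hn : n ≤ 4) (i : Fin 4) (j : Fin 2) :
    UniformO (small r B) n ε fun D x =>
      (lineMeet (D.X i x) (D.X (i + 1) x) (D.h (D.X i x)) (D.h (D.X (i + 1) x)) -
        centralRectangle (D.h x) (D.h (x + π / 2)) x i) j := by
  have hquarter_two (x : ℝ) : x + 2 * (π / 2) = x + π := by ring
  have hquarter_three (x : ℝ) : x + 3 * (π / 2) = x + π + π / 2 := by ring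
  have hquarter_four (x : ℝ) : x + 4 * (π / 2) = x + 2 * π := by ring
  fin_cases j
  · refine (uniformO_lineMeet_zero_sub hn i).congr fun D x => ?_
    fin_cases i <;> simp [centralRectangle, centralParallelogram, hquarter_two, hquarter_three,
      hquarter_four, sin_add_pi_div_two] <;> ring
  · refine (uniformO_lineMeet_one_sub hn i).congr fun D x => ?_
    fin_cases i <;> simp [centralRectangle, centralParallelogram, hquarter_two, hquarter_three,
      hquarter_four, cos_add_pi_div_two] <;> ring

theorem uniformO_comp_X_add_comp_X (hn : n ≤ 4) {G : BilliardDatum r B → ℝ → ℝ}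
    (hG : UniformO (small r B) (n + 1) 1 G)
    (hGπ : UniformO (small r B) n ε fun D x => G D (x + π) + G D x) (k : ℕ) :
    UniformO (small r B) n ε fun D x => G D (D.X (k + 2) x) + G D (D.X k x) := by
  have hX := uniformO_X (r := r) (B := B) (l := small r B) (n := n) (by omega)
  have hXπ : UniformO (small r B) n 1 fun D x => X k D x + π - x :=
    ((hX k).add (UniformO.bdd_const π)).congr fun D x => by ring
  have hsub : UniformO (small r B) n ε fun D x => X (k + 2) D x - (X k D x + π) :=
    (uniformO_X_add_two_sub hn k).congr fun D x => by ring
  exact ((hG.comp_sub_comp (hX _) hXπ hsub).add (hGπ.comp (hX k))).congr fun D x => by ring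

theorem uniformO_curvePoint_X_add (hn : n ≤ 4) (k : ℕ) (j : Fin 2) :
    UniformO (small r B) n ε fun D x =>
      curvePoint D.h (D.X (k + 2) x) j + curvePoint D.h (D.X k x) j := by
  have hh := uniformO_h (r := r) (B := B) (l := small r B) (n := n + 1) (by omega)
  have hh' := uniformO_deriv_h (r := r) (B := B) (l := small r B) (n := n + 1) (by omega)
  have hhπ := (uniformO_h_add_pi_sub (r := r) (B := B)).of_le (show n ≤ 5 by omega)
  have hhπ' := (uniformO_deriv_h_add_pi_sub (r := r) (B := B)).of_le hn
  refine uniformO_comp_X_add_comp_X hn (G := fun D x => curvePoint D.h x j) ?_ ?_ k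
  · fin_cases j
    · exact (hh.mul_bdd UniformO.bdd_cos).sub (hh'.mul_bdd UniformO.bdd_sin)
    · exact (hh.mul_bdd UniformO.bdd_sin).add (hh'.mul_bdd UniformO.bdd_cos)
  · fin_cases j
    · refine ((hhπ'.mul_bdd UniformO.bdd_sin).sub (hhπ.mul_bdd UniformO.bdd_cos)).congr
        fun D x => ?_
      simp [curvePoint]
      ring
    · refine ((hhπ.mul_bdd UniformO.bdd_sin).add (hhπ'.mul_bdd UniformO.bdd_cos)).neg.congr
        fun D x => ?_
      simp [curvePoint]
      ring

theorem uniformO_curvePoint_sub_centralParallelogram (hn : n ≤ 4) (i : Fin 4) (j : Fin 2) :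
    UniformO (small r B) n ε fun D x => (curvePoint D.h (D.X i x) -
      centralParallelogram (curvePoint D.h x) (curvePoint D.h (D.X 1 x)) i) j := by
  fin_cases i
  · exact uniformO_zero.congr fun D x => by simp [centralParallelogram]
  · exact uniformO_zero.congr fun D x => by simp [centralParallelogram]
  · exact (uniformO_curvePoint_X_add hn 0 j).congr fun D x => by simp [centralParallelogram]
  · exact (uniformO_curvePoint_X_add hn 1 j).congr fun D x => by simp [centralParallelogram]

/-- The estimates for a datum `D` which hold with one constant `C` for all data with small defect of
symmetry, with the positivity needed to draw the model parallelograms and rectangles. -/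
structure Estimates (C : ℝ) (D : BilliardDatum r B) : Prop where
  angle_pi : CBound 4 (C * D.ε) fun x => D.d (x + π) - D.d x
  angle_quarter : CBound 4 (C * D.ε) fun x => D.d (x + π / 2) - (π / 2 - D.d x)
  vertex : ∀ i : Fin 4, CBound 4 (C * D.ε) fun x => curvePoint D.h (D.X i x) -
    centralParallelogram (curvePoint D.h x) (curvePoint D.h (D.X 1 x)) i
  tangent : ∀ i : Fin 4, CBound 4 (C * D.ε) fun x =>
    lineMeet (D.X i x) (D.X (i + 1) x) (D.h (D.X i x)) (D.h (D.X (i + 1) x)) -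
      centralRectangle (D.h x) (D.h (x + π / 2)) x i
  sq_add : CBound 4 (C * D.ε) fun x => D.h x ^ 2 + D.h (x + π / 2) ^ 2 - D.R ^ 2
  sin_angle : CBound 4 (C * D.ε) fun x => D.h x - D.R * sin (D.d x)
  cos_angle : CBound 4 (C * D.ε) fun x => D.h (x + π / 2) - D.R * cos (D.d x)
  support_pos : ∀ x, 0 < D.h x
  support_chord_pos : ∀ x, 0 < supportAt D.h x (D.Y 0 x)
  sin_pos : ∀ (i : Fin 4) x, 0 < sin (D.X (i + 1) x - D.X i x)

theorem eventually_estimates : ∀ᶠ C in atTop, ∀ᶠ D in small r B, D.Estimates C := by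
  have hn : 4 ≤ 4 := le_rfl
  filter_upwards [(uniformO_d_add_pi_sub hn).eventually_cBound,
    (uniformO_d_add_pi_div_two_sub hn).eventually_cBound,
    eventually_all.2 fun i => UniformO.eventually_cBound_of_coords
      (uniformO_curvePoint_sub_centralParallelogram hn i),
    eventually_all.2 fun i => UniformO.eventually_cBound_of_coords
      (uniformO_lineMeet_sub_centralRectangle hn i),
    (uniformO_h_sq_add_sub (show 4 ≤ 5 by norm_num)).eventually_cBound,
    (uniformO_h_sub hn).eventually_cBound, (uniformO_h_add_pi_div_two_sub hn).eventually_cBound]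
    with C hangle hquarter hvertex htangent hsq hsin hcos
  filter_upwards [hangle, hquarter, eventually_all.2 hvertex, eventually_all.2 htangent, hsq, hsin,
    hcos, uniformPos_h.eventually_pos, uniformPos_supportAt_Y_zero.eventually_pos,
    eventually_all.2 fun i : Fin 4 => (uniformPos_sin_X_succ_sub i).eventually_pos]
    with D hangle hquarter hvertex htangent hsq hsin hcos hpos hpos_chord hpos_sin
  rw [abs_of_nonneg D.ε_nonneg] at hangle hquarter hsq hsin hcos
  simp only [abs_of_nonneg D.ε_nonneg] at hvertex htangent
  exact ⟨hangle, hquarter, hvertex, htangent, hsq, hsin, hcos, hpos, hpos_chord, hpos_sin⟩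

theorem exists_estimates (r B : ℝ) : ∃ C e : ℝ, 0 < C ∧ 0 < e ∧
    ∀ D : BilliardDatum r B, D.ε < e → D.Estimates C := by
  obtain ⟨C, hC, hCpos⟩ :=
    ((eventually_estimates (r := r) (B := B)).and (eventually_gt_atTop 0)).exists
  obtain ⟨e, he, hball⟩ := (Metric.nhds_basis_ball.comap ε).eventually_iff.1 hC
  refine ⟨C, e, hCpos, he, fun D hD => hball ?_⟩
  rwa [mem_preimage, mem_ball_zero_iff, Real.norm_eq_abs, abs_of_nonneg D.ε_nonneg]

theorem Estimates.exists_orbits {C : ℝ} {D : BilliardDatum r B} (hD : D.Estimates C) {Ω : Set Plane}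
    (hΩ : D.h = supportFn Ω) : ∃ z : ℝ → ℤ → ℝ × ℝ,
    (∀ ψ, IsOrbit Ω (z ψ) ∧ IsPeriodicOrbit 1 4 (z ψ) ∧ z ψ 0 = (ψ, D.d ψ)) ∧
    (∀ w, IsOrbit Ω w → IsPeriodicOrbit 1 4 w → w = z (w 0).1) ∧
    (∃ P : ℝ → Fin 4 → Plane, (∀ ψ, IsParallelogram (P ψ)) ∧
      ∀ i : Fin 4, CBound 4 (C * D.ε) fun ψ => bdryPoint Ω (z ψ ((i : ℕ) : ℤ)).1 - P ψ i) ∧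
    ∃ X Q : ℝ → Fin 4 → Plane,
      (∀ ψ, ∀ i : Fin 4, tangentLine Ω (z ψ ((i : ℕ) : ℤ)).1 ∩
        tangentLine Ω (z ψ (((i : ℕ) : ℤ) + 1)).1 = {X ψ i}) ∧
      (∀ ψ, IsRectangle (Q ψ)) ∧ ∀ i : Fin 4, CBound 4 (C * D.ε) fun ψ => X ψ i - Q ψ i := by
  have hsmooth : IsSmoothSupport (supportFn Ω) := hΩ ▸ D.smooth
  have hcurve : IsInvariantCurve (supportFn Ω) D.d D.f := hΩ ▸ D.curve
  obtain ⟨z, hz, hunique, hzX⟩ := hcurve.exists_isPeriodicOrbit hsmooth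
  have hzX (ψ : ℝ) (k : ℕ) : (z ψ k).1 = D.X k ψ := hzX ψ k
  refine ⟨z, hz, hunique,
    ⟨fun ψ => centralParallelogram (bdryPoint Ω ψ) (bdryPoint Ω (D.X 1 ψ)), fun ψ => ?_,
      fun i => ?_⟩,
    ⟨fun ψ i => lineMeet (D.X i ψ) (D.X (i + 1) ψ) (D.h (D.X i ψ)) (D.h (D.X (i + 1) ψ)),
      fun ψ => centralRectangle (D.h ψ) (D.h (ψ + π / 2)) ψ, fun ψ i => ?_,
      fun ψ => isRectangle_centralRectangle (hD.support_pos ψ) (hD.support_pos _) ψ,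
      hD.tangent⟩⟩
  · have hchord := D.isChord 0 ψ
    have hpos := hD.support_chord_pos ψ
    rw [hΩ] at hchord hpos
    exact hchord.isParallelogram_bdryPoint hsmooth hpos
  · have hvertex := hD.vertex i
    rw [hΩ] at hvertex
    simp only [hzX]
    exact hvertex
  · have hzX_succ := hzX ψ (i + 1)
    push_cast at hzX_succ
    rw [hzX, hzX_succ, hΩ]
    exact tangentLine_inter_tangentLine (hD.sin_pos i ψ).ne'

end BilliardDatum


theorem sub_le_add_deriv_deriv {h h₀ : ℝ → ℝ} {ε : ℝ} (hh : ContDiff ℝ 2 h)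
    (hh₀ : ContDiff ℝ 2 h₀) (hε : CBound 2 ε fun x => h x - h₀ x) (x : ℝ) :
    h₀ x + deriv (deriv h₀) x - 2 * ε ≤ h x + deriv (deriv h) x := by
  have hsecond := hε.2 2 le_rfl x
  rw [iteratedDeriv_fun_sub (by exact_mod_cast hh.contDiffAt) (by exact_mod_cast hh₀.contDiffAt),
    Real.norm_eq_abs] at hsecond
  simp only [iteratedDeriv_succ, iteratedDeriv_zero] at hsecond
  linarith [(abs_le.1 (hε.abs_le x)).1, (abs_le.1 hsecond).1]

theorem abs_sq_sub_sq_le {a b A B ε : ℝ} (ha : |a| ≤ A) (hb : |b| ≤ B) (hab : |a - b| ≤ ε) :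
    |a ^ 2 - b ^ 2| ≤ (A + B) * ε := by
  rw [sq_sub_sq, abs_mul]
  exact mul_le_mul ((abs_add_le a b).trans (add_le_add ha hb)) hab (abs_nonneg _)
    (by linarith [abs_nonneg a, abs_nonneg b])

theorem CBound.comp_add_const_sub_of_periodic {h h₀ : ℝ → ℝ} {n : ℕ} {ε T : ℝ}
    (hε : CBound n ε fun x => h x - h₀ x) (hh₀ : Function.Periodic h₀ T) :
    CBound n (2 * ε) fun x => h (x + T) - h x := by
  convert (hε.comp_add_const T).add (hε.const_mul (-1)) using 1
  · rw [abs_neg, abs_one]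
    ring
  · funext x
    rw [hh₀ x]
    ring

theorem le_add_deriv_deriv_of_curvature_lt {Ω : Set Plane} {κ ψ : ℝ} (hpos : 0 < curvature Ω ψ)
    (hlt : curvature Ω ψ < κ) : κ⁻¹ ≤ supportFn Ω ψ + deriv (deriv (supportFn Ω)) ψ := by
  have hκ := hpos.trans hlt
  simp only [curvature, iteratedDeriv_succ, iteratedDeriv_zero] at hpos hlt
  exact ((inv_lt_comm₀ (inv_pos.1 hpos) hκ).1 hlt).le

theorem exists_billiardDatum {r M ε : ℝ} {Ω₀ Ω K : Set Plane} {m : ℕ} (hm : 6 ≤ m) (hr : 0 < r)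
    (hsymm : ∀ x ∈ Ω₀, -x ∈ Ω₀)
    (hd₀ : ContDiff ℝ m (supportFn Ω₀)) (hM₀ : cNorm m (supportFn Ω₀) < M)
    (hk : ∀ ψ, 2 * r ≤ supportFn Ω₀ ψ + deriv (deriv (supportFn Ω₀)) ψ)
    (hΩ : IsTable Ω) (hd : ContDiff ℝ m (supportFn Ω)) (hM : cNorm m (supportFn Ω) < 2 * M)
    (hε : ε = cNorm 5 (fun ψ => supportFn Ω ψ - supportFn Ω₀ ψ)) (hεr : 2 * ε ≤ r)
    (hK : IsRationalCaustic 4 Ω K) :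
    ∃ D : BilliardDatum r (2 * M), D.h = supportFn Ω ∧ D.ε = ε ∧
      D.R = √(supportFn Ω₀ 0 ^ 2 + supportFn Ω₀ (π / 2) ^ 2) := by
  have hbound₀ := CBound.cNorm hd₀ two_pi_pos.ne' (supportFn_periodic Ω₀)
  have hbound := CBound.cNorm hd two_pi_pos.ne' (supportFn_periodic Ω)
  have hclose : CBound 5 ε fun ψ => supportFn Ω ψ - supportFn Ω₀ ψ :=
    hε ▸ CBound.cNorm ((hd.sub hd₀).of_le (by exact_mod_cast (by omega : 5 ≤ m))) two_pi_pos.ne'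
      ((supportFn_periodic Ω).sub (supportFn_periodic Ω₀))
  have hε₀ : 0 ≤ ε := (abs_nonneg _).trans (hclose.abs_le 0)
  have hm₂ : (2 : WithTop ℕ∞) ≤ m := by exact_mod_cast (by omega : 2 ≤ m)
  have hcurv (x : ℝ) : r ≤ supportFn Ω x + deriv (deriv (supportFn Ω)) x := by
    linarith [hk x, sub_le_add_deriv_deriv (hd.of_le hm₂) (hd₀.of_le hm₂)
      (hclose.mono (by norm_num) le_rfl) x]
  have hsmooth : IsSmoothSupport (supportFn Ω) :=
    ⟨hd.of_le hm₂, supportFn_periodic Ω, fun x => hr.trans_le (hcurv x)⟩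
  obtain ⟨d, f, hcurve⟩ := hK.exists_isInvariantCurve hΩ.isCompact hsmooth
  have hsq (x : ℝ) : |supportFn Ω x ^ 2 - supportFn Ω₀ x ^ 2| ≤ (2 * M + M) * ε :=
    abs_sq_sub_sq_le ((hbound.abs_le x).trans hM.le) ((hbound₀.abs_le x).trans hM₀.le)
      (hclose.abs_le x)
  have hMε : 0 ≤ M * ε := by linarith [(abs_nonneg _).trans (hsq 0)]
  refine ⟨⟨supportFn Ω, d, f, ε, √(supportFn Ω₀ 0 ^ 2 + supportFn Ω₀ (π / 2) ^ 2), hr,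
    hbound.mono hm hM.le, hsmooth, hcurv, hcurve, hε₀,
    hclose.comp_add_const_sub_of_periodic (supportFn_add_pi hsymm), sqrt_nonneg _, ?_⟩,
    rfl, rfl, rfl⟩
  rw [sq_sqrt (by positivity), add_sub_add_comm]
  linarith [abs_add_le (supportFn Ω 0 ^ 2 - supportFn Ω₀ 0 ^ 2)
    (supportFn Ω (π / 2) ^ 2 - supportFn Ω₀ (π / 2) ^ 2), hsq 0, hsq (π / 2)]

theorem theorem3_general :
    ∀ κ₁ M : ℝ,
    ∃ ε₁ C : ℝ, 0 < ε₁ ∧ 0 < C ∧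
    ∀ m : ℕ, 6 ≤ m →
    ∀ Ω₀ : Set Plane, IsTable Ω₀ → (∀ x ∈ Ω₀, -x ∈ Ω₀) →
      ContDiff ℝ m (supportFn Ω₀) → cNorm m (supportFn Ω₀) < M →
      (∀ ψ, 0 < curvature Ω₀ ψ ∧ curvature Ω₀ ψ < κ₁) →
    ∃ R₀ : ℝ, 0 < R₀ ∧
    ∀ Ω : Set Plane, IsTable Ω →
      ContDiff ℝ m (supportFn Ω) → cNorm m (supportFn Ω) < 2 * M →
    ∀ ε : ℝ, ε = cNorm 5 (fun ψ => supportFn Ω ψ - supportFn Ω₀ ψ) → ε < ε₁ →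
      (∃ K : Set Plane, IsRationalCaustic 4 Ω K) →
    ∃ d : ℝ → ℝ, IsLoopAngle Ω 4 d ∧
      CBound 4 (C * ε) (fun ψ => d (ψ + π) - d ψ) ∧
      CBound 4 (C * ε) (fun ψ => d (ψ + π / 2) - (π / 2 - d ψ)) ∧
      (∃ z : ℝ → ℤ → ℝ × ℝ,
        (∀ ψ, IsOrbit Ω (z ψ) ∧ IsPeriodicOrbit 1 4 (z ψ) ∧ z ψ 0 = (ψ, d ψ)) ∧
        (∀ w, IsOrbit Ω w → IsPeriodicOrbit 1 4 w → w = z (w 0).1) ∧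
        (∃ P : ℝ → Fin 4 → Plane, (∀ ψ, IsParallelogram (P ψ)) ∧
          ∀ i : Fin 4, CBound 4 (C * ε)
            (fun ψ => bdryPoint Ω (z ψ ((i : ℕ) : ℤ)).1 - P ψ i)) ∧
        (∃ X Q : ℝ → Fin 4 → Plane,
          (∀ ψ, ∀ i : Fin 4,
            tangentLine Ω (z ψ ((i : ℕ) : ℤ)).1 ∩ tangentLine Ω (z ψ (((i : ℕ) : ℤ) + 1)).1
              = {X ψ i}) ∧
          (∀ ψ, IsRectangle (Q ψ)) ∧
          ∀ i : Fin 4, CBound 4 (C * ε) (fun ψ => X ψ i - Q ψ i))) ∧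
      CBound 4 (C * ε)
        (fun ψ => supportFn Ω ψ ^ 2 + supportFn Ω (ψ + π / 2) ^ 2 - R₀ ^ 2) ∧
      CBound 4 (C * ε) (fun ψ => supportFn Ω ψ - R₀ * sin (d ψ)) ∧
      CBound 4 (C * ε) (fun ψ => supportFn Ω (ψ + π / 2) - R₀ * cos (d ψ)) := by
  intro κ₁ M
  set κ := max κ₁ 1
  have hr : 0 < κ⁻¹ / 2 := half_pos (inv_pos.2 (lt_max_of_lt_right one_pos))
  obtain ⟨C, e, hC, he, hestimates⟩ := BilliardDatum.exists_estimates (κ⁻¹ / 2) (2 * M)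
  refine ⟨min e (κ⁻¹ / 2 / 2), C, lt_min he (half_pos hr), hC, ?_⟩
  intro m hm Ω₀ hΩ₀ hsymm hd₀ hM₀ hcurv
  have hpos : 0 < supportFn Ω₀ 0 := by
    simpa [normalForm] using normalForm_lt_supportFn hΩ₀.isCompact hΩ₀.origin_mem 0
  refine ⟨√(supportFn Ω₀ 0 ^ 2 + supportFn Ω₀ (π / 2) ^ 2), sqrt_pos.2 (by positivity), ?_⟩
  intro Ω hΩ hd hM ε hε hε₁ ⟨K, hK⟩
  have hk (ψ : ℝ) : 2 * (κ⁻¹ / 2) ≤ supportFn Ω₀ ψ + deriv (deriv (supportFn Ω₀)) ψ :=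
    (mul_div_cancel₀ _ two_ne_zero).trans_le (le_add_deriv_deriv_of_curvature_lt (hcurv ψ).1
      ((hcurv ψ).2.trans_le (le_max_left _ _)))
  obtain ⟨hεe, hεr⟩ := lt_min_iff.1 hε₁
  obtain ⟨D, hDh, rfl, hDR⟩ :=
    exists_billiardDatum hm hr hsymm hd₀ hM₀ hk hΩ hd hM hε (by linarith) hK
  have hD := hestimates D hεe
  have hloop : IsLoopAngle Ω 4 D.d := (hDh ▸ D.curve).isLoopAngle (hDh ▸ D.smooth)
  rw [← hDR, ← hDh]
  exact ⟨D.d, hloop, hD.angle_pi, hD.angle_quarter, hD.exists_orbits hDh, hD.sq_add,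
    hD.sin_angle, hD.cos_angle⟩

theorem theorem3 :
    ∀ κ₀ κ₁ M : ℝ, 0 < κ₀ →
    -- the constants depend on the curvature bounds and on `M` only
    ∃ ε₁ C : ℝ, 0 < ε₁ ∧ 0 < C ∧
    ∀ m : ℕ, 40 ≤ m →
    -- the centrally symmetric table
    ∀ Ω₀ : Set Plane, IsTable Ω₀ → (∀ x ∈ Ω₀, -x ∈ Ω₀) →
      ContDiff ℝ m (supportFn Ω₀) → cNorm m (supportFn Ω₀) < M →
      (∀ ψ, κ₀ < curvature Ω₀ ψ ∧ curvature Ω₀ ψ < κ₁) →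
    ∃ R₀ : ℝ, 0 < R₀ ∧
    -- the nearby table and its caustic
    ∀ Ω : Set Plane, IsTable Ω →
      ContDiff ℝ m (supportFn Ω) → cNorm m (supportFn Ω) < 2 * M →
    ∀ ε : ℝ, ε = cNorm 5 (fun ψ => supportFn Ω ψ - supportFn Ω₀ ψ) → ε < ε₁ →
      (∃ K : Set Plane, IsRationalCaustic 4 Ω K) →
    ∃ d : ℝ → ℝ, IsLoopAngle Ω 4 d ∧
      CBound 3 (C * ε) (fun ψ => d (ψ + π) - d ψ) ∧
      CBound 2 (C * ε) (fun ψ => d (ψ + π / 2) - (π / 2 - d ψ)) ∧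
      -- `z ψ` is the one periodic orbit that starts at the point with parameter `ψ`
      (∃ z : ℝ → ℤ → ℝ × ℝ,
        (∀ ψ, IsOrbit Ω (z ψ) ∧ IsPeriodicOrbit 1 4 (z ψ) ∧ z ψ 0 = (ψ, d ψ)) ∧
        (∀ w, IsOrbit Ω w → IsPeriodicOrbit 1 4 w → w = z (w 0).1) ∧
        -- its vertices are close to those of a parallelogram
        (∃ P : ℝ → Fin 4 → Plane, (∀ ψ, IsParallelogram (P ψ)) ∧
          ∀ i : Fin 4, CBound 2 (C * ε)
            (fun ψ => bdryPoint Ω (z ψ ((i : ℕ) : ℤ)).1 - P ψ i)) ∧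
        -- the tangent lines at its vertices meet in points `X ψ i` close to those of a rectangle
        (∃ X Q : ℝ → Fin 4 → Plane,
          (∀ ψ, ∀ i : Fin 4,
            tangentLine Ω (z ψ ((i : ℕ) : ℤ)).1 ∩ tangentLine Ω (z ψ (((i : ℕ) : ℤ) + 1)).1
              = {X ψ i}) ∧
          (∀ ψ, IsRectangle (Q ψ)) ∧
          ∀ i : Fin 4, CBound 2 (C * ε) (fun ψ => X ψ i - Q ψ i))) ∧
      CBound 3 (C * ε)
        (fun ψ => supportFn Ω ψ ^ 2 + supportFn Ω (ψ + π / 2) ^ 2 - R₀ ^ 2) ∧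
      CBound 2 (C * ε) (fun ψ => supportFn Ω ψ - R₀ * sin (d ψ)) ∧
      CBound 2 (C * ε) (fun ψ => supportFn Ω (ψ + π / 2) - R₀ * cos (d ψ)) := by
  intro κ₀ κ₁ M hκ₀
  refine (?_ : _ → _) (theorem3_general κ₁ M)
  gcongr <;> norm_num
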